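/- **Setting.** Let $L>0$, let $q_0,q_1\in\mathbb R^m$ with $|q_1-q_0|<L$, and let $N_0,N_1\in\mathbb R^m$ be unit vectors. For an immersed curve $\gamma\colon[0,L]\to\mathbb R^m$ write $\tau_\gamma=\gamma'/|\gamma'|$ and $\sigma_\gamma=\log|\gamma'|$. Fix $p\in[2,\infty]$ and let $$\mathcal C=\{\gamma\in W^{2,p}([0,L];\mathbb R^m)\ \text{immersed}:\ \gamma(0)=q_0,\ \gamma(L)=q_1,\ \tau_\gamma(0)=N_0,\ \tau_\gamma(L)=N_1,\ \sigma_\gamma=0\},$$ $$\mathcal A=\{\gamma\in\mathcal C\cap W^{3,\infty}:\ \|\gamma''\|_{L^\infty}\le K_1,\ \|\gamma'''\|_{L^\infty}\le K_1\},\qquad K_1\ge 0.$$ Let $T$ be a partition $0=t_0<\dots<t_n=L$ with edges $I_k=[t_k,t_{k+1}]$, lengths $\ell_0(k)=t_{k+1}-t_k$, midpoints $m_k$ and $h(T)=\max_k\ell_0(k)$. For a polygon $P\colon\{t_0,\dots,t_n\}\to\mathbb R^m$ with distinct successive vertices $P_i=P(t_i)$ let $\ell_P(k)=|P_{k+1}-P_k|$,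 $\tau_P(k)=(P_{k+1}-P_k)/\ell_P(k)$, and, for $1\le i\le n-1$, $\bar\ell_P(i)=\tfrac12(\ell_P(i-1)+\ell_P(i))$ and $\kappa_P(i)=(\tau_P(i)-\tau_P(i-1))/\bar\ell_P(i)$. Let $$\mathcal C_T=\{P:\ P_0=q_0,\ P_n=q_1,\ \tau_P(0)=N_0,\ \tau_P(n-1)=N_1,\ \ell_P=\ell_0\},$$ $$\mathcal A_T=\Big\{P\in\mathcal C_T:\ \max_{1\le i\le n-1}|\kappa_P(i)|\le K_2,\ \sum_{i=1}^{n-2}|\kappa_P(i+1)-\kappa_P(i)|\le K_2\Big\}.$$ **Restoration.** For a unit vector $\tau$ let $\mathrm{pr}_\tau^\perp$ be the orthogonal projection to $\tau^\perp$, and let $b(s)=(1-s)^2V_0+(1-s)s\,V+s^2V_1$. For an immersed curve $\gamma$ with normalized arc length parameter $\varphi_\gamma\colon[0,L]\to[0,1]$, let $\mathcal R_\gamma$ be the set of all fields $$u(t)=U_0+\int_0^t\big(\lambda(r)\,\tau_\gamma(r)+\mathrm{pr}^\perp_{\tau_\gamma(r)}b(\varphi_\gamma(r))\big)|\gamma'(r)|\,dr$$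 with $\lambda$ continuous, $U_0,V\in\mathbb R^m$, $V_0\perp\tau_\gamma(0)$, $V_1\perp\tau_\gamma(L)$ (the image of the right inverse of the differential of the constraint map at $\gamma$). For a polygon $P$ let $\mathcal R_P$ be the set of all $$u_i=U_0+\sum_{k<i}\big(\lambda_k\tau_P(k)+\mathrm{pr}^\perp_{\tau_P(k)}b(\varphi_P(k))\big)\ell_P(k),\qquad \varphi_P(k)=\frac{\sum_{j=1}^{k}\bar\ell_P(j)}{\sum_{j=1}^{n-1}\bar\ell_P(j)},$$ with $\lambda_k\in\mathbb R$, $U_0,V\in\mathbb R^m$, $V_0\perp\tau_P(0)$, $V_1\perp\tau_P(n-1)$. Given $\rho>0$, a *restoration* of $\gamma$ is a $\delta\in\mathcal C$ with $\delta-\gamma\in\mathcal R_\gamma$ and $|\delta-\gamma|\le\rho$, $|\delta'-\gamma'|\le\rho$ on $[0,L]$; a restoration of $P$ is a $Q\in\mathcal C_T$ with $Q-P\in\mathcal R_P$ for which $Q-P$ and its difference quotients over the edges (with respect to $\ell_0$) have norm at most $\rho$. **Reconstruction $R$.** For $P\in\mathcal A_T$ let $\tau\colon[0,L]\to\mathbb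 S^{m-1}$ be the curve with $\tau(m_k)=\tau_P(k)$ that is a constant-speed geodesic on each $[m_k,m_{k+1}]$, where the first and the last of these geodesics are continued up to $0$ and $L$. Then $R(P)$ is the restoration of $t\mapsto q_0+\int_0^t\tau(r)\,dr$. **Sampling $S$.** For $\gamma\in\mathcal A$ let $P_i=\gamma(0)+\sum_{k<i}\ell_0(k)\,\dfrac{\gamma(t_{k+1})-\gamma(t_k)}{|\gamma(t_{k+1})-\gamma(t_k)|}$. Then $S(\gamma)$ is the restoration of this polygon. **Theorem ($W^{2,\infty}$-proximity).** There is $K_0\ge0$ such that for every $K_2\ge K_0$ there are $\rho>0$, $h_0>0$ and $C\ge0$ with the following properties for every partition $T$ of $[0,L]$ with $h(T)\le h_0$: 1. For every $\gamma\in\mathcal A$ the restoration that defines $S(\gamma)$ exists and is unique, and $S(\gamma)\in\mathcal A_T$. 2. For every $P\in\mathcal A_T$ the restoration that defines $R(P)\in\mathcal C$ exists and is unique. 3. For every $\gamma\in\mathcal A$, $$\|\gamma-R(S(\gamma))\|_{W^{2,\infty}}\le C\,h(T).$$ -/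

import Mathlib

open Set MeasureTheory
open scoped ENNReal NNReal

noncomputable section

namespace Elastica

/-- The ambient Euclidean space. -/
abbrev E (m : ℕ) := EuclideanSpace ℝ (Fin m)

/-- The curve length `L`, which is also the length of the parameter interval `[0, L]`, and clamped
boundary conditions: end points `q0`, `q1` and unit end tangents `N0`, `N1`. -/
structure ClampedData (m : ℕ) where
  L : ℝ
  L_pos : 0 < L
  q0 : E m
  q1 : E m
  N0 : E m
  N1 : E m
  norm_N0 : ‖N0‖ = 1
  norm_N1 : ‖N1‖ = 1

/-! ### Sobolev spaces on the interval `[0, L]` -/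

section Sobolev

variable {F : Type*} [NormedAddCommGroup F] [NormedSpace ℝ F]

/-- The integrable function `v` is the weak derivative of the integrable function `u` on
`(0, L)`, tested against smooth functions with compact support in `(0, L)`. -/
def HasWeakDeriv (L : ℝ) (u v : ℝ → F) : Prop :=
  IntegrableOn u (Icc 0 L) ∧ IntegrableOn v (Icc 0 L) ∧
    ∀ φ : ℝ → ℝ, ContDiff ℝ (⊤ : ℕ∞) φ → HasCompactSupport φ → tsupport φ ⊆ Ioo 0 L →
      ∫ t in (0 : ℝ)..L, deriv φ t • u t = -∫ t in (0 : ℝ)..L, φ t • v t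

/-- `D 0 = u`, `D 1`, ..., `D k` are the successive weak derivatives of `u` up to order `k`. -/
def AreWeakDerivs (L : ℝ) (k : ℕ) (u : ℝ → F) (D : ℕ → ℝ → F) : Prop :=
  D 0 = u ∧ ∀ j < k, HasWeakDeriv L (D j) (D (j + 1))

/-- Membership in `W^{k,p}([0, L]; F)`. -/
def MemSobolev (L : ℝ) (k : ℕ) (p : ℝ≥0∞) (u : ℝ → F) : Prop :=
  ∃ D : ℕ → ℝ → F, AreWeakDerivs L k u D ∧
    ∀ j ≤ k, MemLp (D j) p (volume.restrict (Icc 0 L))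

/-- The seminorm `|u|_{W^{k,p}}`, the `L^p` norm of the `k`-th weak derivative. Weak derivatives
are unique almost everywhere, so the infimum is over equal values; it is `⊤` if `u` has no weak
derivatives up to order `k`. -/
def sobolevSeminorm (L : ℝ) (k : ℕ) (p : ℝ≥0∞) (u : ℝ → F) : ℝ≥0∞ :=
  ⨅ (D : ℕ → ℝ → F) (_ : AreWeakDerivs L k u D), eLpNorm (D k) p (volume.restrict (Icc 0 L))

/-- The norm `‖u‖_{W^{k,p}}`, the sum of the `L^p` norms of the weak derivatives of orders
`0, ..., k`; it is `⊤` if `u` has no weak derivatives up to order `k`. -/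
def sobolevNorm (L : ℝ) (k : ℕ) (p : ℝ≥0∞) (u : ℝ → F) : ℝ≥0∞ :=
  ⨅ (D : ℕ → ℝ → F) (_ : AreWeakDerivs L k u D),
    ∑ j ∈ Finset.range (k + 1), eLpNorm (D j) p (volume.restrict (Icc 0 L))

end Sobolev

variable {m : ℕ}

/-! ### Curves

A curve is a function on `ℝ` of which only the values on `[0, L]` matter. Elements of `W^{2,p}` are
represented by their continuous representatives; these are `C^1` on `[0, L]`, so that the
derivative is a classical one. -/

/-- The derivative of a curve on `[0, L]`, one-sided at the end points. -/
def velocity (L : ℝ) (γ : ℝ → E m) (t : ℝ) : E m := derivWithin γ (Icc 0 L) t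

/-- Logarithmic strain. -/
def strain (L : ℝ) (γ : ℝ → E m) (t : ℝ) : ℝ := Real.log ‖velocity L γ t‖

/-- Unit tangent. -/
def tangent (L : ℝ) (γ : ℝ → E m) (t : ℝ) : E m := ‖velocity L γ t‖⁻¹ • velocity L γ t

/-- Immersions of class `W^{2,p}`: the logarithmic strain is finite and bounded. -/
def immersions (m : ℕ) (L : ℝ) (p : ℝ≥0∞) : Set (ℝ → E m) :=
  {γ | ContinuousOn γ (Icc 0 L) ∧ MemSobolev L 2 p γ ∧
    ∃ B : ℝ, ∀ t ∈ Icc 0 L, velocity L γ t ≠ 0 ∧ |strain L γ t| ≤ B}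

/-- The smooth feasible set: the boundary conditions hold and the logarithmic strain vanishes. -/
def feasible (d : ClampedData m) (p : ℝ≥0∞) : Set (ℝ → E m) :=
  {γ | γ ∈ immersions m d.L p ∧ γ 0 = d.q0 ∧ γ d.L = d.q1 ∧
    tangent d.L γ 0 = d.N0 ∧ tangent d.L γ d.L = d.N1 ∧ ∀ t ∈ Icc 0 d.L, strain d.L γ t = 0}

/-- The smooth a priori set. -/
def priors (d : ClampedData m) (p : ℝ≥0∞) (K₁ : ℝ) : Set (ℝ → E m) :=
  {γ | γ ∈ feasible d p ∧ MemSobolev d.L 3 ∞ γ ∧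
    sobolevSeminorm d.L 2 ∞ γ ≤ ENNReal.ofReal K₁ ∧
    sobolevSeminorm d.L 3 ∞ γ ≤ ENNReal.ofReal K₁}

/-! ### Partitions and polygons -/

/-- A finite partition `0 = t 0 < t 1 < ... < t n = L`; values `t i` with `i > n` are irrelevant.
The edge with number `k < n` is `[t k, t (k + 1)]`. -/
structure Partition (L : ℝ) where
  n : ℕ
  n_pos : 0 < n
  t : ℕ → ℝ
  t_zero : t 0 = 0
  t_last : t n = L
  t_lt : ∀ i < n, t i < t (i + 1)

namespace Partition

variable {L : ℝ} (T : Partition L)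

/-- Reference edge lengths. -/
def len (k : ℕ) : ℝ := T.t (k + 1) - T.t k

/-- The maximal edge length `h(T)`. -/
def mesh : ℝ := (Finset.range T.n).sup' (Finset.nonempty_range_iff.2 T.n_pos.ne') T.len

/-- Edge midpoints. -/
def mid (k : ℕ) : ℝ := (T.t k + T.t (k + 1)) / 2

/-- Dual reference length of the interior vertex `t (j + 1)`. -/
def dualLen (j : ℕ) : ℝ := (T.len j + T.len (j + 1)) / 2

end Partition

/-- A polygon on a partition with `n` edges is given by its vertices `P 0, ..., P n`; the values
`P i` with `i > n` are irrelevant. -/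
abbrev Polygon (m : ℕ) := ℕ → E m

/-- Edge lengths of a polygon. -/
def edgeLen (P : Polygon m) (k : ℕ) : ℝ := ‖P (k + 1) - P k‖

/-- Unit edge vectors of a polygon. -/
def edgeTangent (P : Polygon m) (k : ℕ) : E m := (edgeLen P k)⁻¹ • (P (k + 1) - P k)

/-- Dual edge length at the interior vertex with number `j + 1`. -/
def dualEdgeLen (P : Polygon m) (j : ℕ) : ℝ := (edgeLen P j + edgeLen P (j + 1)) / 2

/-- Discrete curvature vector at the interior vertex with number `j + 1`. -/
def discreteCurvature (P : Polygon m) (j : ℕ) : E m :=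
  (dualEdgeLen P j)⁻¹ • (edgeTangent P (j + 1) - edgeTangent P j)

/-- The discrete seminorm `|P|_{w^{2,∞}_P}`: the maximum of the norms of the curvature vectors at
the interior vertices. -/
def discreteSecondSup {L : ℝ} (T : Partition L) (P : Polygon m) : ℝ≥0 :=
  (Finset.range (T.n - 1)).sup fun j => ‖discreteCurvature P j‖₊

/-- The discrete seminorm `|P|_{tv^3_P}`: the sum, over the interior edges (those with numbers
`1, ..., n - 2`), of the norm of the difference quotient of the curvature times edge length. -/
def discreteThirdTV {L : ℝ} (T : Partition L) (P : Polygon m) : ℝ :=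
  ∑ j ∈ Finset.range (T.n - 2),
    ‖(edgeLen P (j + 1))⁻¹ • (discreteCurvature P (j + 1) - discreteCurvature P j)‖ *
      edgeLen P (j + 1)

/-- The discrete feasible set: discrete immersions (no edge has length zero) that satisfy the
boundary conditions and have vanishing logarithmic strain. -/
def discreteFeasible (d : ClampedData m) (T : Partition d.L) : Set (Polygon m) :=
  {P | (∀ k < T.n, P (k + 1) ≠ P k) ∧ P 0 = d.q0 ∧ P T.n = d.q1 ∧
    edgeTangent P 0 = d.N0 ∧ edgeTangent P (T.n - 1) = d.N1 ∧
    ∀ k < T.n, Real.log (edgeLen P k / T.len k) = 0}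

/-- The discrete a priori set. -/
def discretePriors (d : ClampedData m) (T : Partition d.L) (K₂ : ℝ) : Set (Polygon m) :=
  {P | P ∈ discreteFeasible d T ∧ (discreteSecondSup T P : ℝ) ≤ K₂ ∧ discreteThirdTV T P ≤ K₂}

/-! ### The right inverses of the differentials of the constraint maps -/

/-- Orthogonal projection of `v` to the orthogonal complement of the unit vector `τ`. -/
def projPerp (τ v : E m) : E m := v - inner ℝ τ v • τ

/-- The quadratic polynomial in `s` used in both right inverses. -/
def blend (s : ℝ) (V₀ V V₁ : E m) : E m :=
  (1 - s) ^ 2 • V₀ + ((1 - s) * s) • V + s ^ 2 • V₁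

/-- Normalized arc length parameter of a curve. -/
def arcParam (L : ℝ) (γ : ℝ → E m) (r : ℝ) : ℝ :=
  (∫ s in (0 : ℝ)..r, ‖velocity L γ s‖) / ∫ s in (0 : ℝ)..L, ‖velocity L γ s‖

/-- The vector field along `γ` with initial value `U₀`, tangential strain rate `lam` and normal
rate of rotation given by `V₀`, `V`, `V₁`. The right inverse of the differential of the constraint
map at `γ` takes `(U₀, U₁, V₀, V₁, lam)`, with `V₀` and `V₁` orthogonal to the end tangents, to
this field, where `V` is such that the value at `L` is `U₁`. -/
def fieldAlong (L : ℝ) (γ : ℝ → E m) (U₀ V₀ V V₁ : E m) (lam : ℝ → ℝ) (t : ℝ) : E m :=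
  U₀ + ∫ r in (0 : ℝ)..t, ‖velocity L γ r‖ • (lam r • tangent L γ r +
    projPerp (tangent L γ r) (blend (arcParam L γ r) V₀ V V₁))

/-- The image of the right inverse at `γ`. As `U₁` is arbitrary, `V` is arbitrary. If the field is
in `W^{2,p}`, then `lam` is automatically in `W^{1,p}`. -/
def InRightInverseImage (L : ℝ) (γ u : ℝ → E m) : Prop :=
  ∃ (U₀ V₀ V V₁ : E m) (lam : ℝ → ℝ),
    inner ℝ (tangent L γ 0) V₀ = 0 ∧ inner ℝ (tangent L γ L) V₁ = 0 ∧
    ContinuousOn lam (Icc 0 L) ∧ ∀ t ∈ Icc 0 L, u t = fieldAlong L γ U₀ V₀ V V₁ lam t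

/-- Normalized distance of the edge with number `k` from the first edge, measured along the polygon
between edge midpoints; it is `0` on the first and `1` on the last of the `n` edges. -/
def edgeParam (n : ℕ) (P : Polygon m) (k : ℕ) : ℝ :=
  (∑ j ∈ Finset.range k, dualEdgeLen P j) / ∑ j ∈ Finset.range (n - 1), dualEdgeLen P j

/-- Discrete version of `fieldAlong`. -/
def discreteFieldAlong (n : ℕ) (P : Polygon m) (U₀ V₀ V V₁ : E m) (lam : ℕ → ℝ) (i : ℕ) : E m :=
  U₀ + ∑ k ∈ Finset.range i, edgeLen P k • (lam k • edgeTangent P k +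
    projPerp (edgeTangent P k) (blend (edgeParam n P k) V₀ V V₁))

/-- Discrete version of `InRightInverseImage`, for polygons with `n` edges. -/
def InDiscreteRightInverseImage (n : ℕ) (P u : Polygon m) : Prop :=
  ∃ (U₀ V₀ V V₁ : E m) (lam : ℕ → ℝ),
    inner ℝ (edgeTangent P 0) V₀ = 0 ∧ inner ℝ (edgeTangent P (n - 1)) V₁ = 0 ∧
    ∀ i ≤ n, u i = discreteFieldAlong n P U₀ V₀ V V₁ lam i

/-! ### Restoration operators -/

/-- `δ` is a zero of the constraint map in the slice through `γ` in the direction of the image of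
the right inverse at `γ`, and its `C^1` distance from `γ` is at most `ρ`. -/
structure IsRestoration (d : ClampedData m) (p : ℝ≥0∞) (ρ : ℝ) (γ δ : ℝ → E m) : Prop where
  feasible : δ ∈ feasible d p
  slice : InRightInverseImage d.L γ (fun t => δ t - γ t)
  close : ∀ t ∈ Icc 0 d.L, ‖δ t - γ t‖ ≤ ρ ∧ ‖velocity d.L δ t - velocity d.L γ t‖ ≤ ρ

open Classical in
/-- The smooth restoration operator: the curve `δ` with `IsRestoration d p ρ γ δ`, if there is one
(and then it is unique on `[0, L]` for small `ρ`). -/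
def restore (d : ClampedData m) (p : ℝ≥0∞) (ρ : ℝ) (γ : ℝ → E m) : ℝ → E m :=
  if h : ∃ δ, IsRestoration d p ρ γ δ then h.choose else γ

/-- `Q` is a zero of the discrete constraint map in the slice through `P` in the direction of the
image of the right inverse at `P`, and `Q - P` and its difference quotients are bounded by `ρ`. -/
structure IsDiscreteRestoration (d : ClampedData m) (T : Partition d.L) (ρ : ℝ)
    (P Q : Polygon m) : Prop where
  feasible : Q ∈ discreteFeasible d T
  slice : InDiscreteRightInverseImage T.n P (fun i => Q i - P i)
  close : ∀ i ≤ T.n, ‖Q i - P i‖ ≤ ρ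
  close_diff : ∀ k < T.n, ‖(T.len k)⁻¹ • ((Q (k + 1) - P (k + 1)) - (Q k - P k))‖ ≤ ρ

open Classical in
/-- The discrete restoration operator. -/
def discreteRestore (d : ClampedData m) (T : Partition d.L) (ρ : ℝ) (P : Polygon m) : Polygon m :=
  if h : ∃ Q, IsDiscreteRestoration d T ρ P Q then h.choose else P

/-! ### Reconstruction and sampling -/

/-- The constant-speed geodesic on the unit sphere that is at `u` for `s = 0` and at `v` for
`s = 1`, extended to all real `s` as a great circle. -/
def geodesic (u v : E m) (s : ℝ) : E m :=
  let a := InnerProductGeometry.angle u v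
  if Real.sin a = 0 then u
  else (Real.sin a)⁻¹ • (Real.sin ((1 - s) * a) • u + Real.sin (s * a) • v)

open Classical in
/-- The piecewise geodesic curve on the sphere that takes the value `edgeTangent P k` at the
midpoint of the edge with number `k`. It is a geodesic between successive midpoints; the first and
the last of these geodesics are continued up to `0` and `L`. -/
def indicatrix {L : ℝ} (T : Partition L) (P : Polygon m) (t : ℝ) : E m :=
  let k := Nat.findGreatest (fun j => T.mid j ≤ t) (T.n - 2)
  geodesic (edgeTangent P k) (edgeTangent P (k + 1)) ((t - T.mid k) / T.dualLen k)

/-- The approximate reconstruction operator: the curve with initial point `q0` whose tangent is the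
piecewise geodesic interpolation of the unit edge vectors. -/
def approxReconstruct (d : ClampedData m) (T : Partition d.L) (P : Polygon m) (t : ℝ) : E m :=
  d.q0 + ∫ r in (0 : ℝ)..t, indicatrix T P r

/-- The reconstruction operator. -/
def reconstruct (d : ClampedData m) (p : ℝ≥0∞) (ρ : ℝ) (T : Partition d.L) (P : Polygon m) :
    ℝ → E m :=
  restore d p ρ (approxReconstruct d T P)

/-- The approximate sampling operator: the edges of the polygon inscribed into `γ` at the vertices
of the partition are rescaled to their reference lengths and strung together from `γ 0`. -/
def approxSample {L : ℝ} (T : Partition L) (γ : ℝ → E m) (i : ℕ) : E m :=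
  γ 0 + ∑ k ∈ Finset.range i,
    (T.len k / edgeLen (fun j => γ (T.t j)) k) • (γ (T.t (k + 1)) - γ (T.t k))

/-- The sampling operator. -/
def sample (d : ClampedData m) (ρ : ℝ) (T : Partition d.L) (γ : ℝ → E m) : Polygon m :=
  discreteRestore d T ρ (approxSample T γ)

end Elastica

end

noncomputable section

namespace Elastica

variable {m : ℕ}

/-! ### Unit vectors with prescribed normal part -/

/-! Both restorations reduce to one equation for one vector. Let τ be the unit tangent (or the unit
edge vectors) of the initial guess. A candidate in the slice has tangent (1 + λ) τ + pr_τ^⊥ b. Unit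
length and smallness of λ determine λ from b, so this tangent is `normalLift τ b`. The end tangents
determine V₀ and V₁. What remains is to choose V in ℝ^m such that ∫ `normalLift τ b` equals q₁ - q₀.

To first order in small b, the end point depends on V through the symmetric operator ∫ (1 - s) s
pr_τ^⊥. It is positive definite with a uniform constant: since |q₁ - q₀| < L, the integral of τ is
shorter than L by a definite amount, so a Lipschitz τ cannot be nearly parallel to one direction on
the whole interval (`CoerciveFrame.of_lipschitz`). Hence the end point is strongly monotone in V
(`CoerciveFrame.monotone`). This yields uniqueness, and a solution of the size of the violation of
the constraints (`CoerciveFrame.exists_blending`). `CoerciveFrame` lives on an arbitrary finite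
measure space so that the same argument serves Lebesgue measure for curves and the measure given by
edge lengths for polygons; `CoerciveFrame.edgeMeasure` carries coercivity from a curve to a nearby
polygon. Both initial guesses violate the constraints by O(h), so all blending vectors are O(h)
(`exists_reconstruction_bounds`, `exists_sampling_bounds`).

The a priori bounds for S(γ) rest on the midpoint rule. Normalized chords agree with γ' at the edge
midpoints up to a multiple of the square of the length of that same edge. The restored edge vectors
are therefore, to this order, samples of a function with bounded and Lipschitz derivative, with
bounds depending only on m, L and K₁ (`exists_restoredEdge_bound`). Dividing differences by dual
lengths leaves errors of first order, with no assumption on ratios of neighbouring edges. This fixes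
K₀ before K₂, ρ and h₀ are chosen.

For proximity (`exists_sobolevNorm_sub_le`), let P = S(γ). Away from the midpoints the derivative of
the piecewise geodesic tangent is within O(h) of a curvature vector of P, which in turn is within
O(h) of γ''. The corrections made by both restorations have Lipschitz constants (for polygons,
difference quotients) proportional to the blending vectors, hence O(h) also at the level of second
derivatives. First derivatives are compared edge by edge, and positions by integration. -/

lemma inner_projPerp {τ : E m} (hτ : ‖τ‖ = 1) (b : E m) : inner ℝ τ (projPerp τ b) = 0 := by
  simp [projPerp, inner_sub_right, inner_smul_right, hτ]

lemma projPerp_sub (τ b c : E m) : projPerp τ (b - c) = projPerp τ b - projPerp τ c := by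
  simp only [projPerp, inner_sub_right, sub_smul]; abel

lemma projPerp_add (τ b c : E m) : projPerp τ (b + c) = projPerp τ b + projPerp τ c := by
  simp only [projPerp, inner_add_right, add_smul]; abel

lemma projPerp_smul (τ : E m) (a : ℝ) (b : E m) : projPerp τ (a • b) = a • projPerp τ b := by
  simp only [projPerp, inner_smul_right, smul_sub, smul_smul]

@[simp] lemma projPerp_zero (τ : E m) : projPerp τ 0 = 0 := by simp [projPerp]

lemma projPerp_eq_self {τ b : E m} (h : inner ℝ τ b = 0) : projPerp τ b = b := by
  simp [projPerp, h]

lemma norm_projPerp_sq {τ : E m} (hτ : ‖τ‖ = 1) (b : E m) :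
    ‖projPerp τ b‖ ^ 2 = ‖b‖ ^ 2 - inner ℝ τ b ^ 2 := by
  rw [projPerp, norm_sub_sq_real, inner_smul_right, norm_smul, hτ, real_inner_comm,
    Real.norm_eq_abs, mul_one, sq_abs]
  ring

lemma norm_projPerp_le {τ : E m} (hτ : ‖τ‖ = 1) (b : E m) : ‖projPerp τ b‖ ≤ ‖b‖ := by
  have := norm_projPerp_sq hτ b
  exact (sq_le_sq₀ (norm_nonneg _) (norm_nonneg _)).1 (by nlinarith [sq_nonneg (inner ℝ τ b)])

lemma inner_projPerp_self {τ : E m} (hτ : ‖τ‖ = 1) (b : E m) :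
    inner ℝ (projPerp τ b) b = ‖projPerp τ b‖ ^ 2 := by
  rw [norm_projPerp_sq hτ, projPerp, inner_sub_left, inner_smul_left, real_inner_self_eq_norm_sq]
  simp [sq]

/-- Unit vector whose part orthogonal to the unit vector `τ` is that of `b`. -/
def normalLift (τ b : E m) : E m := √(1 - ‖projPerp τ b‖ ^ 2) • τ + projPerp τ b

@[simp] lemma normalLift_zero (τ : E m) : normalLift τ 0 = τ := by simp [normalLift]

lemma norm_smul_add_projPerp_sq {τ : E m} (hτ : ‖τ‖ = 1) (a : ℝ) (b : E m) :
    ‖a • τ + projPerp τ b‖ ^ 2 = a ^ 2 + ‖projPerp τ b‖ ^ 2 := by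
  rw [norm_add_sq_real, inner_smul_left, inner_projPerp hτ, norm_smul, hτ]
  simp

lemma norm_normalLift {τ b : E m} (hτ : ‖τ‖ = 1) (hb : ‖b‖ ≤ 1) : ‖normalLift τ b‖ = 1 := by
  have h1 : ‖projPerp τ b‖ ≤ 1 := (norm_projPerp_le hτ b).trans hb
  have h2 := norm_smul_add_projPerp_sq hτ (√(1 - ‖projPerp τ b‖ ^ 2)) b
  rw [Real.sq_sqrt (by nlinarith [norm_nonneg (projPerp τ b)])] at h2
  have h3 : ‖normalLift τ b‖ ^ 2 = 1 := by rw [normalLift, h2]; ring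
  exact (pow_eq_one_iff_of_nonneg (norm_nonneg _) two_ne_zero).1 h3

/-- Pythagoras determines a ^ 2, and `0 ≤ a` selects the root. This eliminates the tangential strain
rate from the restoration problem. -/
lemma eq_sqrt_of_norm_smul_add_projPerp {τ b : E m} (hτ : ‖τ‖ = 1) {a : ℝ} (ha : 0 ≤ a)
    (h : ‖a • τ + projPerp τ b‖ = 1) : a = √(1 - ‖projPerp τ b‖ ^ 2) := by
  have h2 := norm_smul_add_projPerp_sq hτ a b
  rw [h] at h2
  rw [show 1 - ‖projPerp τ b‖ ^ 2 = a ^ 2 by linarith, Real.sqrt_sq ha]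

/-- The bound 3 / 4 keeps both square roots above 1 / 2. Their sum is then at least 1, and
multiplying by the conjugate gives Lipschitz constant 1. -/
lemma abs_sqrt_one_sub_sub_le {x y : ℝ} (hx : x ≤ 3 / 4) (hy : y ≤ 3 / 4) :
    |√(1 - x) - √(1 - y)| ≤ |x - y| := by
  have h1 : (1 / 2 : ℝ) ≤ √(1 - x) := Real.le_sqrt_of_sq_le (by norm_num; linarith)
  have h2 : (1 / 2 : ℝ) ≤ √(1 - y) := Real.le_sqrt_of_sq_le (by norm_num; linarith)
  have h3 : (√(1 - x) - √(1 - y)) * (√(1 - x) + √(1 - y)) = -(x - y) := by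
    have e1 := Real.mul_self_sqrt (show 0 ≤ 1 - x by linarith)
    have e2 := Real.mul_self_sqrt (show 0 ≤ 1 - y by linarith)
    linear_combination e1 - e2
  rw [← abs_neg (x - y), ← h3, abs_mul, abs_of_pos (show 0 < √(1 - x) + √(1 - y) by linarith)]
  nlinarith [abs_nonneg (√(1 - x) - √(1 - y))]

lemma abs_norm_sq_sub_norm_sq_le (x y : E m) :
    |‖x‖ ^ 2 - ‖y‖ ^ 2| ≤ (‖x‖ + ‖y‖) * ‖x - y‖ := by
  rw [sq_sub_sq, abs_mul, abs_of_nonneg (by positivity)]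
  gcongr
  exact abs_norm_sub_norm_le x y

/-- Subtracting the normal part leaves a multiple of τ, and the coefficient of τ varies
quadratically. So `projPerp τ` is the linearization of `normalLift τ` at zero; this is the error
term in the monotonicity estimate. -/
lemma norm_normalLift_sub_sub_projPerp_le {τ b c : E m} (hτ : ‖τ‖ = 1) (hb : ‖b‖ ≤ 1 / 2)
    (hc : ‖c‖ ≤ 1 / 2) :
    ‖normalLift τ b - normalLift τ c - projPerp τ (b - c)‖ ≤ (‖b‖ + ‖c‖) * ‖b - c‖ := by
  have hb' := norm_projPerp_le hτ b
  have hc' := norm_projPerp_le hτ c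
  have e : normalLift τ b - normalLift τ c - projPerp τ (b - c) =
      (√(1 - ‖projPerp τ b‖ ^ 2) - √(1 - ‖projPerp τ c‖ ^ 2)) • τ := by
    rw [projPerp_sub, normalLift, normalLift, sub_smul]; abel
  rw [e, norm_smul, hτ, mul_one, Real.norm_eq_abs]
  have n1 := norm_nonneg (projPerp τ b)
  have n2 := norm_nonneg (projPerp τ c)
  refine (abs_sqrt_one_sub_sub_le (by nlinarith) (by nlinarith)).trans
    ((abs_norm_sq_sub_norm_sq_le _ _).trans ?_)
  rw [← projPerp_sub]
  gcongr
  exact norm_projPerp_le hτ _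

lemma norm_projPerp_sub_projPerp_le {τ υ b c : E m} (hτ : ‖τ‖ = 1) (hυ : ‖υ‖ = 1) :
    ‖projPerp τ b - projPerp υ c‖ ≤ ‖b - c‖ + 2 * ‖b‖ * ‖τ - υ‖ := by
  have e : projPerp τ b - projPerp υ c =
      projPerp υ (b - c) - (inner ℝ τ b • (τ - υ) + inner ℝ (τ - υ) b • υ) := by
    simp only [projPerp, inner_sub_left, inner_sub_right, sub_smul, smul_sub]; abel
  rw [e]
  have h1 : ‖inner ℝ τ b • (τ - υ)‖ ≤ ‖b‖ * ‖τ - υ‖ := by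
    rw [norm_smul]
    gcongr
    simpa [hτ] using norm_inner_le_norm (𝕜 := ℝ) τ b
  have h2 : ‖inner ℝ (τ - υ) b • υ‖ ≤ ‖b‖ * ‖τ - υ‖ := by
    rw [norm_smul, hυ, mul_one, mul_comm]
    exact norm_inner_le_norm (𝕜 := ℝ) (τ - υ) b
  calc _ ≤ _ := norm_sub_le _ _
    _ ≤ ‖b - c‖ + (‖b‖ * ‖τ - υ‖ + ‖b‖ * ‖τ - υ‖) :=
      add_le_add (norm_projPerp_le hυ _) ((norm_add_le _ _).trans (add_le_add h1 h2))
    _ = _ := by ring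

/-- The correction `normalLift τ b - τ` is Lipschitz in `b`, and in `τ` with a constant proportional
to `b`. -/
lemma norm_normalLift_sub_self_sub_le {τ υ b c : E m} (hτ : ‖τ‖ = 1) (hυ : ‖υ‖ = 1)
    (hb : ‖b‖ ≤ 1 / 2) (hc : ‖c‖ ≤ 1 / 2) :
    ‖(normalLift τ b - τ) - (normalLift υ c - υ)‖ ≤ 2 * ‖b - c‖ + 5 * ‖b‖ * ‖τ - υ‖ := by
  set p := projPerp τ b with hp
  set r := projPerp υ c with hr
  have hp' : ‖p‖ ≤ ‖b‖ := norm_projPerp_le hτ b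
  have hr' : ‖r‖ ≤ ‖c‖ := norm_projPerp_le hυ c
  have hpr : ‖p - r‖ ≤ ‖b - c‖ + 2 * ‖b‖ * ‖τ - υ‖ := norm_projPerp_sub_projPerp_le hτ hυ
  have n1 := norm_nonneg p
  have n2 := norm_nonneg r
  -- The number 1 is written `√(1 - 0)` so that `abs_sqrt_one_sub_sub_le` bounds the last
  -- coefficient too.
  have e : (normalLift τ b - τ) - (normalLift υ c - υ) =
      (p - r) + ((√(1 - ‖p‖ ^ 2) - √(1 - ‖r‖ ^ 2)) • υ + (√(1 - ‖p‖ ^ 2) - √(1 - 0)) • (τ - υ)) := by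
    simp only [normalLift, ← hp, ← hr, sub_zero, Real.sqrt_one, sub_smul, smul_sub, one_smul]; abel
  have h1 : ‖(√(1 - ‖p‖ ^ 2) - √(1 - ‖r‖ ^ 2)) • υ‖ ≤ ‖p - r‖ := by
    rw [norm_smul, hυ, mul_one, Real.norm_eq_abs]
    refine (abs_sqrt_one_sub_sub_le (by nlinarith) (by nlinarith)).trans
      ((abs_norm_sq_sub_norm_sq_le _ _).trans ?_)
    exact mul_le_of_le_one_left (norm_nonneg _) (by linarith)
  have h2 : ‖(√(1 - ‖p‖ ^ 2) - √(1 - 0)) • (τ - υ)‖ ≤ ‖b‖ * ‖τ - υ‖ := by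
    rw [norm_smul, Real.norm_eq_abs]
    gcongr
    refine (abs_sqrt_one_sub_sub_le (by nlinarith) (by norm_num)).trans ?_
    rw [sub_zero, abs_of_nonneg (by positivity)]
    nlinarith
  rw [e]
  calc _ ≤ ‖p - r‖ + (‖p - r‖ + ‖b‖ * ‖τ - υ‖) :=
        (norm_add_le _ _).trans (add_le_add le_rfl ((norm_add_le _ _).trans (add_le_add h1 h2)))
    _ ≤ _ := by nlinarith

lemma norm_normalLift_sub_self_le {τ b : E m} (hτ : ‖τ‖ = 1) (hb : ‖b‖ ≤ 1 / 2) :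
    ‖normalLift τ b - τ‖ ≤ 2 * ‖b‖ := by
  simpa using norm_normalLift_sub_self_sub_le (c := 0) hτ hτ hb (by norm_num)

/-- A unit vector `N` close to `τ` is lifted from its own normal part. -/
lemma normalLift_projPerp_eq {τ N : E m} (hτ : ‖τ‖ = 1) (hN : ‖N‖ = 1) (h : ‖τ - N‖ ≤ 1) :
    normalLift τ (projPerp τ N) = N := by
  have h0 : projPerp τ (projPerp τ N) = projPerp τ N := projPerp_eq_self (inner_projPerp hτ N)
  -- For unit vectors at distance at most 1 the inner product is at least 1 / 2, so the square root
  -- in the lift is this inner product and not its negative.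
  have h1 : 0 ≤ inner ℝ τ N := by
    have := norm_sub_sq_real τ N
    rw [hτ, hN] at this
    nlinarith [norm_nonneg (τ - N)]
  rw [normalLift, h0, norm_projPerp_sq hτ, hN]
  simp [Real.sqrt_sq h1, projPerp]

lemma norm_projPerp_le_norm_sub {τ N : E m} (hτ : ‖τ‖ = 1) : ‖projPerp τ N‖ ≤ ‖τ - N‖ := by
  have : projPerp τ N = projPerp τ (N - τ) := by
    rw [projPerp_sub]; simp [projPerp, hτ]
  rw [this, norm_sub_rev]
  exact norm_projPerp_le hτ _

/-- The normal part of a lift is the lifted vector itself. Thus the prescribed end tangents leave no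
freedom in V₀ and V₁. -/
lemma projPerp_eq_of_normalLift_eq {τ V N : E m} (hτ : ‖τ‖ = 1) (hV : inner ℝ τ V = 0)
    (h : normalLift τ V = N) : V = projPerp τ N := by
  rw [← h, normalLift, projPerp_add, projPerp_smul, projPerp_eq_self (inner_projPerp hτ V),
    projPerp_eq_self hV]
  simp [projPerp, hτ]

lemma continuous_normalLift : Continuous fun x : E m × E m => normalLift x.1 x.2 := by
  unfold normalLift projPerp; fun_prop

lemma continuous_projPerp : Continuous fun x : E m × E m => projPerp x.1 x.2 := by
  unfold projPerp; fun_prop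

/-! ### The blending polynomial -/

lemma norm_blend_le {s : ℝ} (hs : s ∈ Icc (0 : ℝ) 1) (V₀ V V₁ : E m) :
    ‖blend s V₀ V V₁‖ ≤ ‖V₀‖ + ‖V‖ + ‖V₁‖ := by
  obtain ⟨h0, h1⟩ := hs
  unfold blend
  refine (norm_add₃_le).trans ?_
  simp only [norm_smul, Real.norm_eq_abs]
  rw [abs_of_nonneg (by positivity), abs_of_nonneg (by nlinarith), abs_of_nonneg (by positivity)]
  gcongr
  · exact mul_le_of_le_one_left (norm_nonneg _) (by nlinarith)
  · exact mul_le_of_le_one_left (norm_nonneg _) (by nlinarith)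
  · exact mul_le_of_le_one_left (norm_nonneg _) (by nlinarith)

lemma blend_sub_blend (s : ℝ) (V₀ V V' V₁ : E m) :
    blend s V₀ V V₁ - blend s V₀ V' V₁ = ((1 - s) * s) • (V - V') := by
  simp only [blend, smul_sub]; abel

lemma norm_blend_sub_blend_le {s r : ℝ} (hs : s ∈ Icc (0 : ℝ) 1) (hr : r ∈ Icc (0 : ℝ) 1)
    (V₀ V V₁ : E m) :
    ‖blend s V₀ V V₁ - blend r V₀ V V₁‖ ≤ 2 * (‖V₀‖ + ‖V‖ + ‖V₁‖) * |s - r| := by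
  have e : blend s V₀ V V₁ - blend r V₀ V V₁ =
      (s - r) • ((s + r - 2) • V₀ + (1 - s - r) • V + (s + r) • V₁) := by
    unfold blend; module
  obtain ⟨h0, h1⟩ := hs
  obtain ⟨h2, h3⟩ := hr
  rw [e, norm_smul, Real.norm_eq_abs, mul_comm]
  gcongr
  refine (norm_add₃_le).trans ?_
  simp only [norm_smul, Real.norm_eq_abs]
  have a1 : |s + r - 2| ≤ 2 := abs_le.2 ⟨by linarith, by linarith⟩
  have a2 : |1 - s - r| ≤ 2 := abs_le.2 ⟨by linarith, by linarith⟩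
  have a3 : |s + r| ≤ 2 := abs_le.2 ⟨by linarith, by linarith⟩
  nlinarith [norm_nonneg V₀, norm_nonneg V, norm_nonneg V₁]

@[simp] lemma blend_zero_left (V₀ V V₁ : E m) : blend 0 V₀ V V₁ = V₀ := by simp [blend]

@[simp] lemma blend_one_left (V₀ V V₁ : E m) : blend 1 V₀ V V₁ = V₁ := by simp [blend]

lemma continuous_blend (V₀ V V₁ : E m) : Continuous fun s => blend s V₀ V V₁ := by
  unfold blend; fun_prop

/-! ### Strongly monotone maps -/

/-- A map that is strongly monotone and Lipschitz on a ball attains all values close to its value at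
the centre. -/
lemma exists_eq_of_stronglyMonotone {r c Λ : ℝ} (hr : 0 ≤ r) (hc : 0 < c) (hcΛ : c ≤ Λ)
    {F : E m → E m} {q : E m}
    (hmono : ∀ x ∈ Metric.closedBall (0 : E m) r, ∀ y ∈ Metric.closedBall (0 : E m) r,
      c * ‖x - y‖ ^ 2 ≤ inner ℝ (F x - F y) (x - y))
    (hlip : ∀ x ∈ Metric.closedBall (0 : E m) r, ∀ y ∈ Metric.closedBall (0 : E m) r,
      ‖F x - F y‖ ≤ Λ * ‖x - y‖)
    (h0 : ‖F 0 - q‖ ≤ c / 2 * r) : ∃ x ∈ Metric.closedBall (0 : E m) r, F x = q := by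
  have hΛ : 0 < Λ := hc.trans_le hcΛ
  -- The map Φ = id - η (F - q) multiplies squared distances by at most 1 - 2 η c + η² Λ², which is
  -- 1 - η c for this η. Since 1 - η c ≤ k ^ 2, the factor k serves without a square root.
  set η := c / Λ ^ 2 with hη
  have hη0 : 0 < η := by positivity
  set k := 1 - η * c / 2 with hk
  have hηc : η * c ≤ 1 := by
    rw [hη, div_mul_eq_mul_div, div_le_one (by positivity)]; nlinarith
  have hk0 : 0 ≤ k := by rw [hk]; linarith
  have hk1 : k < 1 := by rw [hk]; have : 0 < η * c := by positivity
                         linarith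
  let Φ : E m → E m := fun x => x - η • (F x - q)
  have hΦ : ∀ x ∈ Metric.closedBall (0 : E m) r, ∀ y ∈ Metric.closedBall (0 : E m) r,
      ‖Φ x - Φ y‖ ≤ k * ‖x - y‖ := by
    intro x hx y hy
    have e : Φ x - Φ y = (x - y) - η • (F x - F y) := by simp only [Φ, smul_sub]; abel
    refine (sq_le_sq₀ (norm_nonneg _) (by positivity)).1 ?_
    rw [e, norm_sub_sq_real, inner_smul_right, norm_smul, Real.norm_eq_abs, abs_of_pos hη0,
      real_inner_comm]
    have h1 := hmono x hx y hy
    have h2 := hlip x hx y hy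
    have h3 : (η * ‖F x - F y‖) ^ 2 ≤ η * c * ‖x - y‖ ^ 2 := by
      have : (η * ‖F x - F y‖) ^ 2 ≤ (η * (Λ * ‖x - y‖)) ^ 2 := by gcongr
      refine this.trans_eq ?_
      rw [hη]; field_simp
    have h4 : η * (c * ‖x - y‖ ^ 2) ≤ η * inner ℝ (F x - F y) (x - y) := by gcongr
    have h5 : (k * ‖x - y‖) ^ 2 = ‖x - y‖ ^ 2 - η * c * ‖x - y‖ ^ 2
      + (η * c / 2) ^ 2 * ‖x - y‖ ^ 2 := by rw [hk]; ring
    rw [h5]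
    have : 0 ≤ (η * c / 2) ^ 2 * ‖x - y‖ ^ 2 := by positivity
    nlinarith
  have hz : (0 : E m) ∈ Metric.closedBall (0 : E m) r := by simpa using hr
  -- The hypothesis on `F 0` says that Φ moves the centre by at most (1 - k) r, just what a
  -- k-contraction needs to preserve the ball of radius r.
  have hmaps : MapsTo Φ (Metric.closedBall 0 r) (Metric.closedBall 0 r) := by
    intro x hx
    have h1 := hΦ x hx 0 hz
    have h2 : ‖Φ 0‖ ≤ η * (c / 2 * r) := by
      simp only [Φ, zero_sub, norm_neg, norm_smul, Real.norm_eq_abs, abs_of_pos hη0]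
      gcongr
    rw [mem_closedBall_zero_iff] at hx ⊢
    have h3 : k * ‖x - 0‖ ≤ k * r := by rw [sub_zero]; gcongr
    have h4 : ‖Φ x‖ ≤ ‖Φ x - Φ 0‖ + ‖Φ 0‖ := by
      simpa using norm_add_le (Φ x - Φ 0) (Φ 0)
    have h5 : k * r + η * (c / 2 * r) = r := by rw [hk]; ring
    linarith
  have hcontr : ContractingWith k.toNNReal (hmaps.restrict Φ _ _) := by
    refine ⟨by simpa using hk1, LipschitzWith.of_dist_le_mul fun x y => ?_⟩
    rw [Subtype.dist_eq, Subtype.dist_eq, dist_eq_norm, dist_eq_norm, Real.coe_toNNReal _ hk0]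
    exact hΦ x x.2 y y.2
  obtain ⟨x, hx, hfix, -⟩ := hcontr.exists_fixedPoint'
    (Metric.isClosed_closedBall.isComplete) hmaps hz (edist_ne_top _ _)
  refine ⟨x, hx, ?_⟩
  have : η • (F x - q) = 0 := by
    have : x - η • (F x - q) = x := hfix
    simpa using this
  rcases smul_eq_zero.1 this with h | h
  · exact absurd h hη0.ne'
  · exact sub_eq_zero.1 h

/-! ### The end point as a function of the blending vector -/

section EndPoint

variable {X : Type*} [MeasurableSpace X]

/-- Unit vectors `τ` and parameters `s` in `[0, 1]` for which the quadratic form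
`V ↦ ∫ (1 - s) s |pr_τ^⊥ V|²` is bounded below by `c |V|²`. -/
structure CoerciveFrame (μ : Measure X) (c L : ℝ) (τ : X → E m) (s : X → ℝ) : Prop where
  finite : IsFiniteMeasure μ
  mass : μ.real univ ≤ L
  meas_tangent : AEStronglyMeasurable τ μ
  meas_param : AEStronglyMeasurable s μ
  norm_tangent : ∀ᵐ x ∂μ, ‖τ x‖ = 1
  param_mem : ∀ᵐ x ∂μ, s x ∈ Icc (0 : ℝ) 1
  pos : 0 < c
  coercive : ∀ V : E m, c * ‖V‖ ^ 2 ≤ ∫ x, (1 - s x) * s x * ‖projPerp (τ x) V‖ ^ 2 ∂μ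

namespace CoerciveFrame

variable {μ : Measure X} {c L : ℝ} {τ : X → E m} {s : X → ℝ}

lemma L_nonneg (H : CoerciveFrame μ c L τ s) : 0 ≤ L := measureReal_nonneg.trans H.mass

lemma aestronglyMeasurable_blend (H : CoerciveFrame μ c L τ s) (V₀ V V₁ : E m) :
    AEStronglyMeasurable (fun x => blend (s x) V₀ V V₁) μ :=
  (continuous_blend V₀ V V₁).comp_aestronglyMeasurable H.meas_param

lemma aestronglyMeasurable_projPerp (H : CoerciveFrame μ c L τ s) {f : X → E m}
    (hf : AEStronglyMeasurable f μ) : AEStronglyMeasurable (fun x => projPerp (τ x) (f x)) μ :=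
  continuous_projPerp.comp_aestronglyMeasurable (H.meas_tangent.prodMk hf)

lemma integrable_normalLift (H : CoerciveFrame μ c L τ s) {V₀ V V₁ : E m}
    (hV : ‖V₀‖ + ‖V‖ + ‖V₁‖ ≤ 1) :
    Integrable (fun x => normalLift (τ x) (blend (s x) V₀ V V₁)) μ := by
  have := H.finite
  have hm : AEStronglyMeasurable (fun x => normalLift (τ x) (blend (s x) V₀ V V₁)) μ :=
    continuous_normalLift.comp_aestronglyMeasurable (f := fun x => (τ x, blend (s x) V₀ V V₁))
      (H.meas_tangent.prodMk (H.aestronglyMeasurable_blend V₀ V V₁))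
  refine Integrable.of_bound (C := 1) hm ?_
  filter_upwards [H.norm_tangent, H.param_mem] with x h1 h2
  exact (norm_normalLift h1 ((norm_blend_le h2 _ _ _).trans hV)).le

lemma integrable_tangent (H : CoerciveFrame μ c L τ s) : Integrable τ μ := by
  have := H.finite
  refine Integrable.of_bound (C := 1) H.meas_tangent ?_
  filter_upwards [H.norm_tangent] with x h1 using h1.le

lemma integrable_quadratic (H : CoerciveFrame μ c L τ s) (V : E m) :
    Integrable (fun x => (1 - s x) * s x * ‖projPerp (τ x) V‖ ^ 2) μ := by
  have := H.finite
  refine Integrable.of_bound (C := ‖V‖ ^ 2)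
    (Continuous.comp_aestronglyMeasurable (g := fun y : ℝ × E m => (1 - y.1) * y.1 * ‖y.2‖ ^ 2)
      (by fun_prop) (H.meas_param.prodMk
        (H.aestronglyMeasurable_projPerp (aestronglyMeasurable_const (b := V))))) ?_
  filter_upwards [H.norm_tangent, H.param_mem] with x h1 ⟨h2, h3⟩
  have h4 := norm_projPerp_le h1 V
  have h5 : ‖projPerp (τ x) V‖ ^ 2 ≤ ‖V‖ ^ 2 := by gcongr
  rw [Real.norm_eq_abs, abs_of_nonneg (by have := sub_nonneg.2 h3; positivity)]
  have h6 : (1 - s x) * s x ≤ 1 := by nlinarith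
  have h7 : 0 ≤ (1 - s x) * s x := mul_nonneg (sub_nonneg.2 h3) h2
  nlinarith [sq_nonneg ‖projPerp (τ x) V‖]

/-- Strong monotonicity of the end point as a function of the blending vector. -/
lemma monotone (H : CoerciveFrame μ c L τ s) {R : ℝ} (hR : R ≤ 1 / 2) (hRc : 4 * R * L ≤ c)
    {V₀ V₁ V V' : E m} (hV : ‖V₀‖ + ‖V‖ + ‖V₁‖ ≤ R) (hV' : ‖V₀‖ + ‖V'‖ + ‖V₁‖ ≤ R) :
    c / 2 * ‖V - V'‖ ^ 2 ≤ inner ℝ (∫ x, normalLift (τ x) (blend (s x) V₀ V V₁) ∂μ -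
      ∫ x, normalLift (τ x) (blend (s x) V₀ V' V₁) ∂μ) (V - V') := by
  have := H.finite
  have hR0 : 0 ≤ R := le_trans (by positivity) hV
  have i1 := H.integrable_normalLift (hV.trans (hR.trans (by norm_num)))
  have i2 := H.integrable_normalLift (hV'.trans (hR.trans (by norm_num)))
  rw [← integral_sub i1 i2, real_inner_comm, show ∀ D : E m, inner ℝ D (∫ x, (normalLift (τ x) (blend (s x) V₀ V V₁) -
      normalLift (τ x) (blend (s x) V₀ V' V₁)) ∂μ) = ∫ x, inner ℝ D (normalLift (τ x)
      (blend (s x) V₀ V V₁) - normalLift (τ x) (blend (s x) V₀ V' V₁)) ∂μ from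
      fun D => (integral_inner (i1.sub i2) D).symm]
  -- Pointwise, the increment of the lift is its linear part plus a remainder of norm at most 2 R ‖V
  -- - V'‖. Paired with V - V', the linear part is the coercive quadratic form.
  have key : ∫ x, ((1 - s x) * s x * ‖projPerp (τ x) (V - V')‖ ^ 2 - 2 * R * ‖V - V'‖ ^ 2) ∂μ ≤
      ∫ x, inner ℝ (V - V') (normalLift (τ x) (blend (s x) V₀ V V₁) -
        normalLift (τ x) (blend (s x) V₀ V' V₁)) ∂μ := by
    refine integral_mono_ae ((H.integrable_quadratic _).sub (integrable_const _))
      ((i1.sub i2).const_inner _) ?_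
    filter_upwards [H.norm_tangent, H.param_mem] with x h1 h2
    have hb := (norm_blend_le h2 V₀ V V₁).trans hV
    have hb' := (norm_blend_le h2 V₀ V' V₁).trans hV'
    have h3 := norm_normalLift_sub_sub_projPerp_le h1 (hb.trans hR) (hb'.trans hR)
    rw [blend_sub_blend] at h3
    have hs : 0 ≤ (1 - s x) * s x ∧ (1 - s x) * s x ≤ 1 :=
      ⟨mul_nonneg (sub_nonneg.2 h2.2) h2.1, by nlinarith [h2.1, h2.2]⟩
    have h4 : ‖((1 - s x) * s x) • (V - V')‖ ≤ ‖V - V'‖ := by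
      rw [norm_smul, Real.norm_eq_abs, abs_of_nonneg hs.1]
      exact mul_le_of_le_one_left (norm_nonneg _) hs.2
    set D := V - V' with hD
    set N := normalLift (τ x) (blend (s x) V₀ V V₁) - normalLift (τ x) (blend (s x) V₀ V' V₁)
    have h5 : ∀ N : E m, inner ℝ D N = (1 - s x) * s x * ‖projPerp (τ x) D‖ ^ 2 +
        inner ℝ D (N - projPerp (τ x) (((1 - s x) * s x) • D)) := fun N => by
      rw [inner_sub_right, projPerp_smul, inner_smul_right, real_inner_comm, real_inner_comm _ D,
        inner_projPerp_self h1]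
      ring
    have h6 := abs_le.1 (abs_real_inner_le_norm D (N - projPerp (τ x) (((1 - s x) * s x) • D)))
    have h7 : ‖N - projPerp (τ x) (((1 - s x) * s x) • D)‖ ≤ (R + R) * ‖D‖ :=
      h3.trans (by gcongr)
    have h8 : ‖D‖ * ‖N - projPerp (τ x) (((1 - s x) * s x) • D)‖ ≤ ‖D‖ * ((R + R) * ‖D‖) := by
      gcongr
    rw [h5 N]
    nlinarith
  refine le_trans ?_ key
  -- The remainder costs at most 2 R L ‖V - V'‖², which by `hRc` is no more than half of what
  -- coercivity provides.
  rw [integral_sub (H.integrable_quadratic _) (integrable_const _), integral_const, smul_eq_mul]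
  have h1 := H.coercive (V - V')
  have h2 : μ.real univ * (2 * R * ‖V - V'‖ ^ 2) ≤ L * (2 * R * ‖V - V'‖ ^ 2) := by
    gcongr; exact H.mass
  nlinarith [sq_nonneg ‖V - V'‖]

lemma blending_unique (H : CoerciveFrame μ c L τ s) {R : ℝ} (hR : R ≤ 1 / 2)
    (hRc : 4 * R * L ≤ c) {V₀ V₁ V V' : E m} (hV : ‖V₀‖ + ‖V‖ + ‖V₁‖ ≤ R)
    (hV' : ‖V₀‖ + ‖V'‖ + ‖V₁‖ ≤ R)
    (h : ∫ x, normalLift (τ x) (blend (s x) V₀ V V₁) ∂μ =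
      ∫ x, normalLift (τ x) (blend (s x) V₀ V' V₁) ∂μ) : V = V' := by
  have := H.monotone hR hRc hV hV'
  rw [h, sub_self, inner_zero_left] at this
  have h1 := H.pos
  have h2 : ‖V - V'‖ ^ 2 ≤ 0 := by
    by_contra h3
    have := mul_pos (half_pos h1) (not_le.1 h3)
    linarith
  exact sub_eq_zero.1 (norm_eq_zero.1 (pow_eq_zero_iff two_ne_zero |>.1
    (le_antisymm h2 (by positivity))))

lemma norm_integral_sub_le (H : CoerciveFrame μ c L τ s) {V₀ V₁ V V' : E m}
    (hV : ‖V₀‖ + ‖V‖ + ‖V₁‖ ≤ 1 / 2) (hV' : ‖V₀‖ + ‖V'‖ + ‖V₁‖ ≤ 1 / 2) :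
    ‖∫ x, normalLift (τ x) (blend (s x) V₀ V V₁) ∂μ -
      ∫ x, normalLift (τ x) (blend (s x) V₀ V' V₁) ∂μ‖ ≤ 2 * L * ‖V - V'‖ := by
  have := H.finite
  rw [← integral_sub (H.integrable_normalLift (hV.trans (by norm_num)))
    (H.integrable_normalLift (hV'.trans (by norm_num)))]
  refine (norm_integral_le_of_norm_le_const (C := 2 * ‖V - V'‖) ?_).trans ?_
  · filter_upwards [H.norm_tangent, H.param_mem] with x h1 h2
    have h3 := norm_normalLift_sub_self_sub_le h1 h1 ((norm_blend_le h2 _ _ _).trans hV)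
      ((norm_blend_le h2 _ _ _).trans hV')
    rw [sub_sub_sub_cancel_right, sub_self, norm_zero, mul_zero, add_zero, blend_sub_blend,
      norm_smul, Real.norm_eq_abs,
      abs_of_nonneg (mul_nonneg (sub_nonneg.2 h2.2) h2.1)] at h3
    refine h3.trans ?_
    gcongr
    exact mul_le_of_le_one_left (norm_nonneg _) (by nlinarith [h2.1, h2.2])
  · nlinarith [H.mass, norm_nonneg (V - V')]

lemma norm_integral_sub_integral_tangent_le (H : CoerciveFrame μ c L τ s) {V₀ V₁ V : E m}
    (hV : ‖V₀‖ + ‖V‖ + ‖V₁‖ ≤ 1 / 2) :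
    ‖∫ x, normalLift (τ x) (blend (s x) V₀ V V₁) ∂μ - ∫ x, τ x ∂μ‖ ≤
      2 * L * (‖V₀‖ + ‖V‖ + ‖V₁‖) := by
  have := H.finite
  rw [← integral_sub (H.integrable_normalLift (hV.trans (by norm_num))) H.integrable_tangent]
  refine (norm_integral_le_of_norm_le_const (C := 2 * (‖V₀‖ + ‖V‖ + ‖V₁‖)) ?_).trans ?_
  · filter_upwards [H.norm_tangent, H.param_mem] with x h1 h2
    have h3 := norm_blend_le h2 V₀ V V₁
    refine (norm_normalLift_sub_self_le h1 (h3.trans hV)).trans ?_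
    gcongr
  · have : 0 ≤ ‖V₀‖ + ‖V‖ + ‖V₁‖ := by positivity
    nlinarith [H.mass]

/-- A blending vector of size `O(ε)` moves the end point to `q`, if the end conditions are violated
by at most `ε`. -/
lemma exists_blending (H : CoerciveFrame μ c L τ s) {R ε : ℝ} (hR : R ≤ 1 / 2)
    (hRc : 4 * R * L ≤ c) (hε : 0 ≤ ε) {V₀ V₁ q : E m} (h₀ : ‖V₀‖ ≤ ε) (h₁ : ‖V₁‖ ≤ ε)
    (hq : ‖∫ x, τ x ∂μ - q‖ ≤ ε) (hεR : ε + 4 * (4 * L + 1) / c * ε + ε ≤ R) :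
    ∃ V : E m, ‖V‖ ≤ 4 * (4 * L + 1) / c * ε ∧
      ∫ x, normalLift (τ x) (blend (s x) V₀ V V₁) ∂μ = q := by
  have hc := H.pos
  have hL := H.L_nonneg
  -- The radius is chosen such that (c / 2) / 2 * r = (4 L + 1) ε: the vectors V₀ and V₁ move the
  -- end point by at most 2 L (ε + ε), and the unrestored end point is off by at most ε.
  set r := 4 * (4 * L + 1) / c * ε with hr
  have hr0 : 0 ≤ r := by positivity
  have hball : ∀ V ∈ Metric.closedBall (0 : E m) r, ‖V₀‖ + ‖V‖ + ‖V₁‖ ≤ R := fun V hV => by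
    rw [mem_closedBall_zero_iff] at hV; linarith
  -- The Lipschitz constant 2 L is enlarged by c only to guarantee that it dominates the
  -- monotonicity constant.
  obtain ⟨V, hV, hq⟩ := exists_eq_of_stronglyMonotone (r := r) (c := c / 2) (Λ := 2 * L + c)
    (F := fun V => ∫ x, normalLift (τ x) (blend (s x) V₀ V V₁) ∂μ) (q := q) hr0 (by positivity)
    (by linarith)
    (fun x hx y hy => H.monotone hR hRc (hball x hx) (hball y hy))
    (fun x hx y hy => (H.norm_integral_sub_le ((hball x hx).trans hR)
      ((hball y hy).trans hR)).trans (by gcongr; linarith)) (by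
      have h1 := H.norm_integral_sub_integral_tangent_le
        ((hball 0 (by simpa using hr0)).trans hR)
      rw [norm_zero, add_zero] at h1
      have h2 := norm_sub_le_norm_sub_add_norm_sub
        (∫ x, normalLift (τ x) (blend (s x) V₀ 0 V₁) ∂μ) (∫ x, τ x ∂μ) q
      have h3 : c / 2 / 2 * r = (4 * L + 1) * ε := by rw [hr]; field_simp; ring
      rw [h3]
      have h4 : 2 * L * (‖V₀‖ + ‖V₁‖) ≤ 2 * L * (ε + ε) := by gcongr
      linarith)
  exact ⟨V, by simpa using hV, hq⟩

/-- The blending vector is controlled by the normal parts of the blended vectors. -/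
lemma norm_blending_le (H : CoerciveFrame μ c L τ s) {ρ : ℝ} (hρ : 0 ≤ ρ) {V₀ V V₁ : E m}
    (h₀ : ‖V₀‖ ≤ ρ) (h₁ : ‖V₁‖ ≤ ρ)
    (h : ∀ᵐ x ∂μ, ‖projPerp (τ x) (blend (s x) V₀ V V₁)‖ ≤ ρ) : ‖V‖ ≤ 3 * L / c * ρ := by
  have := H.finite
  have hc := H.pos
  have h1 := H.coercive V
  have h2 : ∫ x, (1 - s x) * s x * ‖projPerp (τ x) V‖ ^ 2 ∂μ ≤ ∫ _, 3 * ρ * ‖V‖ ∂μ := by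
    refine integral_mono_ae (H.integrable_quadratic _) (integrable_const _) ?_
    filter_upwards [H.norm_tangent, H.param_mem, h] with x h3 h4 h5
    have hs : 0 ≤ (1 - s x) * s x := mul_nonneg (sub_nonneg.2 h4.2) h4.1
    -- Isolating the V-term exhibits it as a combination of three vectors of norm at most ρ. The
    -- quadratic form is then at most 3 ρ L ‖V‖, and coercivity gains one power of ‖V‖.
    have e : ((1 - s x) * s x) • projPerp (τ x) V = projPerp (τ x) (blend (s x) V₀ V V₁) -
        ((1 - s x) ^ 2 • projPerp (τ x) V₀ + s x ^ 2 • projPerp (τ x) V₁) := by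
      simp only [blend, projPerp_add, projPerp_smul]; abel
    have h6 : ‖((1 - s x) * s x) • projPerp (τ x) V‖ ≤ 3 * ρ := by
      rw [e]
      refine (norm_sub_le _ _).trans ?_
      have := norm_add_le ((1 - s x) ^ 2 • projPerp (τ x) V₀) (s x ^ 2 • projPerp (τ x) V₁)
      simp only [norm_smul, Real.norm_eq_abs, abs_of_nonneg (sq_nonneg (1 - s x)),
        abs_of_nonneg (sq_nonneg (s x))] at this
      have h7 := (norm_projPerp_le h3 V₀).trans h₀
      have h8 := (norm_projPerp_le h3 V₁).trans h₁
      have h9 : (1 - s x) ^ 2 * ‖projPerp (τ x) V₀‖ ≤ 1 * ρ := by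
        gcongr; nlinarith [h4.1, h4.2]
      have h10 : s x ^ 2 * ‖projPerp (τ x) V₁‖ ≤ 1 * ρ := by
        gcongr; nlinarith [h4.1, h4.2]
      linarith
    rw [norm_smul, Real.norm_eq_abs, abs_of_nonneg hs] at h6
    have h7 := norm_projPerp_le h3 V
    calc (1 - s x) * s x * ‖projPerp (τ x) V‖ ^ 2 =
        ((1 - s x) * s x * ‖projPerp (τ x) V‖) * ‖projPerp (τ x) V‖ := by ring
      _ ≤ 3 * ρ * ‖V‖ := by gcongr
  rw [integral_const, smul_eq_mul] at h2
  have h3 : μ.real univ * (3 * ρ * ‖V‖) ≤ L * (3 * ρ * ‖V‖) := by gcongr; exact H.mass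
  rcases (norm_nonneg V).eq_or_lt with h4 | h4
  · rw [← h4]; have := H.L_nonneg; positivity
  · rw [div_mul_eq_mul_div, le_div_iff₀ hc]
    nlinarith

end CoerciveFrame

end EndPoint

/-! ### Coercivity for Lipschitz tangents -/

/-- A continuous function on `[0, L]` whose integral is not close to `±L` is somewhere not close to
`±1`. -/
lemma exists_abs_le_of_abs_integral_le {L g : ℝ} (hL : 0 < L) (hg : 0 < g) (hgL : g ≤ L) {f : ℝ → ℝ}
    (hf : ContinuousOn f (Icc 0 L)) (h : |∫ t in Icc 0 L, f t| ≤ L - g) :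
    ∃ t ∈ Icc 0 L, |f t| ≤ 1 - g / (2 * L) := by
  by_contra! hcon
  have hθ : 0 < 1 - g / (2 * L) := by
    rw [sub_pos, div_lt_one (by positivity)]; linarith
  have hint : IntegrableOn f (Icc 0 L) := hf.integrableOn_Icc
  have hmass : ∫ _ in Icc 0 L, (1 - g / (2 * L)) = L - g / 2 := by
    rw [setIntegral_const, Real.volume_real_Icc_of_le hL.le, smul_eq_mul]; field_simp; ring
  have hmem : (0 : ℝ) ∈ Icc 0 L := ⟨le_rfl, hL.le⟩
  -- If |f| exceeded the positive threshold everywhere, f would have constant sign by the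
  -- intermediate value theorem, and the absolute value of its integral would be at least L - g / 2.
  have hne : ∀ t ∈ Icc 0 L, f t ≠ 0 := fun t ht h0 => by
    have := hcon t ht
    rw [h0, abs_zero] at this
    linarith
  obtain ⟨h1, h2⟩ := abs_le.1 h
  rcases lt_or_gt_of_ne (hne 0 hmem) with h0 | h0
  · have hneg : ∀ t ∈ Icc 0 L, f t ≤ -(1 - g / (2 * L)) := fun t ht => by
      have h3 : f t < 0 := by
        by_contra! h4
        obtain ⟨x, hx, hx0⟩ := isPreconnected_Icc.intermediate_value hmem ht hf ⟨h0.le, h4⟩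
        exact hne x hx hx0
      have := hcon t ht
      rw [abs_of_neg h3] at this
      linarith
    have h5 := setIntegral_mono_on hint (integrable_const _) measurableSet_Icc hneg
    rw [integral_neg, hmass] at h5
    linarith
  · have hpos : ∀ t ∈ Icc 0 L, 1 - g / (2 * L) ≤ f t := fun t ht => by
      have h3 : 0 < f t := by
        by_contra! h4
        obtain ⟨x, hx, hx0⟩ := isPreconnected_Icc.intermediate_value ht hmem hf ⟨h4, h0.le⟩
        exact hne x hx hx0
      have := hcon t ht
      rw [abs_of_pos h3] at this
      linarith
    have h5 := setIntegral_mono_on (integrable_const _) hint measurableSet_Icc hpos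
    rw [hmass] at h5
    linarith

/-- Radius of the interval on which a `Λ`-Lipschitz unit tangent is transversal to a given
direction. -/
def coercivityRadius (L g Λ : ℝ) : ℝ := min (L / 2) (g / (4 * L * Λ))

/-- Coercivity constant for `Λ`-Lipschitz unit tangents on `[0, L]` whose integral has norm at most
`L - g`. -/
def coercivityConst (L g Λ : ℝ) : ℝ :=
  coercivityRadius L g Λ / 2 * ((coercivityRadius L g Λ / (4 * L)) ^ 2 * (g / (4 * L)))

lemma coercivityRadius_pos {L g Λ : ℝ} (hL : 0 < L) (hg : 0 < g) (hΛ : 0 < Λ) :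
    0 < coercivityRadius L g Λ := lt_min (by positivity) (by positivity)

lemma coercivityConst_pos {L g Λ : ℝ} (hL : 0 < L) (hg : 0 < g) (hΛ : 0 < Λ) :
    0 < coercivityConst L g Λ := by
  have := coercivityRadius_pos hL hg hΛ
  unfold coercivityConst; positivity

/-- The integral of ⟨V, τ⟩ is at most L - g in absolute value, so |⟨V, τ⟩| ≤ 1 - g / (2 L) at some
t₀. By the Lipschitz bound it stays below 1 - g / (4 L) within distance r of t₀, and there ‖pr_τ^⊥
V‖² is at least g / (4 L). The weight vanishes at 0 and L; on the middle half of an interval of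
length r inside [0, L] both of its factors are at least r / (4 L). -/
lemma coercivityConst_le_of_unit {L g Λ : ℝ} (hL : 0 < L) (hg : 0 < g) (hΛ : 0 < Λ)
    {τ : ℝ → E m} (hlip : ∀ x ∈ Icc 0 L, ∀ y ∈ Icc 0 L, ‖τ x - τ y‖ ≤ Λ * |x - y|)
    (hcont : ContinuousOn τ (Icc 0 L))
    (hτ : ∀ t ∈ Icc 0 L, ‖τ t‖ = 1) (hint : ‖∫ t in Icc 0 L, τ t‖ ≤ L - g) {V : E m}
    (hV : ‖V‖ = 1) :
    coercivityConst L g Λ ≤ ∫ t in Icc 0 L, (1 - t / L) * (t / L) * ‖projPerp (τ t) V‖ ^ 2 := by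
  have hgL : g ≤ L := by linarith [norm_nonneg (∫ t in Icc 0 L, τ t)]
  have hfc : ContinuousOn (fun t => inner ℝ V (τ t)) (Icc 0 L) := by fun_prop
  obtain ⟨t₀, ht₀, hft₀⟩ := exists_abs_le_of_abs_integral_le hL hg hgL hfc (by
    rw [integral_inner hcont.integrableOn_Icc]
    exact (abs_real_inner_le_norm _ _).trans (by rw [hV, one_mul]; exact hint))
  set r := coercivityRadius L g Λ with hr
  have hr0 : 0 < r := coercivityRadius_pos hL hg hΛ
  have hrL : r ≤ L / 2 := min_le_left _ _
  have hrΛ : Λ * r ≤ g / (4 * L) := by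
    have : r ≤ g / (4 * L * Λ) := min_le_right _ _
    calc Λ * r ≤ Λ * (g / (4 * L * Λ)) := by gcongr
      _ = _ := by field_simp
  -- The interval of length r starts or ends at t₀, on the side where [0, L] has room for it; r ≤ L
  -- / 2 guarantees that there is one.
  obtain ⟨a, ha0, haL, hat⟩ : ∃ a, 0 ≤ a ∧ a + r ≤ L ∧ ∀ t ∈ Icc a (a + r), |t - t₀| ≤ r := by
    rcases le_total t₀ (L / 2) with h | h
    · exact ⟨t₀, ht₀.1, by linarith, fun t ht => abs_le.2 ⟨by linarith [ht.1], by linarith [ht.2]⟩⟩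
    · exact ⟨t₀ - r, by linarith, by linarith [ht₀.2],
        fun t ht => abs_le.2 ⟨by linarith [ht.1], by linarith [ht.2]⟩⟩
  have hsub : Icc (a + r / 4) (a + 3 * r / 4) ⊆ Icc 0 L :=
    Icc_subset_Icc (by linarith) (by linarith)
  have hFc : ContinuousOn (fun t => (1 - t / L) * (t / L) * ‖projPerp (τ t) V‖ ^ 2) (Icc 0 L) := by
    unfold projPerp; fun_prop
  have hFi := hFc.integrableOn_Icc (μ := volume)
  have hw : ∀ t ∈ Icc 0 L, 0 ≤ (1 - t / L) * (t / L) := fun t ht =>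
    mul_nonneg (sub_nonneg.2 ((div_le_one hL).2 ht.2)) (div_nonneg ht.1 hL.le)
  refine le_trans ?_ (setIntegral_mono_set hFi ?_ hsub.eventuallyLE)
  · have : ∫ _ in Icc (a + r / 4) (a + 3 * r / 4), ((r / (4 * L)) ^ 2 * (g / (4 * L))) =
        coercivityConst L g Λ := by
      rw [setIntegral_const, Real.volume_real_Icc_of_le (by linarith), smul_eq_mul,
        coercivityConst, ← hr]
      ring
    rw [← this]
    refine setIntegral_mono_on (integrable_const _) (hFi.mono_set hsub) measurableSet_Icc ?_
    intro t ht
    have htL := hsub ht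
    have h1 : r / (4 * L) ≤ t / L := by
      rw [div_le_div_iff₀ (by positivity) hL]; nlinarith [ht.1]
    have h2 : r / (4 * L) ≤ 1 - t / L := by
      rw [le_sub_iff_add_le, ← le_sub_iff_add_le, div_le_iff₀ (by positivity)]
      have : (1 - t / L) * (4 * L) = 4 * (L - t) := by field_simp
      rw [this]; linarith [ht.2]
    have h3 : g / (4 * L) ≤ ‖projPerp (τ t) V‖ ^ 2 := by
      rw [norm_projPerp_sq (hτ t htL), hV, real_inner_comm]
      have h4 : |inner ℝ V (τ t) - inner ℝ V (τ t₀)| ≤ g / (4 * L) := by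
        rw [← inner_sub_right]
        refine (abs_real_inner_le_norm _ _).trans ?_
        rw [hV, one_mul]
        refine (hlip t htL t₀ ht₀).trans (le_trans ?_ hrΛ)
        gcongr
        exact hat t ⟨by linarith [ht.1], by linarith [ht.2]⟩
      have h5 : |inner ℝ V (τ t)| ≤ 1 - g / (4 * L) := by
        have h6 := abs_sub_abs_le_abs_sub (inner ℝ V (τ t)) (inner ℝ V (τ t₀))
        have h7 : g / (2 * L) = g / (4 * L) + g / (4 * L) := by field_simp; ring
        linarith
      rw [← sq_abs (inner ℝ V (τ t))]
      have h8 : 0 < g / (4 * L) := by positivity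
      nlinarith [abs_nonneg (inner ℝ V (τ t))]
    have h9 : 0 ≤ r / (4 * L) := by positivity
    calc (r / (4 * L)) ^ 2 * (g / (4 * L)) = r / (4 * L) * (r / (4 * L)) * (g / (4 * L)) := by ring
      _ ≤ (1 - t / L) * (t / L) * ‖projPerp (τ t) V‖ ^ 2 := by
        have := h9.trans h2
        have := h9.trans h1
        have := hw t htL
        gcongr
  · filter_upwards [ae_restrict_mem measurableSet_Icc] with t ht
    exact mul_nonneg (hw t ht) (sq_nonneg _)

lemma coercivityConst_mul_le {L g Λ : ℝ} (hL : 0 < L) (hg : 0 < g) (hΛ : 0 < Λ)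
    {τ : ℝ → E m} (hlip : ∀ x ∈ Icc 0 L, ∀ y ∈ Icc 0 L, ‖τ x - τ y‖ ≤ Λ * |x - y|)
    (hcont : ContinuousOn τ (Icc 0 L))
    (hτ : ∀ t ∈ Icc 0 L, ‖τ t‖ = 1) (hint : ‖∫ t in Icc 0 L, τ t‖ ≤ L - g) (V : E m) :
    coercivityConst L g Λ * ‖V‖ ^ 2 ≤
      ∫ t in Icc 0 L, (1 - t / L) * (t / L) * ‖projPerp (τ t) V‖ ^ 2 := by
  rcases eq_or_ne V 0 with rfl | hV
  · simp
  have hV' : 0 < ‖V‖ := norm_pos_iff.2 hV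
  have h1 := coercivityConst_le_of_unit hL hg hΛ hlip hcont hτ hint
    (V := ‖V‖⁻¹ • V) (norm_smul_inv_norm hV)
  have e : ∀ t, (1 - t / L) * (t / L) * ‖projPerp (τ t) (‖V‖⁻¹ • V)‖ ^ 2 =
      (‖V‖⁻¹) ^ 2 * ((1 - t / L) * (t / L) * ‖projPerp (τ t) V‖ ^ 2) := fun t => by
    rw [projPerp_smul, norm_smul, norm_inv, norm_norm]; ring
  simp_rw [e] at h1
  rw [integral_const_mul, inv_pow, inv_mul_eq_div, le_div_iff₀ (by positivity)] at h1
  exact h1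

lemma CoerciveFrame.of_lipschitz {L g Λ : ℝ} (hL : 0 < L) (hg : 0 < g) (hΛ : 0 < Λ)
    {τ : ℝ → E m} (hlip : ∀ x ∈ Icc 0 L, ∀ y ∈ Icc 0 L, ‖τ x - τ y‖ ≤ Λ * |x - y|)
    (hcont : ContinuousOn τ (Icc 0 L))
    (hτ : ∀ t ∈ Icc 0 L, ‖τ t‖ = 1) (hint : ‖∫ t in Icc 0 L, τ t‖ ≤ L - g) :
    CoerciveFrame (volume.restrict (Icc 0 L)) (coercivityConst L g Λ) L τ (fun t => t / L) where
  finite := inferInstance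
  mass := by simp [measureReal_restrict_apply, hL.le]
  meas_tangent := hcont.aestronglyMeasurable measurableSet_Icc
  meas_param := (continuous_id.div_const L).aestronglyMeasurable
  norm_tangent := by
    filter_upwards [ae_restrict_mem measurableSet_Icc] with t ht using hτ t ht
  param_mem := by
    filter_upwards [ae_restrict_mem measurableSet_Icc] with t ht
    exact ⟨div_nonneg ht.1 hL.le, (div_le_one hL).2 ht.2⟩
  pos := coercivityConst_pos hL hg hΛ
  coercive := coercivityConst_mul_le hL hg hΛ hlip hcont hτ hint

lemma continuousOn_of_norm_sub_le {F : Type*} [NormedAddCommGroup F] {f : ℝ → F} {s : Set ℝ} {Λ : ℝ}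
    (hΛ : 0 ≤ Λ) (h : ∀ x ∈ s, ∀ y ∈ s, ‖f x - f y‖ ≤ Λ * |x - y|) : ContinuousOn f s :=
  LipschitzOnWith.continuousOn (K := Λ.toNNReal) <| LipschitzOnWith.of_dist_le_mul fun x hx y hy => by
    rw [dist_eq_norm, Real.dist_eq, Real.coe_toNNReal _ hΛ]; exact h x hx y hy

/-! ### Weak derivatives on an interval -/

section Weak

set_option linter.unusedSectionVars false

variable {F : Type*} [NormedAddCommGroup F] [NormedSpace ℝ F] [CompleteSpace F] {L : ℝ}

lemma absolutelyContinuousOnInterval_of_norm_sub_le (hL : 0 ≤ L) {f : ℝ → F} {Λ : ℝ} (hΛ : 0 ≤ Λ)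
    (h : ∀ x ∈ Icc 0 L, ∀ y ∈ Icc 0 L, ‖f x - f y‖ ≤ Λ * |x - y|) :
    AbsolutelyContinuousOnInterval f 0 L := by
  refine LipschitzOnWith.absolutelyContinuousOnInterval (K := Λ.toNNReal) ?_
  refine LipschitzOnWith.of_dist_le_mul fun x hx y hy => ?_
  rw [uIcc_of_le hL] at hx hy
  rw [dist_eq_norm, Real.dist_eq, Real.coe_toNNReal _ hΛ]
  exact h x hx y hy

lemma norm_primitive_sub_le {v : ℝ → F} {M : ℝ} (hv : IntegrableOn v (Icc 0 L))
    (hM : ∀ᵐ t ∂volume.restrict (Icc 0 L), ‖v t‖ ≤ M) {x y : ℝ} (hx : x ∈ Icc 0 L)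
    (hy : y ∈ Icc 0 L) :
    ‖(∫ t in (0 : ℝ)..x, v t) - ∫ t in (0 : ℝ)..y, v t‖ ≤ M * |x - y| := by
  have hi : ∀ z ∈ Icc 0 L, IntervalIntegrable v volume 0 z := fun z hz =>
    (intervalIntegrable_iff_integrableOn_Icc_of_le hz.1).2 (hv.mono_set (Icc_subset_Icc_right hz.2))
  rw [intervalIntegral.integral_interval_sub_left (hi x hx) (hi y hy)]
  refine intervalIntegral.norm_integral_le_of_norm_le_const_ae ?_
  rw [ae_restrict_iff' measurableSet_Icc] at hM
  filter_upwards [hM] with t ht hty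
  have := uIoc_subset_uIcc hty
  exact ht (uIcc_subset_Icc hy hx this)

/-- An almost everywhere classical derivative of a Lipschitz function is a weak derivative. -/
lemma hasWeakDeriv_of_ae_hasDerivAt (hL : 0 < L) {u v : ℝ → F} {K M : ℝ} (hK : 0 ≤ K)
    (hu : ∀ x ∈ Icc 0 L, ∀ y ∈ Icc 0 L, ‖u x - u y‖ ≤ K * |x - y|)
    (hv : IntegrableOn v (Icc 0 L)) (hM : ∀ᵐ t ∂volume.restrict (Icc 0 L), ‖v t‖ ≤ M)
    (hd : ∀ᵐ t, t ∈ Icc 0 L → HasDerivAt u (v t) t) : HasWeakDeriv L u v := by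
  have huc : ContinuousOn u (Icc 0 L) := continuousOn_of_norm_sub_le hK hu
  refine ⟨huc.integrableOn_Icc, hv, fun φ hφ _ hsupp => ?_⟩
  have hφ1 : ContDiff ℝ 1 φ := hφ.of_le (by exact_mod_cast le_top)
  have hφd : Continuous (deriv φ) := hφ1.continuous_deriv le_rfl
  have hφ0 : φ 0 = 0 := image_eq_zero_of_notMem_tsupport fun h => lt_irrefl _ (hsupp h).1
  have hφL : φ L = 0 := image_eq_zero_of_notMem_tsupport fun h => lt_irrefl _ (hsupp h).2
  have i1 : IntegrableOn (fun t => deriv φ t • u t) (Icc 0 L) :=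
    (hφd.continuousOn.smul huc).integrableOn_Icc
  have i2 : IntegrableOn (fun t => φ t • v t) (Icc 0 L) :=
    hv.continuousOn_smul hφ.continuous.continuousOn isCompact_Icc
  have hi : IntegrableOn (fun t => deriv φ t • u t + φ t • v t) (Icc 0 L) := i1.add i2
  obtain ⟨A, hA⟩ := isCompact_Icc.exists_bound_of_continuousOn (hφd.continuousOn.smul huc)
  obtain ⟨B, hB⟩ := isCompact_Icc.exists_bound_of_continuousOn
    (hφ.continuous.continuousOn (s := Icc 0 L))
  have hB0 : 0 ≤ B := (norm_nonneg _).trans (hB 0 ⟨le_rfl, hL.le⟩)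
  have hbound : ∀ᵐ t ∂volume.restrict (Icc 0 L),
      ‖deriv φ t • u t + φ t • v t‖ ≤ A + B * M := by
    filter_upwards [hM, ae_restrict_mem measurableSet_Icc] with t ht htm
    refine (norm_add_le _ _).trans (add_le_add (hA t htm) ?_)
    rw [norm_smul]
    exact mul_le_mul (hB t htm) ht (norm_nonneg _) hB0
  have hABM : 0 ≤ |A + B * M| := abs_nonneg _
  have ac1 : AbsolutelyContinuousOnInterval (fun t => φ t • u t) 0 L :=
    (hφ1.contDiffOn.absolutelyContinuousOnInterval).fun_smul
      (absolutelyContinuousOnInterval_of_norm_sub_le hL.le hK hu)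
  have ac2 : AbsolutelyContinuousOnInterval
      (fun x => ∫ t in (0 : ℝ)..x, (deriv φ t • u t + φ t • v t)) 0 L :=
    absolutelyContinuousOnInterval_of_norm_sub_le hL.le hABM fun x hx y hy =>
      (norm_primitive_sub_le hi hbound hx hy).trans (by gcongr; exact le_abs_self _)
  -- The function φ u - ∫ (φ' u + φ v) is absolutely continuous with derivative zero almost
  -- everywhere, hence constant. Equating its values at 0 and at L, where φ vanishes, is the
  -- integration by parts.
  obtain ⟨C, hC⟩ := (ac1.fun_sub ac2).const_of_ae_hasDerivAt_zero (by
    have hI : IntervalIntegrable (fun t => deriv φ t • u t + φ t • v t) volume 0 L :=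
      (intervalIntegrable_iff_integrableOn_Icc_of_le hL.le).2 hi
    filter_upwards [hd, hI.ae_hasDerivAt_integral] with t h1 h2 ht
    have h3 := h1 (by rwa [uIcc_of_le hL.le] at ht)
    have h4 := h2 ht 0 left_mem_uIcc
    have h5 := (hφ1.differentiable one_ne_zero t).hasDerivAt.fun_smul h3
    have h6 := h5.fun_sub h4
    rwa [add_comm, sub_self] at h6)
  have e0 := hC 0 left_mem_uIcc
  have eL := hC L right_mem_uIcc
  rw [intervalIntegral.integral_same, hφ0, zero_smul, sub_zero] at e0
  rw [hφL, zero_smul, zero_sub, ← e0, neg_eq_zero, intervalIntegral.integral_add] at eL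
  · exact eq_neg_of_add_eq_zero_left eL
  · exact (intervalIntegrable_iff_integrableOn_Icc_of_le hL.le).2 i1
  · exact (intervalIntegrable_iff_integrableOn_Icc_of_le hL.le).2 i2

lemma integral_smul_eq_interval {φ : ℝ → ℝ} (hL : 0 < L) (h : tsupport φ ⊆ Ioo 0 L) (w : ℝ → F) :
    ∫ t, φ t • w t = ∫ t in (0 : ℝ)..L, φ t • w t := by
  rw [intervalIntegral.integral_of_le hL.le, setIntegral_eq_integral_of_forall_compl_eq_zero]
  intro x hx
  rw [image_eq_zero_of_notMem_tsupport fun h' => hx (Ioo_subset_Ioc_self (h h')), zero_smul]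

lemma exists_Icc_of_isCompact_subset_Ioo {K : Set ℝ} (hL : 0 < L) (hK : IsCompact K)
    (h : K ⊆ Ioo 0 L) : ∃ a b, 0 < a ∧ b < L ∧ a ≤ b ∧ K ⊆ Icc a b := by
  -- The point L / 2 is added so that least and greatest elements exist even for empty K.
  have hK' : IsCompact (insert (L / 2) K) := hK.insert _
  have hsub : insert (L / 2) K ⊆ Ioo 0 L :=
    insert_subset ⟨by positivity, by linarith⟩ h
  have hne : (insert (L / 2) K).Nonempty := insert_nonempty _ _
  obtain ⟨a, ha⟩ := hK'.exists_isLeast hne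
  obtain ⟨b, hb⟩ := hK'.exists_isGreatest hne
  exact ⟨a, b, (hsub ha.1).1, (hsub hb.1).2, ha.2 hb.1,
    fun x hx => ⟨ha.2 (mem_insert_of_mem _ hx), hb.2 (mem_insert_of_mem _ hx)⟩⟩

/-- The lemma of du Bois-Reymond. -/
lemma ae_eq_const_of_integral_deriv_smul_eq_zero (hL : 0 < L) {w : ℝ → F}
    (hw : IntegrableOn w (Icc 0 L))
    (h : ∀ φ : ℝ → ℝ, ContDiff ℝ (⊤ : ℕ∞) φ → HasCompactSupport φ → tsupport φ ⊆ Ioo 0 L →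
      ∫ t in (0 : ℝ)..L, deriv φ t • w t = 0) :
    ∃ c : F, w =ᵐ[volume.restrict (Icc 0 L)] fun _ => c := by
  -- A test function η of integral 1 supported in [L / 4, 3 L / 4]. If w is constant, the constant
  -- must be the integral of η w.
  let β : ContDiffBump (L / 2) := ⟨L / 8, L / 4, by positivity, by linarith⟩
  let η : ℝ → ℝ := β.normed volume
  have hη : ContDiff ℝ (⊤ : ℕ∞) η := β.contDiff_normed
  have hηt : tsupport η = Metric.closedBall (L / 2) (L / 4) := β.tsupport_normed_eq
  have hηs : tsupport η ⊆ Ioo 0 L := by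
    rw [hηt, Real.closedBall_eq_Icc]
    exact fun x hx => ⟨by linarith [hx.1], by linarith [hx.2]⟩
  have hηc : HasCompactSupport η := β.hasCompactSupport_normed
  have hη1 : ∫ t, η t = 1 := β.integral_normed
  set c := ∫ t in (0 : ℝ)..L, η t • w t with hc
  have hwi : ∀ f : ℝ → ℝ, Continuous f → IntervalIntegrable (fun t => f t • w t) volume 0 L :=
    fun f hf => (intervalIntegrable_iff_integrableOn_Icc_of_le hL.le).2
      (hw.continuousOn_smul hf.continuousOn isCompact_Icc)
  have key : ∀ᵐ x, x ∈ Ioo 0 L → w x - c = 0 := by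
    refine isOpen_Ioo.ae_eq_zero_of_integral_contDiff_smul_eq_zero
      ((hw.mono_set Ioo_subset_Icc_self).locallyIntegrableOn.sub
        (integrableOn_const (by simp)).locallyIntegrableOn) ?_
    intro φ hφ hφc hφs
    -- Subtracting A η makes the mean zero, so the primitive ψ of g vanishes beyond the supports and
    -- is admissible in `h`. This turns the hypothesis on derivatives into ∫ φ w = A c for arbitrary
    -- φ.
    set A := ∫ t, φ t with hA
    let g : ℝ → ℝ := fun t => φ t - A * η t
    have hg : ContDiff ℝ (⊤ : ℕ∞) g := hφ.sub (contDiff_const.mul hη)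
    let ψ : ℝ → ℝ := fun t => ∫ s in (0 : ℝ)..t, g s
    have hψd : ∀ t, HasDerivAt ψ (g t) t := fun t =>
      intervalIntegral.integral_hasDerivAt_right (hg.continuous.intervalIntegrable _ _)
        hg.continuous.stronglyMeasurable.stronglyMeasurableAtFilter hg.continuous.continuousAt
    have hψ' : deriv ψ = g := funext fun t => (hψd t).deriv
    have hψ : ContDiff ℝ (⊤ : ℕ∞) ψ := contDiff_infty_iff_deriv.2
      ⟨fun t => (hψd t).differentiableAt, hψ' ▸ hg⟩
    obtain ⟨a, b, ha, hb, hab, hsub⟩ := exists_Icc_of_isCompact_subset_Ioo hL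
      (hφc.isCompact.union hηc.isCompact) (union_subset hφs hηs)
    have hg0 : ∀ t, t ∉ Icc a b → g t = 0 := fun t ht => by
      have h1 : φ t = 0 := image_eq_zero_of_notMem_tsupport fun h => ht (hsub (Or.inl h))
      have h2 : η t = 0 := image_eq_zero_of_notMem_tsupport fun h => ht (hsub (Or.inr h))
      simp [g, h1, h2]
    have hgint : ∫ t, g t = 0 := by
      have h1 : Integrable φ := hφ.continuous.integrable_of_hasCompactSupport hφc
      have h2 : Integrable η := hη.continuous.integrable_of_hasCompactSupport hηc
      simp only [g]
      rw [integral_sub h1 (h2.const_mul A), integral_const_mul, hη1, mul_one, sub_self]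
    have hψ0 : ∀ t, t ∉ Icc a b → ψ t = 0 := by
      intro t ht
      rcases lt_or_ge t a with h1 | h1
      · refine (intervalIntegral.integral_congr (g := fun _ => (0 : ℝ)) ?_).trans (by simp)
        intro s hs
        refine hg0 s fun h2 => ?_
        rcases le_total 0 t with h3 | h3
        · rw [uIcc_of_le h3] at hs; linarith [hs.2, h2.1]
        · rw [uIcc_of_ge h3] at hs; linarith [hs.2, h2.1]
      · have h2 : b < t := by
          by_contra h3; exact ht ⟨h1, not_lt.1 h3⟩
        have h3 : (0 : ℝ) ≤ t := by linarith
        simp only [ψ]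
        rw [intervalIntegral.integral_of_le h3, setIntegral_eq_integral_of_forall_compl_eq_zero,
          hgint]
        intro x hx
        refine hg0 x fun h4 => hx ⟨by linarith [h4.1], by linarith [h4.2]⟩
    have hψs : tsupport ψ ⊆ Icc a b := by
      refine closure_minimal (fun t ht => ?_) isClosed_Icc
      by_contra h1
      exact ht (hψ0 t h1)
    have h1 := h ψ hψ (HasCompactSupport.of_support_subset_isCompact isCompact_Icc
      ((subset_tsupport _).trans hψs))
      (hψs.trans fun x hx => ⟨ha.trans_le hx.1, hx.2.trans_lt hb⟩)
    rw [hψ'] at h1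
    have e1 : ∀ t, g t • w t = φ t • w t - A • (η t • w t) := fun t => by
      simp only [g, sub_smul, mul_smul]
    simp_rw [e1] at h1
    rw [intervalIntegral.integral_sub (hwi φ hφ.continuous)
      (g := fun t => A • (η t • w t)) ((hwi η hη.continuous).smul A),
      intervalIntegral.integral_smul, ← hc] at h1
    rw [integral_smul_eq_interval hL hφs]
    simp_rw [smul_sub]
    rw [intervalIntegral.integral_sub (hwi φ hφ.continuous) (g := fun t => φ t • c)
      ((hφ.continuous.smul continuous_const).intervalIntegrable _ _),
      ← integral_smul_eq_interval hL hφs (fun _ => c), integral_smul_const, ← hA, h1]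
  refine ⟨c, ?_⟩
  rw [Filter.EventuallyEq, ← restrict_Ioo_eq_restrict_Icc, ae_restrict_iff' measurableSet_Ioo]
  filter_upwards [key] with x hx hx' using sub_eq_zero.1 (hx hx')

/-- A function with bounded weak derivative `v` agrees almost everywhere with a Lipschitz primitive
of `v`. -/
lemma HasWeakDeriv.exists_ae_eq_primitive (hL : 0 < L) {u v : ℝ → F} {M : ℝ}
    (h : HasWeakDeriv L u v) (hM : ∀ᵐ t ∂volume.restrict (Icc 0 L), ‖v t‖ ≤ M) (hM0 : 0 ≤ M) :
    ∃ c : F, u =ᵐ[volume.restrict (Icc 0 L)] fun t => c + ∫ r in (0 : ℝ)..t, v r := by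
  obtain ⟨hu, hv, hφ⟩ := h
  have hV : HasWeakDeriv L (fun t => ∫ r in (0 : ℝ)..t, v r) v :=
    hasWeakDeriv_of_ae_hasDerivAt hL hM0 (fun x hx y hy => norm_primitive_sub_le hv hM hx hy)
      hv hM (by
        have hI : IntervalIntegrable v volume 0 L :=
          (intervalIntegrable_iff_integrableOn_Icc_of_le hL.le).2 hv
        filter_upwards [hI.ae_hasDerivAt_integral] with t h2 ht
        exact h2 (by rwa [uIcc_of_le hL.le]) 0 left_mem_uIcc)
  obtain ⟨c, hc⟩ := ae_eq_const_of_integral_deriv_smul_eq_zero hL (hu.sub hV.1) (by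
    intro φ h1 h2 h3
    have hdφ : Continuous (deriv φ) :=
      (h1.of_le (by exact_mod_cast le_top) : ContDiff ℝ 1 φ).continuous_deriv le_rfl
    simp only [Pi.sub_apply, smul_sub]
    rw [intervalIntegral.integral_sub, hφ φ h1 h2 h3, hV.2.2 φ h1 h2 h3, sub_self]
    · exact (intervalIntegrable_iff_integrableOn_Icc_of_le hL.le).2
        (hu.continuousOn_smul hdφ.continuousOn isCompact_Icc)
    · exact (intervalIntegrable_iff_integrableOn_Icc_of_le hL.le).2
        (hV.1.continuousOn_smul hdφ.continuousOn isCompact_Icc))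
  refine ⟨c, ?_⟩
  filter_upwards [hc] with t ht
  rw [← ht]; simp

lemma eqOn_Icc_of_ae_eq (hL : 0 < L) {f g : ℝ → F} (hf : ContinuousOn f (Icc 0 L))
    (hg : ContinuousOn g (Icc 0 L)) (h : f =ᵐ[volume.restrict (Icc 0 L)] g) :
    EqOn f g (Icc 0 L) :=
  Measure.eqOn_Icc_of_ae_eq volume hL.ne h hf hg

end Weak

/-! ### Calculus on `[0, L]` -/

section Calculus

variable {F : Type*} [NormedAddCommGroup F] [NormedSpace ℝ F] {L : ℝ}

lemma hasDerivWithinAt_primitive [CompleteSpace F] {v : ℝ → F} (hv : ContinuousOn v (Icc 0 L))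
    {t : ℝ} (ht : t ∈ Icc 0 L) :
    HasDerivWithinAt (fun t => ∫ r in (0 : ℝ)..t, v r) (v t) (Icc 0 L) t := by
  have : Fact (t ∈ Icc 0 L) := ⟨ht⟩
  refine intervalIntegral.integral_hasDerivWithinAt_right (t := Icc 0 L) ?_ ?_ (hv t ht)
  · exact (hv.mono (by rw [uIcc_of_le ht.1]; exact Icc_subset_Icc_right ht.2)).intervalIntegrable
  · exact hv.stronglyMeasurableAtFilter_nhdsWithin measurableSet_Icc t

/-- Every point of [0, L], including the end points, is a limit of other points of the interval, so
the bound on difference quotients passes to the one-sided derivative. -/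
lemma norm_le_of_hasDerivWithinAt_Icc (hL : 0 < L) {f : ℝ → F} {f' : F} {t M : ℝ}
    (ht : t ∈ Icc 0 L) (hf : HasDerivWithinAt f f' (Icc 0 L) t)
    (hM : ∀ x ∈ Icc 0 L, ‖f x - f t‖ ≤ M * |x - t|) : ‖f'‖ ≤ M := by
  have hne : (nhdsWithin t (Icc 0 L \ {t})).NeBot :=
    ((uniqueDiffOn_Icc hL).uniqueDiffWithinAt ht).accPt |> accPt_principal_iff_nhdsWithin.1
  refine le_of_tendsto (hasDerivWithinAt_iff_tendsto_slope.1 hf).norm ?_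
  filter_upwards [self_mem_nhdsWithin] with x hx
  have h0 : 0 < |x - t| := abs_pos.2 (sub_ne_zero.2 hx.2)
  rw [slope_def_module, norm_smul, norm_inv, Real.norm_eq_abs, inv_mul_le_iff₀ h0, mul_comm]
  exact hM x hx.1

/-- Mean value inequality for the error of a linear approximation. -/
lemma norm_sub_sub_le_of_hasDerivWithinAt {s : Set ℝ} (hs : Convex ℝ s) {f f' : ℝ → F} {M : ℝ}
    (hf : ∀ t ∈ s, HasDerivWithinAt f (f' t) s t)
    {a : F} (hM : ∀ t ∈ s, ‖f' t - a‖ ≤ M) {x y : ℝ} (hx : x ∈ s) (hy : y ∈ s) :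
    ‖f y - f x - (y - x) • a‖ ≤ M * |y - x| := by
  have := hs.norm_image_sub_le_of_norm_hasDerivWithin_le (f := fun t => f t - t • a)
    (f' := fun t => f' t - a) (C := M)
    (fun t ht => by
      simpa using (hf t ht).fun_sub ((hasDerivWithinAt_id t s).smul_const a)) hM hx hy
  rw [Real.norm_eq_abs] at this
  convert this using 2
  rw [sub_smul]; abel

end Calculus

/-! ### Regularity of curves with small constants -/

lemma velocity_eq {L : ℝ} (hL : 0 < L) {γ : ℝ → E m} {t : ℝ} (ht : t ∈ Icc 0 L) {v : E m}
    (h : HasDerivWithinAt γ v (Icc 0 L) t) : velocity L γ t = v :=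
  h.derivWithin ((uniqueDiffOn_Icc hL).uniqueDiffWithinAt ht)

lemma ae_norm_le_of_eLpNorm_top_le {μ : Measure ℝ} {f : ℝ → E m} {M : ℝ} (hM : 0 ≤ M)
    (h : eLpNorm f ∞ μ ≤ ENNReal.ofReal M) : ∀ᵐ t ∂μ, ‖f t‖ ≤ M := by
  filter_upwards [enorm_ae_le_eLpNormEssSup f μ] with t ht
  rw [← eLpNorm_exponent_top] at ht
  have := ht.trans h
  rwa [← ofReal_norm, ENNReal.ofReal_le_ofReal_iff hM] at this

lemma HasWeakDeriv.congr_ae_left {L : ℝ} {F : Type*} [NormedAddCommGroup F] [NormedSpace ℝ F]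
    (hL : 0 < L) {u u' v : ℝ → F}
    (h : HasWeakDeriv L u v) (huu : u =ᵐ[volume.restrict (Icc 0 L)] u') : HasWeakDeriv L u' v := by
  refine ⟨h.1.congr huu, h.2.1, fun φ h1 h2 h3 => ?_⟩
  rw [← h.2.2 φ h1 h2 h3]
  refine intervalIntegral.integral_congr_ae ?_
  rw [uIoc_of_le hL.le, ← ae_restrict_iff' measurableSet_Ioc, restrict_Ioc_eq_restrict_Icc]
  filter_upwards [huu] with t ht
  rw [ht]

lemma intervalIntegral_congr_ae_Icc {L : ℝ} {F : Type*} [NormedAddCommGroup F] [NormedSpace ℝ F]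
    {u v : ℝ → F} (h : u =ᵐ[volume.restrict (Icc 0 L)] v) {t : ℝ} (ht : t ∈ Icc 0 L) :
    ∫ r in (0 : ℝ)..t, u r = ∫ r in (0 : ℝ)..t, v r := by
  refine intervalIntegral.integral_congr_ae ?_
  rw [uIoc_of_le ht.1]
  rw [Filter.EventuallyEq, ae_restrict_iff' measurableSet_Icc] at h
  filter_upwards [h] with x hx hx'
  exact hx ⟨hx'.1.le, hx'.2.trans ht.2⟩

/-- A continuous function with a weak derivative that is almost everywhere equal to a continuous
function `g` is differentiable with derivative `g`. -/
lemma HasWeakDeriv.hasDerivWithinAt {L : ℝ} (hL : 0 < L) {u v g : ℝ → E m}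
    (hu : ContinuousOn u (Icc 0 L)) (h : HasWeakDeriv L u v) (hg : ContinuousOn g (Icc 0 L))
    (hvg : v =ᵐ[volume.restrict (Icc 0 L)] g) {t : ℝ} (ht : t ∈ Icc 0 L) :
    HasDerivWithinAt u (g t) (Icc 0 L) t := by
  obtain ⟨B, hB⟩ := isCompact_Icc.exists_bound_of_continuousOn hg
  have hB0 : 0 ≤ B := (norm_nonneg _).trans (hB 0 ⟨le_rfl, hL.le⟩)
  obtain ⟨c, hc⟩ := h.exists_ae_eq_primitive hL (M := B) (by
    filter_upwards [hvg, ae_restrict_mem measurableSet_Icc] with t h1 h2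
    rw [h1]; exact hB t h2) hB0
  have hG : ∀ t ∈ Icc 0 L, HasDerivWithinAt (fun t => c + ∫ r in (0 : ℝ)..t, g r) (g t)
      (Icc 0 L) t := fun t ht => (hasDerivWithinAt_primitive hg ht).const_add c
  have heq : EqOn u (fun t => c + ∫ r in (0 : ℝ)..t, g r) (Icc 0 L) := by
    refine eqOn_Icc_of_ae_eq hL hu (fun t ht => (hG t ht).continuousWithinAt) ?_
    filter_upwards [hc, ae_restrict_mem measurableSet_Icc] with t h1 h2
    rw [h1, intervalIntegral_congr_ae_Icc hvg h2]
  exact (hG t ht).congr heq (heq ht)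

lemma HasWeakDeriv.exists_lipschitz {L : ℝ} (hL : 0 < L) {u v : ℝ → E m} {M : ℝ}
    (h : HasWeakDeriv L u v) (hM : ∀ᵐ t ∂volume.restrict (Icc 0 L), ‖v t‖ ≤ M) (hM0 : 0 ≤ M) :
    ∃ g : ℝ → E m, u =ᵐ[volume.restrict (Icc 0 L)] g ∧
      ∀ x ∈ Icc 0 L, ∀ y ∈ Icc 0 L, ‖g x - g y‖ ≤ M * |x - y| := by
  obtain ⟨c, hc⟩ := h.exists_ae_eq_primitive hL hM hM0
  refine ⟨_, hc, fun x hx y hy => ?_⟩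
  rw [add_sub_add_left_eq_sub]
  exact norm_primitive_sub_le h.2.1 hM hx hy

/-- A unit-speed curve whose velocity is `M`-Lipschitz, with `M`-Lipschitz derivative `a`. -/
structure RegularCurve (L M : ℝ) (γ a : ℝ → E m) : Prop where
  deriv : ∀ t ∈ Icc 0 L, HasDerivWithinAt γ (velocity L γ t) (Icc 0 L) t
  norm_velocity : ∀ t ∈ Icc 0 L, ‖velocity L γ t‖ = 1
  deriv_velocity : ∀ t ∈ Icc 0 L, HasDerivWithinAt (velocity L γ) (a t) (Icc 0 L) t
  norm_accel : ∀ t ∈ Icc 0 L, ‖a t‖ ≤ M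
  lipschitz_accel : ∀ x ∈ Icc 0 L, ∀ y ∈ Icc 0 L, ‖a x - a y‖ ≤ M * |x - y|

lemma norm_velocity_eq_one_of_feasible {d : ClampedData m} {p : ℝ≥0∞} {γ : ℝ → E m}
    (h : γ ∈ feasible d p) {t : ℝ} (ht : t ∈ Icc 0 d.L) : ‖velocity d.L γ t‖ = 1 := by
  obtain ⟨⟨-, -, B, hB⟩, -, -, -, -, hs⟩ := h
  have h0 : 0 < ‖velocity d.L γ t‖ := norm_pos_iff.2 (hB t ht).1
  exact Real.eq_one_of_pos_of_log_eq_zero h0 (hs t ht)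

/-- The seminorm is an infimum over families of weak derivatives. The slack 1 makes the inequality
strict, so that a family can be picked without showing that the infimum is attained. -/
lemma exists_areWeakDerivs_of_sobolevSeminorm_le {L : ℝ} {k : ℕ} {u : ℝ → E m} {K : ℝ}
    (hK : 0 ≤ K) (h : sobolevSeminorm L k ∞ u ≤ ENNReal.ofReal K) :
    ∃ D : ℕ → ℝ → E m, AreWeakDerivs L k u D ∧
      ∀ᵐ t ∂volume.restrict (Icc 0 L), ‖D k t‖ ≤ K + 1 := by
  have h1 : sobolevSeminorm L k ∞ u < ENNReal.ofReal (K + 1) :=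
    h.trans_lt ((ENNReal.ofReal_lt_ofReal_iff (by linarith)).2 (by linarith))
  rw [sobolevSeminorm, iInf_lt_iff] at h1
  obtain ⟨D, h2⟩ := h1
  rw [iInf_lt_iff] at h2
  obtain ⟨hD, h3⟩ := h2
  exact ⟨D, hD, ae_norm_le_of_eLpNorm_top_le (by linarith) h3.le⟩

/-- Bounded weak derivatives yield Lipschitz representatives one order lower. The family D of order
three makes the second derivative a Lipschitz function a, and the velocity its classical primitive.
The family A of order two is needed only for the uniform Lipschitz bound on the velocity. -/
lemma exists_regularCurve {d : ClampedData m} {p : ℝ≥0∞} {K₁ : ℝ} (hK₁ : 0 ≤ K₁) {γ : ℝ → E m}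
    (h : γ ∈ priors d p K₁) : ∃ a : ℝ → E m, RegularCurve d.L (K₁ + 1) γ a := by
  obtain ⟨hfeas, -, h2, h3⟩ := h
  have hL := d.L_pos
  have hM : 0 ≤ K₁ + 1 := by linarith
  have hγ : ContinuousOn γ (Icc 0 d.L) := hfeas.1.1
  obtain ⟨A, ⟨hA0, hA⟩, hA2⟩ := exists_areWeakDerivs_of_sobolevSeminorm_le hK₁ h2
  obtain ⟨D, ⟨hD0, hD⟩, hD3⟩ := exists_areWeakDerivs_of_sobolevSeminorm_le hK₁ h3
  obtain ⟨g, hg, hglip⟩ := (hA 1 (by norm_num)).exists_lipschitz hL hA2 hM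
  have hgc := continuousOn_of_norm_sub_le hM hglip
  have hγd : ∀ t ∈ Icc 0 d.L, HasDerivWithinAt γ (g t) (Icc 0 d.L) t := fun t ht =>
    (hA0 ▸ hA 0 (by norm_num) : HasWeakDeriv d.L γ (A 1)).hasDerivWithinAt hL hγ hgc hg ht
  have hvg : ∀ t ∈ Icc 0 d.L, velocity d.L γ t = g t := fun t ht => velocity_eq hL ht (hγd t ht)
  obtain ⟨a, ha, halip⟩ := (hD 2 (by norm_num)).exists_lipschitz hL hD3 hM
  have hac := continuousOn_of_norm_sub_le hM halip
  obtain ⟨B, hB⟩ := isCompact_Icc.exists_bound_of_continuousOn hac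
  have hB0 : 0 ≤ B := (norm_nonneg _).trans (hB 0 ⟨le_rfl, hL.le⟩)
  obtain ⟨f, hf, hflip⟩ := (hD 1 (by norm_num)).exists_lipschitz hL (M := B) (by
    filter_upwards [ha, ae_restrict_mem measurableSet_Icc] with t h1 h2
    rw [h1]; exact hB t h2) hB0
  have hfc := continuousOn_of_norm_sub_le hB0 hflip
  have hvf : ∀ t ∈ Icc 0 d.L, velocity d.L γ t = f t := fun t ht => velocity_eq hL ht
    ((hD0 ▸ hD 0 (by norm_num) : HasWeakDeriv d.L γ (D 1)).hasDerivWithinAt hL hγ hfc hf ht)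
  have hfd : ∀ t ∈ Icc 0 d.L, HasDerivWithinAt f (a t) (Icc 0 d.L) t := fun t ht =>
    ((hD 1 (by norm_num)).congr_ae_left hL hf).hasDerivWithinAt hL hfc hac ha ht
  have hvd : ∀ t ∈ Icc 0 d.L, HasDerivWithinAt (velocity d.L γ) (a t) (Icc 0 d.L) t :=
    fun t ht => (hfd t ht).congr hvf (hvf t ht)
  refine ⟨a, fun t ht => (hvg t ht).symm ▸ hγd t ht,
    fun t ht => norm_velocity_eq_one_of_feasible hfeas ht, hvd, fun t ht => ?_, halip⟩
  -- The bound B on a from compactness is not uniform in γ; the uniform one comes from the Lipschitz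
  -- constant of the velocity.
  refine norm_le_of_hasDerivWithinAt_Icc hL ht (hvd t ht) fun x hx => ?_
  rw [hvg x hx, hvg t ht]
  exact hglip x hx t ht

namespace RegularCurve

variable {L M : ℝ} {γ a : ℝ → E m}

lemma norm_velocity_sub_le (H : RegularCurve L M γ a) {x y : ℝ} (hx : x ∈ Icc 0 L)
    (hy : y ∈ Icc 0 L) : ‖velocity L γ x - velocity L γ y‖ ≤ M * |x - y| := by
  have := (convex_Icc 0 L).norm_image_sub_le_of_norm_hasDerivWithin_le H.deriv_velocity
    H.norm_accel hy hx
  rwa [Real.norm_eq_abs] at this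

lemma continuousOn_velocity (H : RegularCurve L M γ a) : ContinuousOn (velocity L γ) (Icc 0 L) :=
  fun t ht => (H.deriv_velocity t ht).continuousWithinAt

lemma continuousOn (H : RegularCurve L M γ a) : ContinuousOn γ (Icc 0 L) :=
  fun t ht => (H.deriv t ht).continuousWithinAt

lemma norm_velocity_sub_sub_le (H : RegularCurve L M γ a) (hM : 0 ≤ M) {x y z : ℝ}
    (hx : x ∈ Icc 0 L) (hy : y ∈ Icc 0 L) (hz : z ∈ Icc x y) :
    ‖velocity L γ y - velocity L γ x - (y - x) • a z‖ ≤ M * |y - x| * |y - x| := by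
  have hsub : Icc x y ⊆ Icc 0 L := Icc_subset_Icc hx.1 hy.2
  have hxy : x ≤ y := hz.1.trans hz.2
  refine norm_sub_sub_le_of_hasDerivWithinAt (convex_Icc x y)
    (fun t ht => (H.deriv_velocity t (hsub ht)).mono hsub) (fun t ht => ?_)
    (left_mem_Icc.2 hxy) (right_mem_Icc.2 hxy)
  refine (H.lipschitz_accel t (hsub ht) z (hsub hz)).trans ?_
  refine mul_le_mul_of_nonneg_left ?_ hM
  rw [abs_of_nonneg (sub_nonneg.2 hxy)]
  exact abs_le.2 ⟨by linarith [ht.1, hz.2], by linarith [ht.2, hz.1]⟩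

/-- Midpoint rule. -/
lemma norm_chord_sub_le (H : RegularCurve L M γ a) (hM : 0 ≤ M) {x y : ℝ} (hx : x ∈ Icc 0 L)
    (hy : y ∈ Icc 0 L) (hxy : x ≤ y) :
    ‖γ y - γ x - (y - x) • velocity L γ ((x + y) / 2)‖ ≤ M * (y - x) ^ 2 * (y - x) := by
  have hsub : Icc x y ⊆ Icc 0 L := Icc_subset_Icc hx.1 hy.2
  set z := (x + y) / 2 with hz
  have hzm : z ∈ Icc x y := ⟨by rw [hz]; linarith, by rw [hz]; linarith⟩
  -- The mean value inequality is applied after subtracting the second-order Taylor polynomial at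
  -- the midpoint. Its quadratic term takes equal values at x and y and drops out, which leaves an
  -- error of third order.
  have key := (convex_Icc x y).norm_image_sub_le_of_norm_hasDerivWithin_le
    (f := fun t => γ t - t • velocity L γ z - ((t - z) ^ 2 / 2) • a z)
    (f' := fun t => velocity L γ t - velocity L γ z - (t - z) • a z) (C := M * (y - x) ^ 2)
    (fun t ht => by
      have h1 : HasDerivWithinAt (fun t : ℝ => (t - z) ^ 2 / 2) (t - z) (Icc x y) t := by
        have := (((hasDerivWithinAt_id t (Icc x y)).sub_const z).pow 2).div_const 2
        refine this.congr_deriv ?_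
        simp
      simpa using ((((H.deriv t (hsub ht)).mono hsub).fun_sub
        ((hasDerivWithinAt_id t _).smul_const (velocity L γ z))).fun_sub (h1.smul_const (a z))))
    (fun t ht => by
      have h1 : ‖velocity L γ t - velocity L γ z - (t - z) • a z‖ ≤ M * |t - z| * |t - z| := by
        rcases le_total z t with h | h
        · exact H.norm_velocity_sub_sub_le hM (hsub hzm) (hsub ht) ⟨le_rfl, h⟩
        · have := H.norm_velocity_sub_sub_le hM (hsub ht) (hsub hzm) ⟨h, le_rfl⟩
          rw [abs_sub_comm z t, ← norm_neg] at this
          refine le_of_eq_of_le (congrArg norm ?_) this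
          module
      have h2 : |t - z| ≤ y - x :=
        abs_le.2 ⟨by linarith [ht.1, hzm.2], by linarith [ht.2, hzm.1]⟩
      calc _ ≤ _ := h1
        _ ≤ M * (y - x) * (y - x) := by gcongr
        _ = _ := by ring)
    (left_mem_Icc.2 hxy) (right_mem_Icc.2 hxy)
  rw [Real.norm_eq_abs, abs_of_nonneg (sub_nonneg.2 hxy)] at key
  have h2 : (y - z) ^ 2 = (x - z) ^ 2 := by rw [hz]; ring
  refine le_of_eq_of_le (congrArg norm ?_) key
  rw [h2]
  module

end RegularCurve

/-! ### Geodesics on the unit sphere -/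

/-- The chord of an angle a is 2 sin (a / 2), and sin x ≥ 2 x / π on [0, π / 2]; the factor 2 comes
from π ≤ 4. -/
lemma angle_le_two_mul_norm_sub {u v : E m} (hu : ‖u‖ = 1) (hv : ‖v‖ = 1) :
    InnerProductGeometry.angle u v ≤ 2 * ‖u - v‖ := by
  set a := InnerProductGeometry.angle u v with ha
  have ha0 : 0 ≤ a := InnerProductGeometry.angle_nonneg u v
  have haπ : a ≤ Real.pi := InnerProductGeometry.angle_le_pi u v
  have h1 : ‖u - v‖ ^ 2 = 2 - 2 * Real.cos a := by
    have := InnerProductGeometry.cos_angle_mul_norm_mul_norm u v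
    rw [hu, hv, ← ha] at this
    rw [norm_sub_sq_real, hu, hv, ← this]; ring
  have h2 : Real.cos a = 1 - 2 * Real.sin (a / 2) ^ 2 := by
    have := Real.cos_two_mul (a / 2)
    rw [mul_div_cancel₀ _ two_ne_zero] at this
    rw [this, Real.cos_sq']; ring
  have h3 := Real.mul_le_sin (show 0 ≤ a / 2 by positivity) (by linarith)
  have h4 : a / 4 ≤ 2 / Real.pi * (a / 2) := by
    have h5 : (1 / 2 : ℝ) ≤ 2 / Real.pi := by
      rw [div_le_div_iff₀ (by norm_num) Real.pi_pos]; linarith [Real.pi_le_four]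
    nlinarith
  have h6 : a / 4 ≤ Real.sin (a / 2) := h4.trans h3
  refine (sq_le_sq₀ ha0 (by positivity)).1 ?_
  rw [mul_pow, h1, h2]
  nlinarith

/-- Gram-Schmidt on v gives the great circle in an orthonormal frame, from which derivatives can be
read off. The hypothesis excludes antipodal points, so a vanishing sine of the angle means u = v and
a constant geodesic. -/
lemma exists_geodesic_eq {u v : E m} (hu : ‖u‖ = 1) (hv : ‖v‖ = 1) (h : ‖u - v‖ < 2) :
    ∃ w : E m, inner ℝ u w = 0 ∧ (‖w‖ = 1 ∨ InnerProductGeometry.angle u v = 0) ∧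
      ∀ s, geodesic u v s = Real.cos (s * InnerProductGeometry.angle u v) • u +
        Real.sin (s * InnerProductGeometry.angle u v) • w := by
  set a := InnerProductGeometry.angle u v with ha
  have hcos : Real.cos a = inner ℝ u v := by
    have := InnerProductGeometry.cos_angle_mul_norm_mul_norm u v
    rw [hu, hv, ← ha] at this
    linarith
  by_cases hs : Real.sin a = 0
  · have ha0 : a = 0 := by
      rcases InnerProductGeometry.sin_eq_zero_iff_angle_eq_zero_or_angle_eq_pi.1 hs with h1 | h1
      · exact h1
      · exfalso
        have h2 : ‖u - v‖ ^ 2 = 4 := by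
          rw [norm_sub_sq_real, hu, hv, ← hcos, ha, h1, Real.cos_pi]; norm_num
        nlinarith [norm_nonneg (u - v)]
    refine ⟨0, by simp, Or.inr ha0, fun s => ?_⟩
    simp only [geodesic, ← ha, hs, if_true]
    simp [ha0]
  · refine ⟨(Real.sin a)⁻¹ • (v - Real.cos a • u), ?_, Or.inl ?_, fun s => ?_⟩
    · rw [inner_smul_right, inner_sub_right, inner_smul_right, real_inner_self_eq_norm_sq, hu,
        hcos]
      ring
    · have h1 : ‖v - Real.cos a • u‖ ^ 2 = Real.sin a ^ 2 := by
        rw [norm_sub_sq_real, inner_smul_right, norm_smul, hu, hv, real_inner_comm, ← hcos,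
          Real.norm_eq_abs, mul_one, sq_abs, Real.sin_sq]
        ring
      have h2 : 0 ≤ Real.sin a := InnerProductGeometry.sin_angle_nonneg u v
      rw [norm_smul, norm_inv, Real.norm_eq_abs, abs_of_nonneg h2,
        (sq_eq_sq₀ (norm_nonneg _) h2).1 h1, inv_mul_cancel₀ hs]
    · simp only [geodesic, ← ha, hs, if_false]
      rw [show (1 - s) * a = a - s * a by ring, Real.sin_sub]
      match_scalars <;> field_simp
      ring

lemma geodesic_zero {u v : E m} (hu : ‖u‖ = 1) (hv : ‖v‖ = 1) (h : ‖u - v‖ < 2) :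
    geodesic u v 0 = u := by
  obtain ⟨w, -, -, hw⟩ := exists_geodesic_eq hu hv h
  rw [hw]; simp

lemma geodesic_one {u v : E m} (hu : ‖u‖ = 1) (hv : ‖v‖ = 1) (h : ‖u - v‖ < 2) :
    geodesic u v 1 = v := by
  by_cases hs : Real.sin (InnerProductGeometry.angle u v) = 0
  · have h0 : InnerProductGeometry.angle u v = 0 := by
      rcases InnerProductGeometry.sin_eq_zero_iff_angle_eq_zero_or_angle_eq_pi.1 hs with h1 | h1
      · exact h1
      · exfalso
        have h2 : ‖u - v‖ ^ 2 = 4 := by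
          have := InnerProductGeometry.cos_angle_mul_norm_mul_norm u v
          rw [hu, hv, h1, Real.cos_pi] at this
          rw [norm_sub_sq_real, hu, hv, ← this]; norm_num
        nlinarith [norm_nonneg (u - v)]
    have h1 : u = v := by
      have := InnerProductGeometry.cos_angle_mul_norm_mul_norm u v
      rw [hu, hv, h0, Real.cos_zero, mul_one, mul_one] at this
      exact (inner_eq_one_iff_of_norm_eq_one hu hv).1 this.symm
    simp only [geodesic, if_pos hs]
    exact h1
  · simp only [geodesic, hs, if_false]
    simp [smul_smul, inv_mul_cancel₀ hs]

lemma norm_cos_smul_add_sin_smul {u w : E m} (hu : ‖u‖ = 1) (hw : ‖w‖ = 1)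
    (huw : inner ℝ u w = 0) (x : ℝ) : ‖Real.cos x • u + Real.sin x • w‖ = 1 := by
  have h : ‖Real.cos x • u + Real.sin x • w‖ ^ 2 = 1 := by
    rw [norm_add_sq_real, inner_smul_left, inner_smul_right, huw, norm_smul, norm_smul, hu, hw]
    simp
  exact (pow_eq_one_iff_of_nonneg (norm_nonneg _) two_ne_zero).1 h

/-- A geodesic has unit norm, speed at most the angle and acceleration at most its square. -/
lemma exists_geodesic_deriv {u v : E m} (hu : ‖u‖ = 1) (hv : ‖v‖ = 1) (h : ‖u - v‖ < 2) :
    (∀ s, ‖geodesic u v s‖ = 1) ∧ ∃ g : ℝ → E m, (∀ s, HasDerivAt (geodesic u v) (g s) s) ∧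
      (∀ s, ‖g s‖ ≤ 2 * ‖u - v‖) ∧ ∀ s r, ‖g s - g r‖ ≤ (2 * ‖u - v‖) ^ 2 * |s - r| := by
  obtain ⟨w, huw, hw, hg⟩ := exists_geodesic_eq hu hv h
  have ha0 := InnerProductGeometry.angle_nonneg u v
  have ha := angle_le_two_mul_norm_sub hu hv
  set a := InnerProductGeometry.angle u v
  have hunit : ∀ s, ‖geodesic u v s‖ = 1 := fun s => by
    rw [hg]
    rcases hw with hw | hw
    · exact norm_cos_smul_add_sin_smul hu hw huw _
    · simp [hw, hu]
  refine ⟨hunit, fun s => a • (-Real.sin (s * a) • u + Real.cos (s * a) • w), fun s => ?_,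
    fun s => ?_, fun s r => ?_⟩
  · have h1 : HasDerivAt (fun s : ℝ => s * a) a s := by
      simpa using (hasDerivAt_id s).mul_const a
    rw [show geodesic u v = fun s => Real.cos (s * a) • u + Real.sin (s * a) • w from funext hg]
    refine ((h1.cos.smul_const u).fun_add (h1.sin.smul_const w)).congr_deriv ?_
    module
  · refine le_trans ?_ ha
    rw [norm_smul, Real.norm_eq_abs, abs_of_nonneg ha0]
    rcases hw with hw | hw
    · have h1 := norm_cos_smul_add_sin_smul (u := w) (w := -u) hw (by rwa [norm_neg])
        (by rw [inner_neg_right, real_inner_comm, huw, neg_zero]) (s * a)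
      rw [show -Real.sin (s * a) • u + Real.cos (s * a) • w =
        Real.cos (s * a) • w + Real.sin (s * a) • -u by module, h1, mul_one]
    · simp [hw]
  -- The acceleration is -a ^ 2 times the geodesic itself, which has norm 1.
  · have hd : ∀ x ∈ univ, HasDerivWithinAt
        (fun s : ℝ => a • (-Real.sin (s * a) • u + Real.cos (s * a) • w))
        (-a ^ 2 • geodesic u v x) univ x := fun x _ => by
      have h1 : HasDerivAt (fun s : ℝ => s * a) a x := by
        simpa using (hasDerivAt_id x).mul_const a
      refine (HasDerivAt.hasDerivWithinAt ?_)
      refine (((h1.sin.neg.smul_const u).fun_add (h1.cos.smul_const w)).const_smul a).congr_deriv ?_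
      rw [hg]
      module
    have := convex_univ.norm_image_sub_le_of_norm_hasDerivWithin_le (C := (2 * ‖u - v‖) ^ 2) hd
      (fun x _ => by
        rw [norm_smul, hunit, norm_neg, norm_pow, Real.norm_eq_abs, abs_of_nonneg ha0, mul_one]
        gcongr) (mem_univ r) (mem_univ s)
    rwa [Real.norm_eq_abs] at this

/-! ### Gluing Lipschitz functions -/

lemma norm_ite_sub_ite_le {F : Type*} [NormedAddCommGroup F] {f g : ℝ → F} {Λ c : ℝ}
    (hf : ∀ x y, ‖f x - f y‖ ≤ Λ * |x - y|) (hg : ∀ x y, ‖g x - g y‖ ≤ Λ * |x - y|)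
    (h : f c = g c) (x y : ℝ) [Decidable (c ≤ x)] [Decidable (c ≤ y)] :
    ‖(if c ≤ x then g x else f x) - (if c ≤ y then g y else f y)‖ ≤ Λ * |x - y| := by
  have key : ∀ x y, x < c → c ≤ y → ‖f x - g y‖ ≤ Λ * |x - y| := fun x y hx hy => by
    have h1 := norm_sub_le_norm_sub_add_norm_sub (f x) (f c) (g y)
    have h2 := hf x c
    have h3 := hg c y
    rw [h] at h1 h2
    rw [abs_of_neg (by linarith)] at h2 ⊢
    rw [abs_of_nonpos (by linarith)] at h3
    linarith
  split_ifs with h1 h2 h2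
  · exact hg x y
  · rw [norm_sub_rev, abs_sub_comm]; exact key y x (not_le.1 h2) h1
  · exact key x y (not_le.1 h1) h2
  · exact hf x y

section Glue

open Classical in
/-- The function that agrees with `f k` between the break points `c k` and `c (k + 1)`. -/
def glue {F : Type*} (c : ℕ → ℝ) (f : ℕ → ℝ → F) (N : ℕ) (t : ℝ) : F :=
  f (Nat.findGreatest (fun j => c j ≤ t) N) t

variable {F : Type*} {c : ℕ → ℝ} {f : ℕ → ℝ → F}

open Classical in
lemma glue_succ (N : ℕ) (t : ℝ) :
    glue c f (N + 1) t = if c (N + 1) ≤ t then f (N + 1) t else glue c f N t := by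
  unfold glue
  rw [Nat.findGreatest_succ]
  split_ifs <;> rfl

lemma glue_zero (t : ℝ) : glue c f 0 t = f 0 t := by simp [glue]

lemma glue_eq_of_le (N : ℕ) {t : ℝ} (h : c N ≤ t) : glue c f N t = f N t := by
  classical
  cases N with
  | zero => exact glue_zero t
  | succ N => rw [glue_succ, if_pos h]

/-- `Nat.findGreatest` returns 0 when no break point is at or before t, so piece 0 extends to the
left of `c 0`; hence the lower bound on t is required only for k ≠ 0. -/
lemma glue_eq_of_mem {N k : ℕ} (hk : k < N) (hc : ∀ j, k < j → j ≤ N → c (k + 1) ≤ c j) {t : ℝ}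
    (h1 : k ≠ 0 → c k ≤ t) (h2 : t < c (k + 1)) : glue c f N t = f k t := by
  classical
  have : Nat.findGreatest (fun j => c j ≤ t) N = k := by
    rw [Nat.findGreatest_eq_iff]
    exact ⟨hk.le, h1, fun j hj hjN h => absurd (h.trans_lt h2) (not_lt.2 (hc j hj hjN))⟩
  rw [glue, this]

variable [NormedAddCommGroup F]

/-- Induction over the last break point: the earlier pieces form one Lipschitz function, which meets
the new piece at `c (N + 1)`, and distances on either side of that point add up. -/
lemma norm_glue_sub_le {Λ : ℝ} (N : ℕ) (hf : ∀ k ≤ N, ∀ x y, ‖f k x - f k y‖ ≤ Λ * |x - y|)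
    (hc : ∀ k < N, c k ≤ c (k + 1)) (hmatch : ∀ k < N, f k (c (k + 1)) = f (k + 1) (c (k + 1)))
    (x y : ℝ) : ‖glue c f N x - glue c f N y‖ ≤ Λ * |x - y| := by
  classical
  induction N generalizing x y with
  | zero => simpa only [glue_zero] using hf 0 le_rfl x y
  | succ N ih =>
    rw [glue_succ, glue_succ]
    refine norm_ite_sub_ite_le (ih (fun k hk => hf k (hk.trans N.le_succ))
      (fun k hk => hc k (hk.trans N.lt_succ_self)) fun k hk => hmatch k (hk.trans N.lt_succ_self))
      (hf (N + 1) le_rfl) ?_ x y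
    rw [glue_eq_of_le N (hc N N.lt_succ_self)]
    exact hmatch N N.lt_succ_self

open Classical in
lemma hasDerivAt_glue [NormedSpace ℝ F] {f' : ℕ → ℝ → F} (N : ℕ)
    (hf : ∀ k ≤ N, ∀ x, HasDerivAt (f k) (f' k x) x) {t : ℝ} (ht : ∀ k ≤ N, t ≠ c k) :
    HasDerivAt (glue c f N) (f' (Nat.findGreatest (fun j => c j ≤ t) N) t) t := by
  induction N with
  | zero =>
    rw [show glue c f 0 = f 0 from funext glue_zero]
    simpa using hf 0 le_rfl t
  | succ N ih =>
    rw [Nat.findGreatest_succ]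
    rcases (ht (N + 1) le_rfl).lt_or_gt with h | h
    · rw [if_neg (not_le.2 h)]
      refine (ih (fun k hk => hf k (hk.trans N.le_succ))
        (fun k hk => ht k (hk.trans N.le_succ))).congr_of_eventuallyEq ?_
      filter_upwards [Iio_mem_nhds h] with x hx
      rw [glue_succ, if_neg (not_le.2 hx)]
    · rw [if_pos h.le]
      refine (hf (N + 1) le_rfl t).congr_of_eventuallyEq ?_
      filter_upwards [Ioi_mem_nhds h] with x hx
      rw [glue_succ, if_pos (le_of_lt hx)]

end Glue

/-! ### Partitions -/

namespace Partition

variable {L : ℝ} (T : Partition L)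

lemma len_pos {k : ℕ} (hk : k < T.n) : 0 < T.len k := sub_pos.2 (T.t_lt k hk)

lemma len_le_mesh {k : ℕ} (hk : k < T.n) : T.len k ≤ T.mesh :=
  Finset.le_sup' T.len (Finset.mem_range.2 hk)

lemma mesh_pos : 0 < T.mesh := (T.len_pos T.n_pos).trans_le (T.len_le_mesh T.n_pos)

lemma t_le {i j : ℕ} (hij : i ≤ j) (hj : j ≤ T.n) : T.t i ≤ T.t j := by
  induction j, hij using Nat.le_induction with
  | base => exact le_rfl
  | succ j _ ih => exact (ih (Nat.le_of_succ_le hj)).trans (T.t_lt j hj).le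

lemma t_mem {i : ℕ} (hi : i ≤ T.n) : T.t i ∈ Icc 0 L :=
  ⟨T.t_zero.symm.le.trans (T.t_le i.zero_le hi), (T.t_le hi le_rfl).trans T.t_last.le⟩

lemma sum_len (i : ℕ) : ∑ k ∈ Finset.range i, T.len k = T.t i := by
  simp only [len]
  rw [Finset.sum_range_sub, T.t_zero, sub_zero]

lemma sum_len_last : ∑ k ∈ Finset.range T.n, T.len k = L := by rw [T.sum_len, T.t_last]

lemma two_le_n (h : T.mesh < L) : 2 ≤ T.n := by
  by_contra! hn
  have h1 : T.n = 1 := by have := T.n_pos; omega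
  have h2 := T.sum_len_last
  rw [h1, Finset.sum_range_one] at h2
  linarith [T.len_le_mesh T.n_pos]

lemma mid_succ_sub (k : ℕ) : T.mid (k + 1) - T.mid k = T.dualLen k := by
  simp only [mid, dualLen, len]; ring

lemma dualLen_pos {k : ℕ} (hk : k + 1 < T.n) : 0 < T.dualLen k := by
  have := T.len_pos hk
  have := T.len_pos (k.lt_succ_self.trans hk)
  unfold dualLen; linarith

lemma dualLen_le_mesh {k : ℕ} (hk : k + 1 < T.n) : T.dualLen k ≤ T.mesh := by
  have := T.len_le_mesh hk
  have := T.len_le_mesh (k.lt_succ_self.trans hk)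
  unfold dualLen; linarith

lemma sum_dualLen (k : ℕ) : ∑ j ∈ Finset.range k, T.dualLen j = T.mid k - T.mid 0 := by
  simp only [← mid_succ_sub]
  rw [Finset.sum_range_sub]

lemma mid_le {i j : ℕ} (hij : i ≤ j) (hj : j < T.n) : T.mid i ≤ T.mid j := by
  have := T.t_le hij hj.le
  have := T.t_le (Nat.succ_le_succ hij) hj
  simp only [Nat.succ_eq_add_one] at this
  unfold mid; linarith

lemma mid_lt {i j : ℕ} (hij : i < j) (hj : j < T.n) : T.mid i < T.mid j := by
  have h1 := T.dualLen_pos (lt_of_le_of_lt (Nat.succ_le_of_lt hij) hj)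
  have h2 := T.mid_succ_sub i
  have h3 := T.mid_le (Nat.succ_le_of_lt hij) hj
  simp only [Nat.succ_eq_add_one] at h3
  linarith

lemma mid_mem_edge {k : ℕ} (hk : k < T.n) : T.mid k ∈ Icc (T.t k) (T.t (k + 1)) := by
  have := T.t_lt k hk
  unfold mid; exact ⟨by linarith, by linarith⟩

lemma edge_subset {k : ℕ} (hk : k < T.n) : Icc (T.t k) (T.t (k + 1)) ⊆ Icc 0 L :=
  Icc_subset_Icc (T.t_mem hk.le).1 (T.t_mem hk).2

lemma mid_mem {k : ℕ} (hk : k < T.n) : T.mid k ∈ Icc 0 L := T.edge_subset hk (T.mid_mem_edge hk)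

lemma mid_zero : T.mid 0 = T.len 0 / 2 := by simp [mid, len, T.t_zero]

lemma mid_last : T.mid (T.n - 1) = L - T.len (T.n - 1) / 2 := by
  have h : T.n - 1 + 1 = T.n := Nat.sub_add_cancel T.n_pos
  simp only [mid, len, h, T.t_last]; ring

lemma abs_sub_mid_le {k : ℕ} {t : ℝ} (ht : t ∈ Icc (T.t k) (T.t (k + 1))) :
    |t - T.mid k| ≤ T.len k / 2 := by
  unfold mid len
  exact abs_le.2 ⟨by linarith [ht.1], by linarith [ht.2]⟩

/-- Error of a Riemann sum. -/
lemma norm_integral_sub_sum_le {F : Type*} [NormedAddCommGroup F] [NormedSpace ℝ F]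
    [CompleteSpace F] {f : ℝ → F} {c : ℕ → F} {ε : ℝ} (hL : 0 ≤ L) (hf : ContinuousOn f (Icc 0 L))
    (h : ∀ k < T.n, ∀ t ∈ Icc (T.t k) (T.t (k + 1)), ‖f t - c k‖ ≤ ε) :
    ‖(∫ t in Icc 0 L, f t) - ∑ k ∈ Finset.range T.n, T.len k • c k‖ ≤ ε * L := by
  have hi : ∀ k < T.n, IntervalIntegrable f volume (T.t k) (T.t (k + 1)) := fun k hk =>
    (hf.mono (by rw [uIcc_of_le (T.t_lt k hk).le]; exact T.edge_subset hk)).intervalIntegrable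
  have e0 : ∫ t in (0 : ℝ)..L, f t = ∫ t in T.t 0..T.t T.n, f t := by rw [T.t_zero, T.t_last]
  rw [integral_Icc_eq_integral_Ioc, ← intervalIntegral.integral_of_le hL, e0,
    ← intervalIntegral.sum_integral_adjacent_intervals hi, ← Finset.sum_sub_distrib]
  refine (norm_sum_le_of_le _ (n := fun k => ε * T.len k) fun k hk => ?_).trans_eq ?_
  · have hk := Finset.mem_range.1 hk
    have hle := (T.t_lt k hk).le
    have e : (∫ t in T.t k..T.t (k + 1), f t) - T.len k • c k =
        ∫ t in T.t k..T.t (k + 1), (f t - c k) := by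
      rw [intervalIntegral.integral_sub (hi k hk) intervalIntegrable_const,
        intervalIntegral.integral_const, len]
    rw [e]
    refine (intervalIntegral.norm_integral_le_of_norm_le_const (C := ε) fun t ht => ?_).trans_eq ?_
    · rw [uIoc_of_le hle] at ht
      exact h k hk t (Ioc_subset_Icc_self ht)
    · rw [abs_of_nonneg (sub_nonneg.2 hle), len]
  · rw [← Finset.mul_sum, T.sum_len_last]

end Partition

/-! ### The indicatrix -/

/-- The edge vectors of `P` have unit length, and turn by at most `K` times the dual length. -/
structure TurningBound {L : ℝ} (T : Partition L) (P : Polygon m) (K : ℝ) : Prop where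
  two_le : 2 ≤ T.n
  unit : ∀ k < T.n, ‖edgeTangent P k‖ = 1
  nonneg : 0 ≤ K
  turn : ∀ k, k + 1 < T.n → ‖edgeTangent P k - edgeTangent P (k + 1)‖ ≤ K * T.dualLen k
  small : K * T.mesh < 2

namespace TurningBound

variable {L K : ℝ} {T : Partition L} {P : Polygon m}

/-- The geodesic between the midpoints of the edges `k` and `k + 1`, as a function of the curve
parameter. -/
def piece (T : Partition L) (P : Polygon m) (k : ℕ) (t : ℝ) : E m :=
  geodesic (edgeTangent P k) (edgeTangent P (k + 1)) ((t - T.mid k) / T.dualLen k)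

lemma indicatrix_eq_glue (T : Partition L) (P : Polygon m) :
    indicatrix T P = glue T.mid (piece T P) (T.n - 2) := rfl

/-- Successive edge vectors are not antipodal, so the estimates for the geodesic joining them apply.
-/
lemma norm_sub_lt (H : TurningBound T P K) {k : ℕ} (hk : k + 1 < T.n) :
    ‖edgeTangent P k - edgeTangent P (k + 1)‖ < 2 :=
  (H.turn k hk).trans_lt (lt_of_le_of_lt
    (mul_le_mul_of_nonneg_left (T.dualLen_le_mesh hk) H.nonneg) H.small)

lemma norm_piece (H : TurningBound T P K) {k : ℕ} (hk : k + 1 < T.n) (t : ℝ) :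
    ‖piece T P k t‖ = 1 :=
  (exists_geodesic_deriv (H.unit k (k.lt_succ_self.trans hk)) (H.unit _ hk)
    (H.norm_sub_lt hk)).1 _

/-- Derivative of a piece of the indicatrix. -/
lemma exists_deriv_piece (H : TurningBound T P K) {k : ℕ} (hk : k + 1 < T.n) :
    ∃ g : ℝ → E m, (∀ t, HasDerivAt (piece T P k) (g t) t) ∧ (∀ t, ‖g t‖ ≤ 2 * K) ∧
      ∀ t, (t - T.mid k) / T.dualLen k ∈ Icc (-1 : ℝ) 2 →
        ‖g t - (T.dualLen k)⁻¹ • (edgeTangent P (k + 1) - edgeTangent P k)‖ ≤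
          8 * K ^ 2 * T.dualLen k := by
  have hu := H.unit k (k.lt_succ_self.trans hk)
  have hv := H.unit _ hk
  have hlt := H.norm_sub_lt hk
  obtain ⟨-, g, hg, hg1, hg2⟩ := exists_geodesic_deriv hu hv hlt
  have hd := T.dualLen_pos hk
  set ℓ := T.dualLen k with hℓ
  have hturn := H.turn k hk
  rw [← hℓ] at hturn
  refine ⟨fun t => ℓ⁻¹ • g ((t - T.mid k) / ℓ), fun t => ?_, fun t => ?_, fun t ht => ?_⟩
  · have h1 : HasDerivAt (fun t : ℝ => (t - T.mid k) / ℓ) ℓ⁻¹ t := by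
      simpa using ((hasDerivAt_id t).sub_const (T.mid k)).div_const ℓ
    exact (hg ((t - T.mid k) / ℓ)).scomp t h1
  · rw [norm_smul, norm_inv, Real.norm_eq_abs, abs_of_pos hd, inv_mul_le_iff₀ hd]
    refine (hg1 _).trans ?_
    linarith
  -- The difference of the two edge vectors is the increment of the geodesic over [0, 1]. For s in
  -- [-1, 2] its speed there differs from that at s by at most 2 (2 K ℓ)², and dividing by ℓ gives 8
  -- K² ℓ.
  · set s := (t - T.mid k) / ℓ
    have h1 := norm_sub_sub_le_of_hasDerivWithinAt (convex_Icc (0 : ℝ) 1)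
      (f := geodesic (edgeTangent P k) (edgeTangent P (k + 1))) (a := g s)
      (M := (2 * (K * ℓ)) ^ 2 * 2) (fun r _ => (hg r).hasDerivWithinAt) (fun r hr => by
        refine (hg2 r s).trans ?_
        gcongr
        exact abs_le.2 ⟨by linarith [hr.1, ht.2], by linarith [hr.2, ht.1]⟩)
      (left_mem_Icc.2 zero_le_one) (right_mem_Icc.2 zero_le_one)
    rw [geodesic_zero hu hv hlt, geodesic_one hu hv hlt, sub_zero, one_smul, abs_one, mul_one,
      norm_sub_rev] at h1
    rw [← smul_sub, norm_smul, norm_inv, Real.norm_eq_abs, abs_of_pos hd, inv_mul_le_iff₀ hd]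
    refine h1.trans_eq ?_
    ring

lemma norm_piece_sub_le (H : TurningBound T P K) {k : ℕ} (hk : k + 1 < T.n) (x y : ℝ) :
    ‖piece T P k x - piece T P k y‖ ≤ 2 * K * |x - y| := by
  obtain ⟨g, hg, hg1, -⟩ := H.exists_deriv_piece hk
  have := convex_univ.norm_image_sub_le_of_norm_hasDerivWithin_le
    (fun t _ => (hg t).hasDerivWithinAt) (fun t _ => hg1 t) (mem_univ y) (mem_univ x)
  rwa [Real.norm_eq_abs] at this

lemma piece_mid (H : TurningBound T P K) {k : ℕ} (hk : k + 1 < T.n) :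
    piece T P k (T.mid k) = edgeTangent P k := by
  rw [piece, sub_self, zero_div,
    geodesic_zero (H.unit k (k.lt_succ_self.trans hk)) (H.unit _ hk) (H.norm_sub_lt hk)]

lemma piece_mid_succ (H : TurningBound T P K) {k : ℕ} (hk : k + 1 < T.n) :
    piece T P k (T.mid (k + 1)) = edgeTangent P (k + 1) := by
  rw [piece, T.mid_succ_sub, div_self (T.dualLen_pos hk).ne',
    geodesic_one (H.unit k (k.lt_succ_self.trans hk)) (H.unit _ hk) (H.norm_sub_lt hk)]

lemma norm_indicatrix (H : TurningBound T P K) (t : ℝ) : ‖indicatrix T P t‖ = 1 := by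
  classical
  refine H.norm_piece ?_ t
  have := Nat.findGreatest_le (P := fun j => T.mid j ≤ t) (T.n - 2)
  have := H.two_le
  omega

lemma norm_indicatrix_sub_le (H : TurningBound T P K) (x y : ℝ) :
    ‖indicatrix T P x - indicatrix T P y‖ ≤ 2 * K * |x - y| := by
  have := H.two_le
  rw [indicatrix_eq_glue]
  refine norm_glue_sub_le _ (fun k hk => H.norm_piece_sub_le (by omega))
    (fun k hk => T.mid_le k.le_succ (by omega)) (fun k hk => ?_) x y
  rw [H.piece_mid_succ (by omega), H.piece_mid (by omega)]

lemma continuous_indicatrix (H : TurningBound T P K) : Continuous (indicatrix T P) := by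
  rw [← continuousOn_univ]
  have := H.nonneg
  exact continuousOn_of_norm_sub_le (by positivity) fun x _ y _ => H.norm_indicatrix_sub_le x y

lemma indicatrix_mid (H : TurningBound T P K) {k : ℕ} (hk : k < T.n) :
    indicatrix T P (T.mid k) = edgeTangent P k := by
  have hn := H.two_le
  rw [indicatrix_eq_glue]
  rcases lt_trichotomy k (T.n - 2) with h | rfl | h
  · rw [glue_eq_of_mem h (fun j hj hjn => T.mid_le hj (by omega)) (fun _ => le_rfl)
      (T.mid_lt k.lt_succ_self (by omega)), H.piece_mid (by omega)]
  · rw [glue_eq_of_le _ le_rfl, H.piece_mid (by omega)]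
  · have hk' : k = T.n - 2 + 1 := by omega
    subst hk'
    rw [glue_eq_of_le _ (T.mid_le (Nat.le_succ _) hk), H.piece_mid_succ hk]

lemma norm_indicatrix_sub_edgeTangent_le (H : TurningBound T P K) {k : ℕ} (hk : k < T.n) {t : ℝ}
    (ht : t ∈ Icc (T.t k) (T.t (k + 1))) :
    ‖indicatrix T P t - edgeTangent P k‖ ≤ K * T.mesh := by
  rw [← H.indicatrix_mid hk]
  refine (H.norm_indicatrix_sub_le _ _).trans ?_
  have h1 := T.abs_sub_mid_le ht
  have h2 := T.len_le_mesh hk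
  have h3 := H.nonneg
  calc 2 * K * |t - T.mid k| ≤ 2 * K * (T.mesh / 2) := by gcongr; linarith
    _ = _ := by ring

/-- Away from the edge midpoints, the derivative of the indicatrix is close to a discrete
curvature. -/
lemma exists_hasDerivAt_indicatrix (H : TurningBound T P K) {t : ℝ} (ht : t ∈ Icc 0 L)
    (hmid : ∀ k < T.n, t ≠ T.mid k) :
    ∃ k v, k + 1 < T.n ∧ HasDerivAt (indicatrix T P) v t ∧ |t - T.mid k| ≤ 2 * T.mesh ∧
      ‖v - (T.dualLen k)⁻¹ • (edgeTangent P (k + 1) - edgeTangent P k)‖ ≤ 8 * K ^ 2 * T.mesh := by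
  classical
  have hn := H.two_le
  choose! g hg hg1 hg2 using fun (k : ℕ) (hk : k + 1 < T.n) => H.exists_deriv_piece hk
  have hd := hasDerivAt_glue (c := T.mid) (f' := g) (T.n - 2)
    (fun k hk => hg k (by omega)) (t := t) (fun k hk => hmid k (by omega))
  rw [← indicatrix_eq_glue] at hd
  obtain ⟨h1, h2, h3⟩ := (Nat.findGreatest_eq_iff (P := fun j => T.mid j ≤ t) (k := T.n - 2)).1 rfl
  set k := Nat.findGreatest (fun j => T.mid j ≤ t) (T.n - 2) with hk
  have hk1 : k + 1 < T.n := by omega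
  have hdp := T.dualLen_pos hk1
  have hdm := T.dualLen_le_mesh hk1
  -- Beyond the first and the last midpoint the geodesics are continued by half an edge, which is at
  -- most one dual length. This is why the normalized parameter is admitted in [-1, 2].
  have hlo : -T.dualLen k ≤ t - T.mid k := by
    by_cases h0 : k = 0
    · rw [h0, T.mid_zero, Partition.dualLen]
      have := T.len_pos (show 0 + 1 < T.n by omega)
      linarith [ht.1]
    · have := h2 h0
      linarith
  have hhi : t - T.mid k ≤ 2 * T.dualLen k := by
    by_cases h0 : k = T.n - 2
    · have h4 := T.mid_succ_sub k
      have h5 := T.mid_last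
      have h6 : T.n - 1 = k + 1 := by omega
      rw [h6] at h5
      have h7 := T.len_pos (show k < T.n by omega)
      have h8 : T.len (k + 1) / 2 ≤ T.dualLen k := by unfold Partition.dualLen; linarith
      linarith [ht.2]
    · have h4 := h3 k.lt_succ_self (show k + 1 ≤ T.n - 2 by omega)
      have h5 := T.mid_succ_sub k
      simp only [not_le] at h4
      linarith
  refine ⟨k, g k t, hk1, hd, abs_le.2 ⟨by linarith, by linarith⟩, ?_⟩
  refine (hg2 k hk1 t ⟨?_, ?_⟩).trans (by gcongr)
  · rw [le_div_iff₀ hdp]; linarith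
  · rw [div_le_iff₀ hdp]; linarith

end TurningBound

/-! ### Sobolev functions from Lipschitz derivatives -/

section

variable {L : ℝ}

lemma ae_Icc_of_forall_Ioo {q : ℝ → Prop} (h : ∀ t ∈ Ioo 0 L, q t) : ∀ᵐ t, t ∈ Icc 0 L → q t := by
  rw [← ae_restrict_iff' measurableSet_Icc, ← restrict_Ioo_eq_restrict_Icc,
    ae_restrict_iff' measurableSet_Ioo]
  exact Filter.Eventually.of_forall h

lemma ae_hasDerivAt_deriv_of_lipschitz {u : ℝ → E m} {K : ℝ} (hK : 0 ≤ K)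
    (hu : ∀ x ∈ Icc 0 L, ∀ y ∈ Icc 0 L, ‖u x - u y‖ ≤ K * |x - y|) :
    ∀ᵐ t, t ∈ Icc 0 L → HasDerivAt u (deriv u t) t ∧ ‖deriv u t‖ ≤ K := by
  have hlip : LipschitzOnWith K.toNNReal u (Icc 0 L) :=
    LipschitzOnWith.of_dist_le_mul fun x hx y hy => by
      rw [dist_eq_norm, Real.dist_eq, Real.coe_toNNReal _ hK]; exact hu x hx y hy
  have h0 := ae_Icc_of_forall_Ioo (L := L) (q := fun t => t ∈ Ioo 0 L) fun t ht => ht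
  filter_upwards [hlip.ae_differentiableWithinAt_of_mem_real, h0] with t h1 h2 ht
  have hn : Icc 0 L ∈ nhds t := Icc_mem_nhds (h2 ht).1 (h2 ht).2
  have hd : HasDerivAt u (deriv u t) t := ((h1 ht).differentiableAt hn).hasDerivAt
  refine ⟨hd, ?_⟩
  have := hd.le_of_lipschitzOn hn hlip
  rwa [Real.coe_toNNReal _ hK] at this

lemma hasWeakDeriv_deriv_of_lipschitz (hL : 0 < L) {u : ℝ → E m} {K : ℝ} (hK : 0 ≤ K)
    (hu : ∀ x ∈ Icc 0 L, ∀ y ∈ Icc 0 L, ‖u x - u y‖ ≤ K * |x - y|) :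
    HasWeakDeriv L u (deriv u) := by
  have h := ae_hasDerivAt_deriv_of_lipschitz hK hu
  have hM : ∀ᵐ t ∂volume.restrict (Icc 0 L), ‖deriv u t‖ ≤ K := by
    rw [ae_restrict_iff' measurableSet_Icc]
    filter_upwards [h] with t ht htm using (ht htm).2
  refine hasWeakDeriv_of_ae_hasDerivAt hL hK hu ?_ hM ?_
  · exact Integrable.of_bound (stronglyMeasurable_deriv u).aestronglyMeasurable K hM
  · filter_upwards [h] with t ht htm using (ht htm).1

/-- A function, its derivative, and the derivative of the latter. -/
def twoDerivs (u v : ℝ → E m) (j : ℕ) : ℝ → E m :=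
  if j = 0 then u else if j = 1 then v else deriv v

lemma areWeakDerivs_twoDerivs (hL : 0 < L) {u v : ℝ → E m} {K : ℝ} (hK : 0 ≤ K)
    (hd : ∀ t ∈ Icc 0 L, HasDerivWithinAt u (v t) (Icc 0 L) t)
    (hv : ∀ x ∈ Icc 0 L, ∀ y ∈ Icc 0 L, ‖v x - v y‖ ≤ K * |x - y|) :
    AreWeakDerivs L 2 u (twoDerivs u v) := by
  refine ⟨rfl, fun j hj => ?_⟩
  have hvc := continuousOn_of_norm_sub_le hK hv
  obtain ⟨B, hB⟩ := isCompact_Icc.exists_bound_of_continuousOn hvc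
  have hB0 : 0 ≤ B := (norm_nonneg _).trans (hB 0 ⟨le_rfl, hL.le⟩)
  interval_cases j
  · refine hasWeakDeriv_of_ae_hasDerivAt hL hB0 (fun x hx y hy => ?_) hvc.integrableOn_Icc
      ((ae_restrict_mem measurableSet_Icc).mono hB) ?_
    · have := (convex_Icc 0 L).norm_image_sub_le_of_norm_hasDerivWithin_le hd hB hy hx
      rwa [Real.norm_eq_abs] at this
    · exact ae_Icc_of_forall_Ioo fun t ht =>
        (hd t (Ioo_subset_Icc_self ht)).hasDerivAt (Icc_mem_nhds ht.1 ht.2)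
  · exact hasWeakDeriv_deriv_of_lipschitz hL hK hv

lemma memSobolev_two (hL : 0 < L) {u v : ℝ → E m} {K : ℝ} (hK : 0 ≤ K)
    (hd : ∀ t ∈ Icc 0 L, HasDerivWithinAt u (v t) (Icc 0 L) t)
    (hv : ∀ x ∈ Icc 0 L, ∀ y ∈ Icc 0 L, ‖v x - v y‖ ≤ K * |x - y|) (p : ℝ≥0∞) :
    MemSobolev L 2 p u := by
  refine ⟨_, areWeakDerivs_twoDerivs hL hK hd hv, fun j hj => ?_⟩
  have hcont : ∀ f : ℝ → E m, ContinuousOn f (Icc 0 L) →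
      MemLp f p (volume.restrict (Icc 0 L)) := fun f hf => by
    obtain ⟨B, hB⟩ := isCompact_Icc.exists_bound_of_continuousOn hf
    exact MemLp.of_bound (hf.aestronglyMeasurable measurableSet_Icc) B
      ((ae_restrict_mem measurableSet_Icc).mono hB)
  interval_cases j
  · exact hcont u fun t ht => (hd t ht).continuousWithinAt
  · exact hcont v (continuousOn_of_norm_sub_le hK hv)
  · refine MemLp.of_bound (stronglyMeasurable_deriv v).aestronglyMeasurable K ?_
    rw [ae_restrict_iff' measurableSet_Icc]
    filter_upwards [ae_hasDerivAt_deriv_of_lipschitz hK hv] with t ht htm using (ht htm).2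

lemma eLpNorm_top_le {f : ℝ → E m} {A : ℝ}
    (h : ∀ᵐ t, t ∈ Icc 0 L → ‖f t‖ ≤ A) :
    eLpNorm f ∞ (volume.restrict (Icc 0 L)) ≤ ENNReal.ofReal A := by
  rw [eLpNorm_exponent_top]
  exact eLpNormEssSup_le_of_ae_bound ((ae_restrict_iff' measurableSet_Icc).2 h)

lemma sobolevNorm_two_le (hL : 0 < L) {u v : ℝ → E m} {K A : ℝ} (hK : 0 ≤ K) (hA : 0 ≤ A)
    (hd : ∀ t ∈ Icc 0 L, HasDerivWithinAt u (v t) (Icc 0 L) t)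
    (hv : ∀ x ∈ Icc 0 L, ∀ y ∈ Icc 0 L, ‖v x - v y‖ ≤ K * |x - y|)
    (h0 : ∀ t ∈ Icc 0 L, ‖u t‖ ≤ A) (h1 : ∀ t ∈ Icc 0 L, ‖v t‖ ≤ A)
    (h2 : ∀ᵐ t, t ∈ Icc 0 L → ‖deriv v t‖ ≤ A) :
    sobolevNorm L 2 ∞ u ≤ ENNReal.ofReal (3 * A) := by
  refine (iInf₂_le _ (areWeakDerivs_twoDerivs hL hK hd hv)).trans ?_
  rw [Finset.sum_range_succ, Finset.sum_range_succ, Finset.sum_range_one,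
    show 3 * A = A + A + A by ring, ENNReal.ofReal_add (by positivity) hA,
    ENNReal.ofReal_add hA hA]
  exact add_le_add (add_le_add (eLpNorm_top_le (Filter.Eventually.of_forall h0))
    (eLpNorm_top_le (Filter.Eventually.of_forall h1))) (eLpNorm_top_le h2)

end

/-! ### Restoration of unit-speed curves -/

section Restoration

/-- The curve with initial point `q` and tangent `τ`. -/
def integralCurve (q : E m) (τ : ℝ → E m) (t : ℝ) : E m := q + ∫ r in (0 : ℝ)..t, τ r

/-- The tangent of the restored curve. -/
def restoredTangent (L : ℝ) (τ : ℝ → E m) (V₀ V V₁ : E m) (r : ℝ) : E m :=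
  normalLift (τ r) (blend (r / L) V₀ V V₁)

variable {L : ℝ} {τ : ℝ → E m} {q : E m}

lemma div_mem_unitInterval (hL : 0 < L) {t : ℝ} (ht : t ∈ Icc 0 L) : t / L ∈ Icc (0 : ℝ) 1 :=
  ⟨div_nonneg ht.1 hL.le, (div_le_one hL).2 ht.2⟩

lemma hasDerivWithinAt_integralCurve {f : ℝ → E m} (hf : ContinuousOn f (Icc 0 L)) {t : ℝ}
    (ht : t ∈ Icc 0 L) : HasDerivWithinAt (integralCurve q f) (f t) (Icc 0 L) t :=
  (hasDerivWithinAt_primitive hf ht).const_add q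

lemma velocity_integralCurve (hL : 0 < L) {f : ℝ → E m} (hf : ContinuousOn f (Icc 0 L)) {t : ℝ}
    (ht : t ∈ Icc 0 L) : velocity L (integralCurve q f) t = f t :=
  velocity_eq hL ht (hasDerivWithinAt_integralCurve hf ht)

lemma tangent_integralCurve (hL : 0 < L) {f : ℝ → E m} (hf : ContinuousOn f (Icc 0 L)) {t : ℝ}
    (ht : t ∈ Icc 0 L) (h1 : ‖f t‖ = 1) : tangent L (integralCurve q f) t = f t := by
  rw [tangent, velocity_integralCurve hL hf ht, h1, inv_one, one_smul]

lemma arcParam_integralCurve (hL : 0 < L) {f : ℝ → E m} (hf : ContinuousOn f (Icc 0 L))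
    (h1 : ∀ t ∈ Icc 0 L, ‖f t‖ = 1) {t : ℝ} (ht : t ∈ Icc 0 L) :
    arcParam L (integralCurve q f) t = t / L := by
  have e : ∀ x ∈ Icc 0 L, ∫ s in (0 : ℝ)..x, ‖velocity L (integralCurve q f) s‖ = x := by
    intro x hx
    have : ∫ s in (0 : ℝ)..x, ‖velocity L (integralCurve q f) s‖ = ∫ _ in (0 : ℝ)..x, (1 : ℝ) := by
      refine intervalIntegral.integral_congr fun s hs => ?_
      rw [uIcc_of_le hx.1] at hs
      have hs' : s ∈ Icc 0 L := ⟨hs.1, hs.2.trans hx.2⟩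
      simp only [velocity_integralCurve hL hf hs', h1 s hs']
    rw [this]; simp
  rw [arcParam, e t ht, e L ⟨hL.le, le_rfl⟩]

lemma fieldAlong_integralCurve (hL : 0 < L) {f : ℝ → E m} (hf : ContinuousOn f (Icc 0 L))
    (h1 : ∀ t ∈ Icc 0 L, ‖f t‖ = 1) (U₀ V₀ V V₁ : E m) (lam : ℝ → ℝ) {t : ℝ} (ht : t ∈ Icc 0 L) :
    fieldAlong L (integralCurve q f) U₀ V₀ V V₁ lam t =
      integralCurve U₀ (fun r => lam r • f r + projPerp (f r) (blend (r / L) V₀ V V₁)) t := by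
  rw [fieldAlong, integralCurve]
  congr 1
  refine intervalIntegral.integral_congr fun s hs => ?_
  rw [uIcc_of_le ht.1] at hs
  have hs' : s ∈ Icc 0 L := ⟨hs.1, hs.2.trans ht.2⟩
  simp only [velocity_integralCurve hL hf hs', h1 s hs', tangent_integralCurve hL hf hs' (h1 s hs'),
    arcParam_integralCurve hL hf h1 hs', one_smul]

lemma continuousOn_projPerp_blend {f : ℝ → E m} (hf : ContinuousOn f (Icc 0 L))
    (V₀ V V₁ : E m) :
    ContinuousOn (fun r => projPerp (f r) (blend (r / L) V₀ V V₁)) (Icc 0 L) := by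
  unfold projPerp blend; fun_prop

lemma continuousOn_restoredTangent {f : ℝ → E m} (hf : ContinuousOn f (Icc 0 L))
    (V₀ V V₁ : E m) : ContinuousOn (restoredTangent L f V₀ V V₁) (Icc 0 L) := by
  have h := continuousOn_projPerp_blend hf V₀ V V₁
  unfold restoredTangent normalLift; fun_prop

lemma integralCurve_congr {f g : ℝ → E m} (h : ∀ t ∈ Icc 0 L, f t = g t) {t : ℝ}
    (ht : t ∈ Icc 0 L) : integralCurve q f t = integralCurve q g t := by
  rw [integralCurve, integralCurve]
  congr 1
  refine intervalIntegral.integral_congr fun s hs => ?_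
  rw [uIcc_of_le ht.1] at hs
  exact h s ⟨hs.1, hs.2.trans ht.2⟩

/-- The Lipschitz constant of the correction is proportional to R. With blending vectors of size
O(h), restoring therefore changes second derivatives by O(h) only. -/
lemma restoredTangent_sub_sub_le (hL : 0 < L) {V₀ V V₁ : E m} {R : ℝ}
    (hV : ‖V₀‖ + ‖V‖ + ‖V₁‖ ≤ R) (hR : R ≤ 1 / 2) (h1 : ∀ t ∈ Icc 0 L, ‖τ t‖ = 1)
    {x y : ℝ} (hx : x ∈ Icc 0 L) (hy : y ∈ Icc 0 L) :
    ‖(restoredTangent L τ V₀ V V₁ x - τ x) - (restoredTangent L τ V₀ V V₁ y - τ y)‖ ≤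
      4 * R / L * |x - y| + 5 * R * ‖τ x - τ y‖ := by
  have hx' := div_mem_unitInterval hL hx
  have hy' := div_mem_unitInterval hL hy
  have hbx := (norm_blend_le hx' V₀ V V₁).trans hV
  have hby := (norm_blend_le hy' V₀ V V₁).trans hV
  have hR0 : 0 ≤ R := (norm_nonneg _).trans hbx
  refine (norm_normalLift_sub_self_sub_le (h1 x hx) (h1 y hy) (hbx.trans hR)
    (hby.trans hR)).trans (add_le_add ?_ (by gcongr))
  have h2 := norm_blend_sub_blend_le hx' hy' V₀ V V₁
  rw [← sub_div, abs_div, abs_of_pos hL] at h2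
  calc _ ≤ 2 * (2 * (‖V₀‖ + ‖V‖ + ‖V₁‖) * (|x - y| / L)) := by gcongr
    _ ≤ 2 * (2 * R * (|x - y| / L)) := by gcongr
    _ = _ := by ring

lemma norm_restoredTangent_sub_self_le (hL : 0 < L) {V₀ V V₁ : E m} {R : ℝ}
    (hV : ‖V₀‖ + ‖V‖ + ‖V₁‖ ≤ R) (hR : R ≤ 1 / 2) (h1 : ∀ t ∈ Icc 0 L, ‖τ t‖ = 1)
    {x : ℝ} (hx : x ∈ Icc 0 L) : ‖restoredTangent L τ V₀ V V₁ x - τ x‖ ≤ 2 * R := by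
  have hbx := (norm_blend_le (div_mem_unitInterval hL hx) V₀ V V₁).trans hV
  exact (norm_normalLift_sub_self_le (h1 x hx) (hbx.trans hR)).trans (by gcongr)

/-- The integral curve of the restored tangent is a restoration. -/
lemma isRestoration_integralCurve {d : ClampedData m} {p : ℝ≥0∞} {ρ R Λ : ℝ} {V₀ V V₁ : E m}
    (hτ : ContinuousOn τ (Icc 0 d.L)) (h1 : ∀ t ∈ Icc 0 d.L, ‖τ t‖ = 1) (hΛ : 0 ≤ Λ)
    (hlip : ∀ x ∈ Icc 0 d.L, ∀ y ∈ Icc 0 d.L, ‖τ x - τ y‖ ≤ Λ * |x - y|)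
    (h₀ : V₀ = projPerp (τ 0) d.N0) (h₁ : V₁ = projPerp (τ d.L) d.N1)
    (hN₀ : ‖τ 0 - d.N0‖ ≤ 1) (hN₁ : ‖τ d.L - d.N1‖ ≤ 1) (hV : ‖V₀‖ + ‖V‖ + ‖V₁‖ ≤ R)
    (hR : R ≤ 1 / 2) (hRρ : 2 * R ≤ ρ) (hRρL : 2 * R * d.L ≤ ρ)
    (hend : ∫ t in (0 : ℝ)..d.L, restoredTangent d.L τ V₀ V V₁ t = d.q1 - d.q0) :
    IsRestoration d p ρ (integralCurve d.q0 τ)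
      (integralCurve d.q0 (restoredTangent d.L τ V₀ V V₁)) := by
  have hL := d.L_pos
  have hR0 : 0 ≤ R := le_trans (by positivity) hV
  have m0 : (0 : ℝ) ∈ Icc 0 d.L := ⟨le_rfl, hL.le⟩
  have mL : d.L ∈ Icc 0 d.L := ⟨hL.le, le_rfl⟩
  set f := restoredTangent d.L τ V₀ V V₁ with hf
  have hfc : ContinuousOn f (Icc 0 d.L) := continuousOn_restoredTangent hτ V₀ V V₁
  have hd : ∀ t ∈ Icc 0 d.L, HasDerivWithinAt (integralCurve d.q0 f) (f t) (Icc 0 d.L) t :=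
    fun t ht => hasDerivWithinAt_integralCurve hfc ht
  have hf1 : ∀ t ∈ Icc 0 d.L, ‖f t‖ = 1 := fun t ht => norm_normalLift (h1 t ht)
    (((norm_blend_le (div_mem_unitInterval hL ht) V₀ V V₁).trans hV).trans
      (hR.trans (by norm_num)))
  have hvel : ∀ t ∈ Icc 0 d.L, velocity d.L (integralCurve d.q0 f) t = f t :=
    fun t ht => velocity_integralCurve hL hfc ht
  have hstrain : ∀ t ∈ Icc 0 d.L, strain d.L (integralCurve d.q0 f) t = 0 := fun t ht => by
    rw [strain, hvel t ht, hf1 t ht, Real.log_one]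
  have hdiff : ∀ t ∈ Icc 0 d.L, ‖f t - τ t‖ ≤ 2 * R := fun t ht =>
    norm_restoredTangent_sub_self_le hL hV hR h1 ht
  -- The tangential rate witnessing the slice condition is √(1 - |pr b|²) - 1, the coefficient of τ
  -- in `normalLift τ b - τ`.
  refine ⟨⟨⟨fun t ht => (hd t ht).continuousWithinAt, ?_, 0, fun t ht => ⟨?_, ?_⟩⟩, ?_, ?_, ?_, ?_,
    hstrain⟩, ⟨0, V₀, V, V₁, fun r => √(1 - ‖projPerp (τ r) (blend (r / d.L) V₀ V V₁)‖ ^ 2) - 1,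
      ?_, ?_, ?_, fun t ht => ?_⟩, fun t ht => ⟨?_, ?_⟩⟩
  · refine memSobolev_two hL (K := 4 * R / d.L + 5 * R * Λ + Λ) (by positivity) hd
      (fun x hx y hy => ?_) p
    have h2 := restoredTangent_sub_sub_le hL hV hR h1 hx hy
    have h3 := hlip x hx y hy
    have h4 := norm_add_le ((f x - τ x) - (f y - τ y)) (τ x - τ y)
    rw [show (f x - τ x) - (f y - τ y) + (τ x - τ y) = f x - f y by abel] at h4
    have h5 : 5 * R * ‖τ x - τ y‖ ≤ 5 * R * (Λ * |x - y|) := by gcongr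
    linarith
  · rw [hvel t ht]
    intro h0
    have := hf1 t ht
    rw [h0, norm_zero] at this
    exact zero_ne_one this
  · rw [hstrain t ht, abs_zero]
  · simp [integralCurve]
  · rw [integralCurve, hend]; abel
  · rw [tangent_integralCurve hL hfc m0 (hf1 0 m0), hf, restoredTangent, zero_div,
      blend_zero_left, h₀, normalLift_projPerp_eq (h1 0 m0) d.norm_N0 hN₀]
  · rw [tangent_integralCurve hL hfc mL (hf1 _ mL), hf, restoredTangent, div_self hL.ne',
      blend_one_left, h₁, normalLift_projPerp_eq (h1 _ mL) d.norm_N1 hN₁]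
  · rw [tangent_integralCurve hL hτ m0 (h1 0 m0), h₀, inner_projPerp (h1 0 m0)]
  · rw [tangent_integralCurve hL hτ mL (h1 _ mL), h₁, inner_projPerp (h1 _ mL)]
  · have h := continuousOn_projPerp_blend hτ V₀ V V₁
    fun_prop
  · have hsub : Icc 0 t ⊆ Icc 0 d.L := Icc_subset_Icc_right ht.2
    have hi : ∀ g : ℝ → E m, ContinuousOn g (Icc 0 d.L) → IntervalIntegrable g volume 0 t :=
      fun g hg => (hg.mono (by rw [uIcc_of_le ht.1]; exact hsub)).intervalIntegrable
    rw [fieldAlong_integralCurve hL hτ h1 _ _ _ _ _ ht]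
    simp only [integralCurve]
    rw [add_sub_add_left_eq_sub, ← intervalIntegral.integral_sub (hi f hfc) (hi τ hτ), zero_add]
    refine intervalIntegral.integral_congr fun s _ => ?_
    simp only [hf, restoredTangent, normalLift, sub_smul, one_smul]
    abel
  · have h2 := (convex_Icc 0 d.L).norm_image_sub_le_of_norm_hasDerivWithin_le
      (f := fun t => integralCurve d.q0 f t - integralCurve d.q0 τ t)
      (fun t ht => (hd t ht).fun_sub (hasDerivWithinAt_integralCurve hτ ht)) hdiff m0 ht
    simp only [integralCurve, intervalIntegral.integral_same, sub_self, sub_zero,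
      Real.norm_eq_abs, abs_of_nonneg ht.1] at h2
    refine h2.trans (le_trans ?_ hRρL)
    gcongr
    exact ht.2
  · rw [hvel t ht, velocity_integralCurve hL hτ ht]
    exact (hdiff t ht).trans hRρ

/-- Every restoration is the integral curve of a restored tangent. -/
lemma IsRestoration.exists_blending {d : ClampedData m} {p : ℝ≥0∞} {ρ : ℝ} {δ : ℝ → E m}
    (hτ : ContinuousOn τ (Icc 0 d.L)) (h1 : ∀ t ∈ Icc 0 d.L, ‖τ t‖ = 1) (hρ : ρ ≤ 1)
    (h : IsRestoration d p ρ (integralCurve d.q0 τ) δ) :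
    ‖projPerp (τ 0) d.N0‖ ≤ ρ ∧ ‖projPerp (τ d.L) d.N1‖ ≤ ρ ∧ ∃ V : E m,
      (∀ t ∈ Icc 0 d.L, ‖projPerp (τ t) (blend (t / d.L) (projPerp (τ 0) d.N0) V
        (projPerp (τ d.L) d.N1))‖ ≤ ρ) ∧
      (∀ t ∈ Icc 0 d.L, δ t = integralCurve d.q0 (restoredTangent d.L τ (projPerp (τ 0) d.N0) V
        (projPerp (τ d.L) d.N1)) t) ∧
      ∫ t in (0 : ℝ)..d.L, restoredTangent d.L τ (projPerp (τ 0) d.N0) V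
        (projPerp (τ d.L) d.N1) t = d.q1 - d.q0 := by
  have hL := d.L_pos
  have m0 : (0 : ℝ) ∈ Icc 0 d.L := ⟨le_rfl, hL.le⟩
  have mL : d.L ∈ Icc 0 d.L := ⟨hL.le, le_rfl⟩
  obtain ⟨hfeas, ⟨U₀, V₀, V, V₁, lam, hV₀, hV₁, hlam, hfield⟩, hclose⟩ := h
  rw [tangent_integralCurve hL hτ m0 (h1 0 m0)] at hV₀
  rw [tangent_integralCurve hL hτ mL (h1 _ mL)] at hV₁
  set g : ℝ → E m := fun r => lam r • τ r + projPerp (τ r) (blend (r / d.L) V₀ V V₁) with hg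
  have hpc := continuousOn_projPerp_blend hτ V₀ V V₁
  have hgc : ContinuousOn g (Icc 0 d.L) := by fun_prop
  have hδ : ∀ t ∈ Icc 0 d.L, δ t = integralCurve d.q0 τ t + integralCurve U₀ g t := fun t ht => by
    have := hfield t ht
    simp only [fieldAlong_integralCurve hL hτ h1 _ _ _ _ _ ht] at this
    rw [← this]; abel
  have hδd : ∀ t ∈ Icc 0 d.L, HasDerivWithinAt δ (τ t + g t) (Icc 0 d.L) t := fun t ht =>
    ((hasDerivWithinAt_integralCurve hτ ht).fun_add
      (hasDerivWithinAt_integralCurve hgc ht)).congr hδ (hδ t ht)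
  have hvel : ∀ t ∈ Icc 0 d.L, velocity d.L δ t = τ t + g t := fun t ht =>
    velocity_eq hL ht (hδd t ht)
  have hgρ : ∀ t ∈ Icc 0 d.L, ‖g t‖ ≤ ρ := fun t ht => by
    have := (hclose t ht).2
    rwa [hvel t ht, velocity_integralCurve hL hτ ht, add_sub_cancel_left] at this
  have hρ0 : 0 ≤ ρ := (norm_nonneg _).trans (hgρ 0 m0)
  -- The tangential and normal parts of the rate are orthogonal, so each inherits the C^1 bound ρ.
  have hsq : ∀ t ∈ Icc 0 d.L, |lam t| ≤ ρ ∧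
      ‖projPerp (τ t) (blend (t / d.L) V₀ V V₁)‖ ≤ ρ := fun t ht => by
    have h2 := norm_smul_add_projPerp_sq (h1 t ht) (lam t) (blend (t / d.L) V₀ V V₁)
    have h3 : ‖g t‖ ^ 2 ≤ ρ ^ 2 := by gcongr; exact hgρ t ht
    simp only [hg] at h3
    rw [h2] at h3
    exact ⟨abs_le_of_sq_le_sq (by nlinarith [sq_nonneg ‖projPerp (τ t) (blend (t / d.L) V₀ V V₁)‖])
      hρ0, (sq_le_sq₀ (norm_nonneg _) hρ0).1 (by nlinarith [sq_nonneg (lam t)])⟩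
  -- Because |λ| ≤ ρ ≤ 1, the coefficient 1 + λ is nonnegative, and unit length identifies it with
  -- the square root.
  have hlift : ∀ t ∈ Icc 0 d.L, τ t + g t = restoredTangent d.L τ V₀ V V₁ t := fun t ht => by
    have e : τ t + g t = (1 + lam t) • τ t + projPerp (τ t) (blend (t / d.L) V₀ V V₁) := by
      simp only [hg, add_smul, one_smul, add_assoc]
    have h2 := norm_velocity_eq_one_of_feasible hfeas ht
    rw [hvel t ht, e] at h2
    have h3 := (abs_le.1 (hsq t ht).1).1
    rw [e, restoredTangent, normalLift,
      ← eq_sqrt_of_norm_smul_add_projPerp (h1 t ht) (by linarith) h2]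
  have htan : ∀ t ∈ Icc 0 d.L, tangent d.L δ t = restoredTangent d.L τ V₀ V V₁ t := fun t ht => by
    rw [tangent, norm_velocity_eq_one_of_feasible hfeas ht, inv_one, one_smul, hvel t ht,
      hlift t ht]
  obtain ⟨-, hq0, hq1, hN0, hN1, -⟩ := hfeas
  have e₀ : V₀ = projPerp (τ 0) d.N0 := by
    refine projPerp_eq_of_normalLift_eq (h1 0 m0) hV₀ ?_
    rw [← hN0, htan 0 m0, restoredTangent, zero_div, blend_zero_left]
  have e₁ : V₁ = projPerp (τ d.L) d.N1 := by
    refine projPerp_eq_of_normalLift_eq (h1 _ mL) hV₁ ?_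
    rw [← hN1, htan _ mL, restoredTangent, div_self hL.ne', blend_one_left]
  have hU : U₀ = 0 := by
    have := hδ 0 m0
    rw [hq0] at this
    simpa [integralCurve] using this
  have hcurve : ∀ t ∈ Icc 0 d.L,
      δ t = integralCurve d.q0 (restoredTangent d.L τ V₀ V V₁) t := fun t ht => by
    have hsub : Icc 0 t ⊆ Icc 0 d.L := Icc_subset_Icc_right ht.2
    have hi : ∀ g : ℝ → E m, ContinuousOn g (Icc 0 d.L) → IntervalIntegrable g volume 0 t :=
      fun g hg => (hg.mono (by rw [uIcc_of_le ht.1]; exact hsub)).intervalIntegrable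
    rw [hδ t ht, ← integralCurve_congr hlift ht, hU]
    simp only [integralCurve]
    rw [intervalIntegral.integral_add (hi τ hτ) (hi g hgc), zero_add, add_assoc]
  have b₀ := (hsq 0 m0).2
  have b₁ := (hsq _ mL).2
  rw [zero_div, blend_zero_left, projPerp_eq_self hV₀] at b₀
  rw [div_self hL.ne', blend_one_left, projPerp_eq_self hV₁] at b₁
  rw [← e₀, ← e₁]
  refine ⟨b₀, b₁, V, fun t ht => (hsq t ht).2, hcurve, ?_⟩
  have := hcurve _ mL
  rw [hq1, integralCurve] at this
  rw [this]; abel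

end Restoration

/-! ### Feasible polygons -/

section Feasible

variable {d : ClampedData m} {T : Partition d.L} {P : Polygon m}

lemma edgeLen_eq_len (h : P ∈ discreteFeasible d T) {k : ℕ} (hk : k < T.n) :
    edgeLen P k = T.len k := by
  obtain ⟨hne, -, -, -, -, hs⟩ := h
  have h1 : 0 < edgeLen P k := norm_pos_iff.2 (sub_ne_zero.2 (hne k hk))
  have h2 := T.len_pos hk
  have h3 := Real.eq_one_of_pos_of_log_eq_zero (div_pos h1 h2) (hs k hk)
  rwa [div_eq_one_iff_eq h2.ne'] at h3

lemma norm_edgeTangent {P : Polygon m} {k : ℕ} (h : P (k + 1) ≠ P k) : ‖edgeTangent P k‖ = 1 :=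
  norm_smul_inv_norm (sub_ne_zero.2 h)

lemma edgeLen_smul_edgeTangent (P : Polygon m) (k : ℕ) :
    edgeLen P k • edgeTangent P k = P (k + 1) - P k := by
  rcases eq_or_ne (P (k + 1)) (P k) with h | h
  · simp [edgeLen, h]
  · rw [edgeTangent, smul_smul, mul_inv_cancel₀, one_smul]
    exact (norm_pos_iff.2 (sub_ne_zero.2 h)).ne'

lemma sum_len_smul_edgeTangent (h : P ∈ discreteFeasible d T) {i : ℕ} (hi : i ≤ T.n) :
    ∑ k ∈ Finset.range i, T.len k • edgeTangent P k = P i - P 0 := by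
  rw [← Finset.sum_range_sub]
  refine Finset.sum_congr rfl fun k hk => ?_
  rw [← edgeLen_smul_edgeTangent, edgeLen_eq_len h ((Finset.mem_range.1 hk).trans_le hi)]

lemma dualEdgeLen_eq_dualLen (h : P ∈ discreteFeasible d T) {j : ℕ} (hj : j + 1 < T.n) :
    dualEdgeLen P j = T.dualLen j := by
  rw [dualEdgeLen, Partition.dualLen, edgeLen_eq_len h hj,
    edgeLen_eq_len h (j.lt_succ_self.trans hj)]

lemma discreteCurvature_eq (h : P ∈ discreteFeasible d T) {j : ℕ} (hj : j + 1 < T.n) :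
    discreteCurvature P j =
      (T.dualLen j)⁻¹ • (edgeTangent P (j + 1) - edgeTangent P j) := by
  rw [discreteCurvature, dualEdgeLen_eq_dualLen h hj]

lemma turningBound_of_discretePriors {K : ℝ} (hK : 0 ≤ K) (h : P ∈ discretePriors d T K)
    (hmesh : T.mesh < d.L) (hsmall : K * T.mesh < 2) : TurningBound T P K := by
  obtain ⟨hf, h2, -⟩ := h
  refine ⟨T.two_le_n hmesh, fun k hk => norm_edgeTangent (hf.1 k hk), hK, fun k hk => ?_, hsmall⟩
  have h3 : ‖discreteCurvature P k‖₊ ≤ discreteSecondSup T P :=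
    Finset.le_sup (f := fun j => ‖discreteCurvature P j‖₊) (Finset.mem_range.2 (by omega))
  have h4 : ‖discreteCurvature P k‖ ≤ K := le_trans (by exact_mod_cast h3) h2
  have h5 := T.dualLen_pos hk
  rw [discreteCurvature_eq hf hk, norm_smul, norm_inv, Real.norm_eq_abs, abs_of_pos h5,
    inv_mul_le_iff₀ h5] at h4
  rw [norm_sub_rev, mul_comm]
  exact h4

end Feasible

/-! ### The reconstruction operator -/

lemma integral_restoredTangent {L : ℝ} (hL : 0 ≤ L) (τ : ℝ → E m) (V₀ V V₁ : E m) :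
    ∫ t in (0 : ℝ)..L, restoredTangent L τ V₀ V V₁ t =
      ∫ t in Icc 0 L, normalLift (τ t) (blend (t / L) V₀ V V₁) := by
  rw [intervalIntegral.integral_of_le hL, integral_Icc_eq_integral_Ioc]; rfl

lemma exists_mesh_bound {C L η : ℝ} (hC : 0 ≤ C) (hL : 0 < L) (hη : 0 < η) :
    ∃ h : ℝ, 0 < h ∧ h < L ∧ C * h ≤ η := by
  refine ⟨min (L / 2) (η / (C + 1)), lt_min (by positivity) (by positivity),
    (min_le_left _ _).trans_lt (by linarith), ?_⟩
  calc C * min (L / 2) (η / (C + 1)) ≤ (C + 1) * (η / (C + 1)) := by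
        gcongr
        · linarith
        · exact min_le_right _ _
    _ = η := by field_simp

/-- Existence, uniqueness and form of the restoration that defines the reconstruction operator. -/
theorem exists_reconstruction_bounds (d : ClampedData m) (hd : ‖d.q1 - d.q0‖ < d.L) (p : ℝ≥0∞)
    {K : ℝ} (hK : 0 ≤ K) :
    ∃ ρ₀ : ℝ, 0 < ρ₀ ∧ ∃ C : ℝ, 0 ≤ C ∧ ∀ ρ : ℝ, 0 < ρ → ρ ≤ ρ₀ → ∃ h₀ : ℝ, 0 < h₀ ∧
      ∀ T : Partition d.L, T.mesh ≤ h₀ → ∀ P ∈ discretePriors d T K,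
        TurningBound T P K ∧
        (∃ δ, IsRestoration d p ρ (approxReconstruct d T P) δ) ∧
        (∀ δ δ' : ℝ → E m, IsRestoration d p ρ (approxReconstruct d T P) δ →
          IsRestoration d p ρ (approxReconstruct d T P) δ' → ∀ t ∈ Icc 0 d.L, δ t = δ' t) ∧
        ∃ V₀ V V₁ : E m, ‖V₀‖ + ‖V‖ + ‖V₁‖ ≤ C * T.mesh ∧ ‖V₀‖ + ‖V‖ + ‖V₁‖ ≤ 1 / 2 ∧
          ∀ δ, IsRestoration d p ρ (approxReconstruct d T P) δ →
            ∀ t ∈ Icc 0 d.L,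
              δ t = integralCurve d.q0 (restoredTangent d.L (indicatrix T P) V₀ V V₁) t := by
  have hL := d.L_pos
  -- Half of the gap; the other half absorbs the deviation of the integral of the indicatrix from q₁
  -- - q₀.
  set g := (d.L - ‖d.q1 - d.q0‖) / 2 with hg
  have hg0 : 0 < g := by rw [hg]; linarith
  -- The indicatrix is 2 K-Lipschitz; the additional 1 keeps the constant positive when K = 0.
  set c := coercivityConst d.L g (2 * K + 1) with hc
  have hc0 : 0 < c := coercivityConst_pos hL hg0 (by positivity)
  set R₀ := min (1 / 2) (c / (4 * d.L)) with hR₀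
  have hR₀pos : 0 < R₀ := lt_min (by norm_num) (by positivity)
  have hR₀half : R₀ ≤ 1 / 2 := min_le_left _ _
  have hR₀c : 4 * R₀ * d.L ≤ c := by
    have : R₀ ≤ c / (4 * d.L) := min_le_right _ _
    rw [le_div_iff₀ (by positivity)] at this
    linarith
  -- A restoration within ρ has blending vectors of total size at most B ρ, by `norm_blending_le`.
  -- With B ρ ≤ R₀ it lies where the end-point map is strongly monotone.
  set B := 2 + 3 * d.L / c with hB
  have hB0 : 0 < B := by positivity
  set A := 4 * (4 * d.L + 1) / c with hA
  have hA0 : 0 ≤ A := by positivity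
  set C := (2 + A) * (K * (1 + d.L)) with hC
  have hC0 : 0 ≤ C := by positivity
  refine ⟨min 1 (R₀ / B), lt_min one_pos (by positivity), C, hC0, fun ρ hρ hρ₀ => ?_⟩
  have hρ1 : ρ ≤ 1 := hρ₀.trans (min_le_left _ _)
  have hρB : ρ * B ≤ R₀ := by
    have : ρ ≤ R₀ / B := hρ₀.trans (min_le_right _ _)
    rwa [le_div_iff₀ hB0] at this
  -- The size of the blending vectors must respect the gap g, the distance 1 at which end tangents
  -- can be lifted, the monotonicity radius R₀, and the closeness ρ for velocities and, after
  -- integration over [0, L], for positions.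
  obtain ⟨h₀, hh₀, hh₀L, hCh₀⟩ := exists_mesh_bound (L := d.L)
    (η := min (min g 1) (min R₀ (min (ρ / 2) (ρ / (2 * d.L))))) hC0 hL
    (lt_min (lt_min hg0 one_pos) (lt_min hR₀pos (lt_min (by positivity) (by positivity))))
  refine ⟨h₀, hh₀, fun T hT P hP => ?_⟩
  have hmesh := T.mesh_pos
  -- This dominates the violation of all constraints: K h for the end tangents and K h L for the end
  -- point.
  set ε := K * (1 + d.L) * T.mesh with hε
  have hε0 : 0 ≤ ε := by positivity
  have hCε : C * T.mesh = (2 + A) * ε := by rw [hC, hε]; ring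
  have hCη : (2 + A) * ε ≤ min (min g 1) (min R₀ (min (ρ / 2) (ρ / (2 * d.L)))) := by
    rw [← hCε]
    exact (mul_le_mul_of_nonneg_left hT hC0).trans hCh₀
  obtain ⟨⟨hηg, hη1⟩, hηR, hηρ, hηρL⟩ : ((2 + A) * ε ≤ g ∧ (2 + A) * ε ≤ 1) ∧
      (2 + A) * ε ≤ R₀ ∧ (2 + A) * ε ≤ ρ / 2 ∧ (2 + A) * ε ≤ ρ / (2 * d.L) := by
    simpa only [le_min_iff] using hCη
  have hεle : ε ≤ (2 + A) * ε := by nlinarith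
  have hKε : K * T.mesh ≤ ε := by
    rw [hε]
    have : 0 ≤ K * T.mesh * d.L := by positivity
    linarith
  have hTB := turningBound_of_discretePriors hK hP (hT.trans_lt hh₀L) (by linarith)
  obtain ⟨hfeas, -, -⟩ := hP
  obtain ⟨-, hP0, hPn, hN0, hN1, -⟩ := id hfeas
  set τ := indicatrix T P with hτ
  have hτc : ContinuousOn τ (Icc 0 d.L) := hTB.continuous_indicatrix.continuousOn
  have hτ1 : ∀ t ∈ Icc 0 d.L, ‖τ t‖ = 1 := fun t _ => hTB.norm_indicatrix t
  have m0 : (0 : ℝ) ∈ Icc (T.t 0) (T.t (0 + 1)) := by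
    rw [← T.t_zero]; exact ⟨le_rfl, (T.t_lt 0 T.n_pos).le⟩
  have hn1 : T.n - 1 + 1 = T.n := Nat.sub_add_cancel T.n_pos
  have hn1' : T.n - 1 < T.n := Nat.sub_lt T.n_pos one_pos
  have mL : d.L ∈ Icc (T.t (T.n - 1)) (T.t (T.n - 1 + 1)) := by
    rw [hn1, T.t_last]
    have := T.t_lt _ hn1'
    rw [hn1, T.t_last] at this
    exact ⟨this.le, le_rfl⟩
  have hτ0 : ‖τ 0 - d.N0‖ ≤ ε := by
    rw [← hN0]; exact (hTB.norm_indicatrix_sub_edgeTangent_le T.n_pos m0).trans hKε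
  have hτL : ‖τ d.L - d.N1‖ ≤ ε := by
    rw [← hN1]; exact (hTB.norm_indicatrix_sub_edgeTangent_le hn1' mL).trans hKε
  have hV₀ : ‖projPerp (τ 0) d.N0‖ ≤ ε :=
    (norm_projPerp_le_norm_sub (hTB.norm_indicatrix 0)).trans hτ0
  have hV₁ : ‖projPerp (τ d.L) d.N1‖ ≤ ε :=
    (norm_projPerp_le_norm_sub (hTB.norm_indicatrix _)).trans hτL
  have hint : ‖(∫ t in Icc 0 d.L, τ t) - (d.q1 - d.q0)‖ ≤ ε := by
    have h1 := T.norm_integral_sub_sum_le hL.le hτc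
      (fun k hk t ht => hTB.norm_indicatrix_sub_edgeTangent_le hk ht)
    rw [sum_len_smul_edgeTangent hfeas le_rfl, hPn, hP0] at h1
    refine h1.trans ?_
    rw [hε]
    have : 0 ≤ K * T.mesh := by positivity
    linarith
  have hint' : ‖∫ t in Icc 0 d.L, τ t‖ ≤ d.L - g := by
    have h1 := norm_sub_norm_le (∫ t in Icc 0 d.L, τ t) (d.q1 - d.q0)
    have h2 : ‖d.q1 - d.q0‖ = d.L - 2 * g := by rw [hg]; ring
    linarith
  have hlip : ∀ x ∈ Icc 0 d.L, ∀ y ∈ Icc 0 d.L, ‖τ x - τ y‖ ≤ (2 * K + 1) * |x - y| :=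
    fun x _ y _ => (hTB.norm_indicatrix_sub_le x y).trans (by gcongr; linarith)
  have hcf := CoerciveFrame.of_lipschitz hL hg0 (by positivity) hlip hτc hτ1 hint'
  rw [← hc] at hcf
  obtain ⟨V, hV, hend⟩ := hcf.exists_blending hR₀half hR₀c hε0 hV₀ hV₁ hint (by linarith)
  have hsum : ‖projPerp (τ 0) d.N0‖ + ‖V‖ + ‖projPerp (τ d.L) d.N1‖ ≤ (2 + A) * ε := by linarith
  have hform : ∀ δ, IsRestoration d p ρ (approxReconstruct d T P) δ → ∀ t ∈ Icc 0 d.L,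
      δ t = integralCurve d.q0 (restoredTangent d.L τ (projPerp (τ 0) d.N0) V
        (projPerp (τ d.L) d.N1)) t := by
    intro δ hδ
    obtain ⟨hb₀, hb₁, V', hpr, hcurve, hend'⟩ := hδ.exists_blending hτc hτ1 hρ1
    -- Nothing is known about V' beyond closeness ρ; this bound brings it into the region where the
    -- solution is unique.
    have hV' := hcf.norm_blending_le hρ.le hb₀ hb₁
      ((ae_restrict_mem measurableSet_Icc).mono hpr)
    have hBρ : ρ * B = ρ + 3 * d.L / c * ρ + ρ := by rw [hB]; ring
    rw [integral_restoredTangent hL.le] at hend'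
    have := hcf.blending_unique hR₀half hR₀c (V := V') (V' := V) (by linarith) (by linarith)
      (hend'.trans hend.symm)
    rw [← this]
    exact hcurve
  refine ⟨hTB, ⟨_, isRestoration_integralCurve (R := (2 + A) * ε) (Λ := 2 * K + 1) hτc hτ1
    (by positivity) hlip rfl rfl (by linarith) (by linarith) hsum (by linarith) (by linarith) ?_ ?_⟩,
    fun δ δ' h h' t ht => (hform δ h t ht).trans (hform δ' h' t ht).symm,
    _, V, _, hCε ▸ hsum, by linarith, hform⟩
  · rw [le_div_iff₀ (by positivity)] at hηρL
    linarith
  · rw [integral_restoredTangent hL.le, hend]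

/-! ### Edge measure of a partition -/

namespace Partition

variable {L : ℝ} (T : Partition L)

/-- The measure on the set of edges given by the reference lengths. -/
def edgeMeasure : Measure ℕ :=
  ∑ k ∈ Finset.range T.n, ENNReal.ofReal (T.len k) • Measure.dirac k

lemma edgeMeasure_univ : T.edgeMeasure univ = ENNReal.ofReal L := by
  rw [edgeMeasure, Measure.finsetSum_apply]
  simp only [Measure.smul_apply, measure_univ, smul_eq_mul, mul_one]
  rw [← ENNReal.ofReal_sum_of_nonneg fun k hk => (T.len_pos (Finset.mem_range.1 hk)).le,
    T.sum_len_last]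

instance : IsFiniteMeasure T.edgeMeasure := ⟨by rw [edgeMeasure_univ]; exact ENNReal.ofReal_lt_top⟩

lemma ae_edgeMeasure {q : ℕ → Prop} (h : ∀ k < T.n, q k) : ∀ᵐ k ∂T.edgeMeasure, q k := by
  rw [ae_iff, edgeMeasure, Measure.finsetSum_apply]
  refine Finset.sum_eq_zero fun k hk => ?_
  rw [Measure.smul_apply, Measure.dirac_apply' _ (MeasurableSet.of_discrete),
    indicator_of_notMem (by simpa using h k (Finset.mem_range.1 hk)), smul_zero]

lemma integral_edgeMeasure {F : Type*} [NormedAddCommGroup F] [NormedSpace ℝ F] [CompleteSpace F]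
    (f : ℕ → F) : ∫ k, f k ∂T.edgeMeasure = ∑ k ∈ Finset.range T.n, T.len k • f k := by
  rw [edgeMeasure, integral_finsetSum_measure fun k _ =>
    (integrable_dirac (by simp [enorm_lt_top])).smul_measure ENNReal.ofReal_ne_top]
  refine Finset.sum_congr rfl fun k hk => ?_
  rw [integral_smul_measure, integral_dirac,
    ENNReal.toReal_ofReal (T.len_pos (Finset.mem_range.1 hk)).le]

/-- Normalized distance of an edge midpoint from the first one. -/
def param (k : ℕ) : ℝ := (T.mid k - T.mid 0) / (T.mid (T.n - 1) - T.mid 0)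

lemma mid_last_sub_pos (h : 2 ≤ T.n) : 0 < T.mid (T.n - 1) - T.mid 0 :=
  sub_pos.2 (T.mid_lt (by omega) (by omega))

lemma param_mem (h : 2 ≤ T.n) {k : ℕ} (hk : k < T.n) : T.param k ∈ Icc (0 : ℝ) 1 := by
  have h1 := T.mid_last_sub_pos h
  have h2 := T.mid_le k.zero_le hk
  have h3 := T.mid_le (show k ≤ T.n - 1 by omega) (by omega)
  exact ⟨div_nonneg (by linarith) h1.le, (div_le_one h1).2 (by linarith)⟩

lemma param_zero : T.param 0 = 0 := by simp [param]

lemma param_last (h : 2 ≤ T.n) : T.param (T.n - 1) = 1 := div_self (T.mid_last_sub_pos h).ne'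

/-- The discrete parameter maps the range between the first and last midpoints onto [0, 1], whereas
t / L uses all of [0, L]. The two differ by contributions of half edges at the two ends and at edge
k. -/
lemma abs_div_sub_param_le (hL : 0 < L) (h : 2 ≤ T.n) {k : ℕ} (hk : k < T.n) {t : ℝ}
    (ht : t ∈ Icc (T.t k) (T.t (k + 1))) : |t / L - T.param k| ≤ 2 / L * T.mesh := by
  have h1 := T.mid_last_sub_pos h
  obtain ⟨h2, h3⟩ := T.param_mem h hk
  have h4 : T.param k * (T.mid (T.n - 1) - T.mid 0) = T.mid k - T.mid 0 := by
    rw [param, div_mul_cancel₀ _ h1.ne']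
  have h5 := abs_le.1 (T.abs_sub_mid_le ht)
  have h6 := T.len_le_mesh hk
  have h7 := T.len_le_mesh T.n_pos
  have h8 := T.len_le_mesh (show T.n - 1 < T.n by omega)
  have h9 := T.len_pos T.n_pos
  have h10 := T.len_pos (show T.n - 1 < T.n by omega)
  rw [T.mid_last, T.mid_zero] at h4
  have e : t / L - T.param k = (t - T.param k * L) / L := by field_simp
  rw [e, abs_div, abs_of_pos hL, div_mul_eq_mul_div]
  gcongr
  refine abs_le.2 ⟨?_, ?_⟩ <;> nlinarith

end Partition

lemma abs_quadratic_sub_le {s r ε : ℝ} {τ υ V : E m} (hs : s ∈ Icc (0 : ℝ) 1)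
    (hr : r ∈ Icc (0 : ℝ) 1) (hτ : ‖τ‖ = 1) (hυ : ‖υ‖ = 1) (hsr : |s - r| ≤ ε) (hτυ : ‖τ - υ‖ ≤ ε) :
    |(1 - s) * s * ‖projPerp τ V‖ ^ 2 - (1 - r) * r * ‖projPerp υ V‖ ^ 2| ≤ 3 * ε * ‖V‖ ^ 2 := by
  have hε : 0 ≤ ε := (abs_nonneg _).trans hsr
  have h1 : |(1 - s) * s - (1 - r) * r| ≤ ε := by
    rw [show (1 - s) * s - (1 - r) * r = (s - r) * (1 - s - r) by ring, abs_mul]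
    have : |1 - s - r| ≤ 1 := abs_le.2 ⟨by linarith [hs.2, hr.2], by linarith [hs.1, hr.1]⟩
    calc _ ≤ ε * 1 := by gcongr
      _ = ε := mul_one _
  have h2 : |inner ℝ υ V ^ 2 - inner ℝ τ V ^ 2| ≤ 2 * ε * ‖V‖ ^ 2 := by
    have a1 : |inner ℝ υ V| ≤ ‖V‖ := by simpa [hυ] using abs_real_inner_le_norm υ V
    have a2 : |inner ℝ τ V| ≤ ‖V‖ := by simpa [hτ] using abs_real_inner_le_norm τ V
    have a3 : |inner ℝ υ V - inner ℝ τ V| ≤ ε * ‖V‖ := by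
      rw [← inner_sub_left]
      refine (abs_real_inner_le_norm _ _).trans ?_
      rw [norm_sub_rev]; gcongr
    rw [sq_sub_sq, abs_mul]
    calc _ ≤ (‖V‖ + ‖V‖) * (ε * ‖V‖) := by
          gcongr
          exact (abs_add_le _ _).trans (add_le_add a1 a2)
      _ = _ := by ring
  have h3 : 0 ≤ (1 - r) * r ∧ (1 - r) * r ≤ 1 :=
    ⟨mul_nonneg (sub_nonneg.2 hr.2) hr.1, by nlinarith [hr.1, hr.2]⟩
  have h4 := norm_projPerp_le hτ V
  have e : (1 - s) * s * ‖projPerp τ V‖ ^ 2 - (1 - r) * r * ‖projPerp υ V‖ ^ 2 =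
      ((1 - s) * s - (1 - r) * r) * ‖projPerp τ V‖ ^ 2 +
        (1 - r) * r * (inner ℝ υ V ^ 2 - inner ℝ τ V ^ 2) := by
    rw [norm_projPerp_sq hτ, norm_projPerp_sq hυ]; ring
  rw [e]
  refine (abs_add_le _ _).trans ?_
  rw [abs_mul, abs_mul, abs_of_nonneg h3.1, abs_of_nonneg (sq_nonneg ‖projPerp τ V‖)]
  have h5 : |(1 - s) * s - (1 - r) * r| * ‖projPerp τ V‖ ^ 2 ≤ ε * ‖V‖ ^ 2 := by gcongr
  have h6 : (1 - r) * r * |inner ℝ υ V ^ 2 - inner ℝ τ V ^ 2| ≤ 1 * (2 * ε * ‖V‖ ^ 2) := by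
    gcongr
    exact h3.2
  linarith

/-- Coercivity passes to polygons whose edge vectors are close to the tangents of a curve. -/
lemma CoerciveFrame.edgeMeasure {L c ε : ℝ} {T : Partition L} {σ : ℝ → E m} {τ : ℕ → E m}
    (hL : 0 < L) (hn : 2 ≤ T.n) (hσ : ContinuousOn σ (Icc 0 L))
    (hσ1 : ∀ t ∈ Icc 0 L, ‖σ t‖ = 1)
    (H : CoerciveFrame (volume.restrict (Icc 0 L)) c L σ fun t => t / L)
    (hτ1 : ∀ k < T.n, ‖τ k‖ = 1)
    (hστ : ∀ k < T.n, ∀ t ∈ Icc (T.t k) (T.t (k + 1)), ‖σ t - τ k‖ ≤ ε)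
    (hs : 2 / L * T.mesh ≤ ε) (hε : 6 * ε * L ≤ c) :
    CoerciveFrame T.edgeMeasure (c / 2) L τ T.param where
  finite := inferInstance
  mass := by rw [measureReal_def, T.edgeMeasure_univ, ENNReal.toReal_ofReal hL.le]
  meas_tangent := Measurable.of_discrete.aestronglyMeasurable
  meas_param := Measurable.of_discrete.aestronglyMeasurable
  norm_tangent := T.ae_edgeMeasure hτ1
  param_mem := T.ae_edgeMeasure fun _ hk => T.param_mem hn hk
  pos := half_pos H.pos
  coercive V := by
    have h1 := H.coercive V
    have hFc : ContinuousOn (fun t => (1 - t / L) * (t / L) * ‖projPerp (σ t) V‖ ^ 2) (Icc 0 L) := by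
      unfold projPerp; fun_prop
    -- The discrete quadratic form is a Riemann sum of the continuous one with error at most 3 ε L
    -- ‖V‖², hence at most half of the coercive bound.
    have h2 := T.norm_integral_sub_sum_le (ε := 3 * ε * ‖V‖ ^ 2)
      (c := fun k => (1 - T.param k) * T.param k * ‖projPerp (τ k) V‖ ^ 2) hL.le hFc
      fun k hk t ht => abs_quadratic_sub_le
        (div_mem_unitInterval hL (T.edge_subset hk ht)) (T.param_mem hn hk)
        (hσ1 t (T.edge_subset hk ht)) (hτ1 k hk) ((T.abs_div_sub_param_le hL hn hk ht).trans hs)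
        (hστ k hk t ht)
    rw [T.integral_edgeMeasure]
    rw [Real.norm_eq_abs] at h2
    have h3 := (abs_le.1 h2).2
    nlinarith [sq_nonneg ‖V‖]

/-! ### Restoration of polygons -/

section DiscreteRestoration

/-- The edge vectors of the restored polygon. -/
def restoredEdge {L : ℝ} (T : Partition L) (τ : ℕ → E m) (V₀ V V₁ : E m) (k : ℕ) : E m :=
  normalLift (τ k) (blend (T.param k) V₀ V V₁)

/-- The polygon with initial vertex `q` and edge vectors `τ`. -/
def polygonOf {L : ℝ} (T : Partition L) (q : E m) (τ : ℕ → E m) : Polygon m := fun i =>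
  q + ∑ k ∈ Finset.range i, T.len k • τ k

variable {L : ℝ} {T : Partition L} {P : Polygon m}

lemma polygonOf_apply (T : Partition L) (q : E m) (τ : ℕ → E m) (i : ℕ) :
    polygonOf T q τ i = q + ∑ k ∈ Finset.range i, T.len k • τ k := rfl

lemma polygonOf_succ_sub (T : Partition L) (q : E m) (τ : ℕ → E m) (k : ℕ) :
    polygonOf T q τ (k + 1) - polygonOf T q τ k = T.len k • τ k := by
  simp only [polygonOf, Finset.sum_range_succ]; abel

lemma edgeLen_polygonOf {q : E m} {τ : ℕ → E m} {k : ℕ} (hk : k < T.n) (h1 : ‖τ k‖ = 1) :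
    edgeLen (polygonOf T q τ) k = T.len k := by
  rw [edgeLen, polygonOf_succ_sub, norm_smul, h1, mul_one, Real.norm_eq_abs,
    abs_of_pos (T.len_pos hk)]

lemma edgeTangent_polygonOf {q : E m} {τ : ℕ → E m} {k : ℕ} (hk : k < T.n) (h1 : ‖τ k‖ = 1) :
    edgeTangent (polygonOf T q τ) k = τ k := by
  rw [edgeTangent, edgeLen_polygonOf hk h1, polygonOf_succ_sub, smul_smul,
    inv_mul_cancel₀ (T.len_pos hk).ne', one_smul]

lemma polygonOf_succ_ne {q : E m} {τ : ℕ → E m} {k : ℕ} (hk : k < T.n) (h1 : ‖τ k‖ = 1) :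
    polygonOf T q τ (k + 1) ≠ polygonOf T q τ k := by
  rw [← sub_ne_zero, polygonOf_succ_sub]
  refine smul_ne_zero (T.len_pos hk).ne' fun h => ?_
  rw [h, norm_zero] at h1
  exact zero_ne_one h1

lemma edgeParam_eq_param (hlen : ∀ k < T.n, edgeLen P k = T.len k) {k : ℕ} (hk : k < T.n) :
    edgeParam T.n P k = T.param k := by
  have h : ∀ j, j < T.n → ∑ i ∈ Finset.range j, dualEdgeLen P i = T.mid j - T.mid 0 := by
    intro j hj
    rw [← T.sum_dualLen]
    refine Finset.sum_congr rfl fun i hi => ?_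
    have := Finset.mem_range.1 hi
    rw [dualEdgeLen, Partition.dualLen, hlen i (by omega), hlen (i + 1) (by omega)]
  have := T.n_pos
  rw [edgeParam, h k hk, h (T.n - 1) (by omega), Partition.param]

/-- The polygon with the restored edge vectors is a restoration. -/
lemma isDiscreteRestoration_polygonOf {d : ClampedData m} {T : Partition d.L} {ρ R : ℝ}
    {τ : ℕ → E m} {V₀ V V₁ : E m} (hn : 2 ≤ T.n) (h1 : ∀ k < T.n, ‖τ k‖ = 1)
    (h₀ : V₀ = projPerp (τ 0) d.N0) (h₁ : V₁ = projPerp (τ (T.n - 1)) d.N1)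
    (hN₀ : ‖τ 0 - d.N0‖ ≤ 1) (hN₁ : ‖τ (T.n - 1) - d.N1‖ ≤ 1) (hV : ‖V₀‖ + ‖V‖ + ‖V₁‖ ≤ R)
    (hR : R ≤ 1 / 2) (hRρ : 2 * R ≤ ρ) (hRρL : 2 * R * d.L ≤ ρ)
    (hend : ∑ k ∈ Finset.range T.n, T.len k • restoredEdge T τ V₀ V V₁ k = d.q1 - d.q0) :
    IsDiscreteRestoration d T ρ (polygonOf T d.q0 τ)
      (polygonOf T d.q0 (restoredEdge T τ V₀ V V₁)) := by
  have hR0 : 0 ≤ R := le_trans (by positivity) hV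
  have p0 : 0 < T.n := T.n_pos
  have pL : T.n - 1 < T.n := by omega
  set f := restoredEdge T τ V₀ V V₁ with hf
  have hblend : ∀ k < T.n, ‖blend (T.param k) V₀ V V₁‖ ≤ R := fun k hk =>
    (norm_blend_le (T.param_mem hn hk) V₀ V V₁).trans hV
  have hf1 : ∀ k < T.n, ‖f k‖ = 1 := fun k hk =>
    norm_normalLift (h1 k hk) ((hblend k hk).trans (hR.trans (by norm_num)))
  have hdiff : ∀ k < T.n, ‖f k - τ k‖ ≤ 2 * R := fun k hk =>
    (norm_normalLift_sub_self_le (h1 k hk) ((hblend k hk).trans hR)).trans (by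
      have := hblend k hk; gcongr)
  have hlen : ∀ k < T.n, edgeLen (polygonOf T d.q0 τ) k = T.len k := fun k hk =>
    edgeLen_polygonOf hk (h1 k hk)
  refine ⟨⟨fun k hk => polygonOf_succ_ne hk (hf1 k hk), ?_, ?_, ?_, ?_, fun k hk => ?_⟩,
    ⟨0, V₀, V, V₁, fun k => √(1 - ‖projPerp (τ k) (blend (T.param k) V₀ V V₁)‖ ^ 2) - 1,
      ?_, ?_, fun i hi => ?_⟩, fun i hi => ?_, fun k hk => ?_⟩
  · simp [polygonOf]
  · rw [polygonOf, hend]; abel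
  · rw [edgeTangent_polygonOf p0 (hf1 0 p0), hf, restoredEdge, T.param_zero, blend_zero_left, h₀,
      normalLift_projPerp_eq (h1 0 p0) d.norm_N0 hN₀]
  · rw [edgeTangent_polygonOf pL (hf1 _ pL), hf, restoredEdge, T.param_last hn, blend_one_left, h₁,
      normalLift_projPerp_eq (h1 _ pL) d.norm_N1 hN₁]
  · rw [edgeLen_polygonOf hk (hf1 k hk), div_self (T.len_pos hk).ne', Real.log_one]
  · rw [edgeTangent_polygonOf p0 (h1 0 p0), h₀, inner_projPerp (h1 0 p0)]
  · rw [edgeTangent_polygonOf pL (h1 _ pL), h₁, inner_projPerp (h1 _ pL)]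
  · simp only [polygonOf_apply, discreteFieldAlong]
    rw [add_sub_add_left_eq_sub, ← Finset.sum_sub_distrib, zero_add]
    refine Finset.sum_congr rfl fun k hk => ?_
    have hk' : k < T.n := (Finset.mem_range.1 hk).trans_le hi
    have e1 := edgeParam_eq_param hlen hk'
    have e2 := hlen k hk'
    have e3 : edgeTangent (polygonOf T d.q0 τ) k = τ k := edgeTangent_polygonOf hk' (h1 k hk')
    rw [e1, e2, e3, ← smul_sub, hf, restoredEdge, normalLift, sub_smul, one_smul]
    congr 1
    abel
  · simp only [polygonOf]
    rw [add_sub_add_left_eq_sub, ← Finset.sum_sub_distrib]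
    refine (norm_sum_le_of_le _ (n := fun k => 2 * R * T.len k) fun k hk => ?_).trans ?_
    · have hk' : k < T.n := (Finset.mem_range.1 hk).trans_le hi
      rw [← smul_sub, norm_smul, Real.norm_eq_abs, abs_of_pos (T.len_pos hk'), mul_comm]
      exact mul_le_mul_of_nonneg_right (hdiff k hk') (T.len_pos hk').le
    · rw [← Finset.mul_sum, T.sum_len]
      refine le_trans ?_ hRρL
      gcongr
      exact (T.t_mem hi).2
  · rw [sub_sub_sub_comm, polygonOf_succ_sub, polygonOf_succ_sub, ← smul_sub, smul_smul,
      inv_mul_cancel₀ (T.len_pos hk).ne', one_smul]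
    exact (hdiff k hk).trans hRρ

/-- Every restoration of a polygon has the restored edge vectors. -/
lemma IsDiscreteRestoration.exists_blending {d : ClampedData m} {T : Partition d.L} {ρ : ℝ}
    {τ : ℕ → E m} {Q : Polygon m} (hn : 2 ≤ T.n) (h1 : ∀ k < T.n, ‖τ k‖ = 1) (hρ : ρ ≤ 1)
    (h : IsDiscreteRestoration d T ρ (polygonOf T d.q0 τ) Q) :
    ‖projPerp (τ 0) d.N0‖ ≤ ρ ∧ ‖projPerp (τ (T.n - 1)) d.N1‖ ≤ ρ ∧ ∃ V : E m,
      (∀ k < T.n, ‖projPerp (τ k) (blend (T.param k) (projPerp (τ 0) d.N0) V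
        (projPerp (τ (T.n - 1)) d.N1))‖ ≤ ρ) ∧
      (∀ k < T.n, edgeTangent Q k = restoredEdge T τ (projPerp (τ 0) d.N0) V
        (projPerp (τ (T.n - 1)) d.N1) k) ∧
      ∑ k ∈ Finset.range T.n, T.len k • restoredEdge T τ (projPerp (τ 0) d.N0) V
        (projPerp (τ (T.n - 1)) d.N1) k = d.q1 - d.q0 := by
  have p0 : 0 < T.n := T.n_pos
  have pL : T.n - 1 < T.n := by omega
  have hlen : ∀ k < T.n, edgeLen (polygonOf T d.q0 τ) k = T.len k := fun k hk =>
    edgeLen_polygonOf hk (h1 k hk)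
  obtain ⟨hfeas, ⟨U₀, V₀, V, V₁, lam, hV₀, hV₁, hfield⟩, -, hclose⟩ := h
  rw [edgeTangent_polygonOf p0 (h1 0 p0)] at hV₀
  rw [edgeTangent_polygonOf pL (h1 _ pL)] at hV₁
  set g : ℕ → E m := fun k => lam k • τ k + projPerp (τ k) (blend (T.param k) V₀ V V₁) with hg
  have hQ : ∀ k < T.n, (Q (k + 1) - polygonOf T d.q0 τ (k + 1)) - (Q k - polygonOf T d.q0 τ k) =
      T.len k • g k := fun k hk => by
    have e1 := hfield (k + 1) hk
    have e2 := hfield k hk.le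
    simp only at e1 e2
    rw [e1, e2]
    simp only [discreteFieldAlong, Finset.sum_range_succ]
    rw [hlen k hk, edgeTangent_polygonOf hk (h1 k hk), edgeParam_eq_param hlen hk, hg]
    abel
  have hgρ : ∀ k < T.n, ‖g k‖ ≤ ρ := fun k hk => by
    have := hclose k hk
    rwa [hQ k hk, smul_smul, inv_mul_cancel₀ (T.len_pos hk).ne', one_smul] at this
  have hρ0 : 0 ≤ ρ := (norm_nonneg _).trans (hgρ 0 p0)
  have hsq : ∀ k < T.n, |lam k| ≤ ρ ∧
      ‖projPerp (τ k) (blend (T.param k) V₀ V V₁)‖ ≤ ρ := fun k hk => by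
    have h2 := norm_smul_add_projPerp_sq (h1 k hk) (lam k) (blend (T.param k) V₀ V V₁)
    have h3 : ‖g k‖ ^ 2 ≤ ρ ^ 2 := by gcongr; exact hgρ k hk
    simp only [hg] at h3
    rw [h2] at h3
    exact ⟨abs_le_of_sq_le_sq
      (by nlinarith [sq_nonneg ‖projPerp (τ k) (blend (T.param k) V₀ V V₁)‖]) hρ0,
      (sq_le_sq₀ (norm_nonneg _) hρ0).1 (by nlinarith [sq_nonneg (lam k)])⟩
  have htan : ∀ k < T.n, edgeTangent Q k = restoredEdge T τ V₀ V V₁ k := fun k hk => by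
    have h2 := edgeLen_smul_edgeTangent Q k
    rw [edgeLen_eq_len hfeas hk] at h2
    have h3 : T.len k • edgeTangent Q k = T.len k • (τ k + g k) := by
      rw [h2, smul_add, ← hQ k hk, ← polygonOf_succ_sub T d.q0 τ k]; abel
    have h4 : edgeTangent Q k = τ k + g k := smul_right_injective _ (T.len_pos hk).ne' h3
    have e : τ k + g k = (1 + lam k) • τ k + projPerp (τ k) (blend (T.param k) V₀ V V₁) := by
      simp only [hg, add_smul, one_smul, add_assoc]
    have h5 := norm_edgeTangent (hfeas.1 k hk)
    rw [h4, e] at h5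
    have h6 := (abs_le.1 (hsq k hk).1).1
    rw [h4, e, restoredEdge, normalLift,
      ← eq_sqrt_of_norm_smul_add_projPerp (h1 k hk) (by linarith) h5]
  obtain ⟨-, hq0, hq1, hN0, hN1, -⟩ := id hfeas
  have e₀ : V₀ = projPerp (τ 0) d.N0 := by
    refine projPerp_eq_of_normalLift_eq (h1 0 p0) hV₀ ?_
    rw [← hN0, htan 0 p0, restoredEdge, T.param_zero, blend_zero_left]
  have e₁ : V₁ = projPerp (τ (T.n - 1)) d.N1 := by
    refine projPerp_eq_of_normalLift_eq (h1 _ pL) hV₁ ?_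
    rw [← hN1, htan _ pL, restoredEdge, T.param_last hn, blend_one_left]
  have b₀ := (hsq 0 p0).2
  have b₁ := (hsq _ pL).2
  rw [T.param_zero, blend_zero_left, projPerp_eq_self hV₀] at b₀
  rw [T.param_last hn, blend_one_left, projPerp_eq_self hV₁] at b₁
  rw [← e₀, ← e₁]
  refine ⟨b₀, b₁, V, fun k hk => (hsq k hk).2, htan, ?_⟩
  rw [← hq1, ← hq0, ← sum_len_smul_edgeTangent hfeas le_rfl]
  exact Finset.sum_congr rfl fun k hk => by rw [htan k (Finset.mem_range.1 hk)]

end DiscreteRestoration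

/-! ### Inscribed polygons -/

/-- Unit edge vectors of the polygon inscribed into `γ`. -/
def chordTangent {L : ℝ} (T : Partition L) (γ : ℝ → E m) (k : ℕ) : E m :=
  edgeTangent (fun j => γ (T.t j)) k

lemma approxSample_eq {L : ℝ} (T : Partition L) (γ : ℝ → E m) :
    approxSample T γ = polygonOf T (γ 0) (chordTangent T γ) := by
  funext i
  simp only [approxSample, polygonOf_apply, chordTangent, edgeTangent, smul_smul, div_eq_mul_inv]

/-- Normalization of a vector close to a multiple of a unit vector. -/
lemma norm_normalize_sub_le {c v : E m} {ℓ η : ℝ} (hv : ‖v‖ = 1) (hℓ : 0 < ℓ) (hη : η < 1)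
    (h : ‖c - ℓ • v‖ ≤ η * ℓ) :
    c ≠ 0 ∧ ‖‖c‖⁻¹ • c - v‖ ≤ 2 * η ∧ ‖ℓ • (‖c‖⁻¹ • c) - c‖ ≤ η * ℓ := by
  have h1 : |‖c‖ - ℓ| ≤ η * ℓ := by
    have := abs_norm_sub_norm_le c (ℓ • v)
    rw [norm_smul, hv, mul_one, Real.norm_eq_abs, abs_of_pos hℓ] at this
    exact this.trans h
  have hc : c ≠ 0 := by
    rintro rfl
    rw [norm_zero, zero_sub, abs_neg, abs_of_pos hℓ] at h1
    nlinarith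
  have hx : ‖‖c‖⁻¹ • c‖ = 1 := norm_smul_inv_norm hc
  have hcx : c = ‖c‖ • (‖c‖⁻¹ • c) := by
    rw [smul_smul, mul_inv_cancel₀ (norm_ne_zero_iff.2 hc), one_smul]
  set x := ‖c‖⁻¹ • c with hxdef
  -- Rescaling c to length ℓ costs no more than its distance from the vector of length ℓ, so
  -- normalization at most doubles the error.
  have h2 : ‖ℓ • x - c‖ ≤ η * ℓ := by
    have e : ℓ • x - c = (ℓ - ‖c‖) • x := by
      rw [sub_smul, ← hcx]
    rw [e, norm_smul, hx, mul_one, Real.norm_eq_abs, abs_sub_comm]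
    exact h1
  refine ⟨hc, ?_, h2⟩
  have e : ℓ • (x - v) = (ℓ • x - c) + (c - ℓ • v) := by rw [smul_sub]; abel
  have h3 : ‖ℓ • (x - v)‖ ≤ η * ℓ + η * ℓ := by
    rw [e]; exact (norm_add_le _ _).trans (add_le_add h2 h)
  rw [norm_smul, Real.norm_eq_abs, abs_of_pos hℓ] at h3
  have : ℓ * ‖x - v‖ ≤ ℓ * (2 * η) := by linarith
  exact le_of_mul_le_mul_left this hℓ

namespace RegularCurve

variable {L M : ℝ} {γ a : ℝ → E m}

/-- The midpoint rule survives normalization. The error is measured by the length of edge k and not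
by the mesh, so that it can later be divided by a dual length on an arbitrary partition. -/
lemma chordTangent_spec (H : RegularCurve L M γ a) (hM : 0 ≤ M) (T : Partition L)
    (hmesh : M * T.mesh ^ 2 < 1) {k : ℕ} (hk : k < T.n) :
    ‖chordTangent T γ k‖ = 1 ∧
      ‖chordTangent T γ k - velocity L γ (T.mid k)‖ ≤ 2 * (M * T.len k ^ 2) ∧
      ‖T.len k • chordTangent T γ k - (γ (T.t (k + 1)) - γ (T.t k))‖ ≤
        M * T.len k ^ 2 * T.len k := by
  have h1 : ‖γ (T.t (k + 1)) - γ (T.t k) - T.len k • velocity L γ (T.mid k)‖ ≤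
      M * T.len k ^ 2 * T.len k :=
    H.norm_chord_sub_le hM (T.t_mem hk.le) (T.t_mem hk) (T.t_lt k hk).le
  have h2 := T.len_pos hk
  have h3 := T.len_le_mesh hk
  have h6 : M * T.len k ^ 2 < 1 := lt_of_le_of_lt (by gcongr) hmesh
  obtain ⟨hne, h4, h5⟩ := norm_normalize_sub_le (H.norm_velocity _ (T.mid_mem hk)) h2
    h6 h1
  exact ⟨norm_smul_inv_norm hne, h4, h5⟩

lemma integral_velocity (H : RegularCurve L M γ a) (hL : 0 < L) :
    ∫ t in Icc 0 L, velocity L γ t = γ L - γ 0 := by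
  rw [integral_Icc_eq_integral_Ioc, ← intervalIntegral.integral_of_le hL.le]
  refine integral_eq_of_hasDerivAt_off_countable_of_le γ _ hL.le countable_empty H.continuousOn
    (fun t ht => (H.deriv t (Ioo_subset_Icc_self ht.1)).hasDerivAt
      (Icc_mem_nhds ht.1.1 ht.1.2)) ?_
  exact (H.continuousOn_velocity.mono (by rw [uIcc_of_le hL.le])).intervalIntegrable

end RegularCurve

/-! ### The sampling operator -/

/-- Existence, uniqueness and form of the restoration that defines the sampling operator. -/
theorem exists_sampling_bounds (d : ClampedData m) (hd : ‖d.q1 - d.q0‖ < d.L) (p : ℝ≥0∞)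
    {K₁ : ℝ} (hK₁ : 0 ≤ K₁) :
    ∃ ρ₀ : ℝ, 0 < ρ₀ ∧ ∃ C : ℝ, 0 ≤ C ∧ ∀ ρ : ℝ, 0 < ρ → ρ ≤ ρ₀ → ∃ h₀ : ℝ, 0 < h₀ ∧
      ∀ T : Partition d.L, T.mesh ≤ h₀ → 2 ≤ T.n ∧ T.mesh ≤ 1 ∧ ∀ γ ∈ priors d p K₁,
        (∃ a, RegularCurve d.L (K₁ + 1) γ a) ∧
        (∀ k < T.n, ‖chordTangent T γ k‖ = 1 ∧
          ‖chordTangent T γ k - velocity d.L γ (T.mid k)‖ ≤ 2 * ((K₁ + 1) * T.len k ^ 2)) ∧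
        (∃ Q, IsDiscreteRestoration d T ρ (approxSample T γ) Q) ∧
        (∀ Q Q' : Polygon m, IsDiscreteRestoration d T ρ (approxSample T γ) Q →
          IsDiscreteRestoration d T ρ (approxSample T γ) Q' → ∀ i ≤ T.n, Q i = Q' i) ∧
        ∃ V₀ V V₁ : E m, ‖V₀‖ + ‖V‖ + ‖V₁‖ ≤ C * T.mesh ∧ ‖V₀‖ + ‖V‖ + ‖V₁‖ ≤ 1 / 2 ∧
          ∀ Q, IsDiscreteRestoration d T ρ (approxSample T γ) Q → Q ∈ discreteFeasible d T ∧
            ∀ k < T.n, edgeTangent Q k = restoredEdge T (chordTangent T γ) V₀ V V₁ k := by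
  have hL := d.L_pos
  set M := K₁ + 1 with hM
  have hM0 : 0 < M := by rw [hM]; linarith
  -- The velocity of γ integrates exactly to q₁ - q₀, so the whole gap is available.
  set g := d.L - ‖d.q1 - d.q0‖ with hg
  have hg0 : 0 < g := by rw [hg]; linarith
  set c := coercivityConst d.L g M with hc
  have hc0 : 0 < c := coercivityConst_pos hL hg0 hM0
  -- Passing from the curve to the edge measure halves the coercivity constant.
  obtain ⟨c', hc'⟩ : ∃ c', c' = c / 2 := ⟨_, rfl⟩
  have hc'0 : 0 < c' := by rw [hc']; positivity
  set R₀ := min (1 / 2) (c' / (4 * d.L)) with hR₀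
  have hR₀pos : 0 < R₀ := lt_min (by norm_num) (by positivity)
  have hR₀half : R₀ ≤ 1 / 2 := min_le_left _ _
  have hR₀c : 4 * R₀ * d.L ≤ c' := by
    have : R₀ ≤ c' / (4 * d.L) := min_le_right _ _
    rw [le_div_iff₀ (by positivity)] at this
    linarith
  set B := 2 + 3 * d.L / c' with hB
  have hB0 : 0 < B := by positivity
  set A := 4 * (4 * d.L + 1) / c' with hA
  have hA0 : 0 ≤ A := by positivity
  -- The terms of N h control the distance between velocity and chords (at most 3 M h), the end
  -- point error (at most M h L) and the difference of the two parameters (at most 2 h / L).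
  set N := 3 * M * (1 + d.L) + 2 / d.L with hN
  have hN0 : 0 ≤ N := by positivity
  set C := (2 + A) * N with hC
  have hC0 : 0 ≤ C := by positivity
  refine ⟨min 1 (R₀ / B), lt_min one_pos (by positivity), C, hC0, fun ρ hρ hρ₀ => ?_⟩
  have hρ1 : ρ ≤ 1 := hρ₀.trans (min_le_left _ _)
  have hρB : ρ * B ≤ R₀ := by
    have : ρ ≤ R₀ / B := hρ₀.trans (min_le_right _ _)
    rwa [le_div_iff₀ hB0] at this
  obtain ⟨h₀, hh₀, hh₀L, hCh₀⟩ := exists_mesh_bound (L := min d.L 1)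
    (η := min (min (c / (6 * d.L)) 1) (min R₀ (min (ρ / 2) (ρ / (2 * d.L))))) hC0
    (lt_min hL one_pos)
    (lt_min (lt_min (by positivity) one_pos)
      (lt_min hR₀pos (lt_min (by positivity) (by positivity))))
  refine ⟨h₀, hh₀, fun T hT => ?_⟩
  have hTL : T.mesh < d.L := (hT.trans_lt hh₀L).trans_le (min_le_left _ _)
  have hT1 : T.mesh ≤ 1 := ((hT.trans_lt hh₀L).trans_le (min_le_right _ _)).le
  have hn := T.two_le_n hTL
  refine ⟨hn, hT1, fun γ hγ => ?_⟩
  obtain ⟨a, hreg⟩ := exists_regularCurve hK₁ hγ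
  rw [← hM] at hreg
  have hmesh := T.mesh_pos
  set ε := N * T.mesh with hε
  have hε0 : 0 ≤ ε := by positivity
  have hCε : C * T.mesh = (2 + A) * ε := by rw [hC, hε]; ring
  have hCη : (2 + A) * ε ≤
      min (min (c / (6 * d.L)) 1) (min R₀ (min (ρ / 2) (ρ / (2 * d.L)))) := by
    rw [← hCε]
    exact (mul_le_mul_of_nonneg_left hT hC0).trans hCh₀
  obtain ⟨⟨hηc, hη1⟩, hηR, hηρ, hηρL⟩ : ((2 + A) * ε ≤ c / (6 * d.L) ∧ (2 + A) * ε ≤ 1) ∧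
      (2 + A) * ε ≤ R₀ ∧ (2 + A) * ε ≤ ρ / 2 ∧ (2 + A) * ε ≤ ρ / (2 * d.L) := by
    simpa only [le_min_iff] using hCη
  have hεle : ε ≤ (2 + A) * ε := by nlinarith
  have hsplit : ε = 3 * (M * T.mesh) + 3 * (M * T.mesh * d.L) + 2 / d.L * T.mesh := by
    rw [hε, hN]; ring
  have hs1 : 0 < M * T.mesh := by positivity
  have hs2 : 0 < M * T.mesh * d.L := by positivity
  have hs3 : 0 < 2 / d.L * T.mesh := by positivity
  have hMm : M * T.mesh ^ 2 ≤ M * T.mesh := by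
    rw [sq, ← mul_assoc]; exact mul_le_of_le_one_right hs1.le hT1
  have hMm1 : M * T.mesh ^ 2 < 1 := by linarith
  have hspec := fun k (hk : k < T.n) => hreg.chordTangent_spec hM0.le T hMm1 hk
  set χ := chordTangent T γ with hχ
  set v := velocity d.L γ with hv
  have hχ1 : ∀ k < T.n, ‖χ k‖ = 1 := fun k hk => (hspec k hk).1
  have hclose : ∀ k < T.n, ∀ t ∈ Icc (T.t k) (T.t (k + 1)), ‖v t - χ k‖ ≤ ε := by
    intro k hk t ht
    have h1 := hreg.norm_velocity_sub_le (T.edge_subset hk ht) (T.mid_mem hk)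
    have h2 := (hspec k hk).2.1
    have h3 := T.abs_sub_mid_le ht
    have h4 := T.len_le_mesh hk
    have h5 := T.len_pos hk
    have h6 := norm_sub_le_norm_sub_add_norm_sub (v t) (v (T.mid k)) (χ k)
    rw [norm_sub_rev (v (T.mid k))] at h6
    have h7 : M * |t - T.mid k| ≤ M * T.mesh := by gcongr; linarith
    have h8 : M * T.len k ^ 2 ≤ M * T.mesh ^ 2 := by gcongr
    linarith
  obtain ⟨-, hγ0, hγL, hT0, hTL', -⟩ := hγ.1
  have mem0 : (0 : ℝ) ∈ Icc 0 d.L := ⟨le_rfl, hL.le⟩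
  have memL : d.L ∈ Icc 0 d.L := ⟨hL.le, le_rfl⟩
  have htan : ∀ t ∈ Icc 0 d.L, tangent d.L γ t = v t := fun t ht => by
    rw [tangent, hreg.norm_velocity t ht, inv_one, one_smul]
  have m0 : (0 : ℝ) ∈ Icc (T.t 0) (T.t (0 + 1)) := by
    rw [← T.t_zero]; exact ⟨le_rfl, (T.t_lt 0 T.n_pos).le⟩
  have hn1 : T.n - 1 + 1 = T.n := Nat.sub_add_cancel T.n_pos
  have hn1' : T.n - 1 < T.n := Nat.sub_lt T.n_pos one_pos
  have mL : d.L ∈ Icc (T.t (T.n - 1)) (T.t (T.n - 1 + 1)) := by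
    rw [hn1, T.t_last]
    have := T.t_lt _ hn1'
    rw [hn1, T.t_last] at this
    exact ⟨this.le, le_rfl⟩
  have hχ0 : ‖χ 0 - d.N0‖ ≤ ε := by
    rw [← hT0, htan 0 mem0, norm_sub_rev]; exact hclose 0 T.n_pos 0 m0
  have hχL : ‖χ (T.n - 1) - d.N1‖ ≤ ε := by
    rw [← hTL', htan _ memL, norm_sub_rev]; exact hclose _ hn1' _ mL
  have hV₀ : ‖projPerp (χ 0) d.N0‖ ≤ ε :=
    (norm_projPerp_le_norm_sub (hχ1 0 T.n_pos)).trans hχ0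
  have hV₁ : ‖projPerp (χ (T.n - 1)) d.N1‖ ≤ ε :=
    (norm_projPerp_le_norm_sub (hχ1 _ hn1')).trans hχL
  have hint : ‖∫ k, χ k ∂T.edgeMeasure - (d.q1 - d.q0)‖ ≤ ε := by
    -- The chords themselves close up exactly; the end point is displaced only by rescaling them to
    -- the reference lengths.
    have e : d.q1 - d.q0 = ∑ k ∈ Finset.range T.n, (γ (T.t (k + 1)) - γ (T.t k)) := by
      rw [Finset.sum_range_sub (fun k => γ (T.t k)), T.t_zero, T.t_last, hγ0, hγL]
    rw [T.integral_edgeMeasure, e, ← Finset.sum_sub_distrib]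
    refine (norm_sum_le_of_le _ (n := fun k => M * T.mesh ^ 2 * T.len k) fun k hk => ?_).trans ?_
    · have hk' := Finset.mem_range.1 hk
      refine (hspec k hk').2.2.trans ?_
      have h4 := T.len_le_mesh hk'
      have h5 := T.len_pos hk'
      gcongr
    · rw [← Finset.mul_sum, T.sum_len_last]
      have : M * T.mesh ^ 2 * d.L ≤ M * T.mesh * d.L := by gcongr
      linarith
  have hvL : ‖∫ t in Icc 0 d.L, v t‖ ≤ d.L - g := by
    rw [hreg.integral_velocity hL, hγ0, hγL, hg]; linarith
  have hcf₀ := CoerciveFrame.of_lipschitz hL hg0 hM0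
    (fun x hx y hy => hreg.norm_velocity_sub_le hx hy) hreg.continuousOn_velocity
    hreg.norm_velocity hvL
  rw [← hc] at hcf₀
  have hcf := CoerciveFrame.edgeMeasure hL hn hreg.continuousOn_velocity hreg.norm_velocity hcf₀
    hχ1 hclose (by linarith) (by
      rw [le_div_iff₀ (by positivity)] at hηc
      have : ε * (6 * d.L) ≤ (2 + A) * ε * (6 * d.L) := by gcongr
      linarith)
  rw [← hc'] at hcf
  obtain ⟨V, hV, hend⟩ := hcf.exists_blending hR₀half hR₀c hε0 hV₀ hV₁ hint (by linarith)
  have hsum : ‖projPerp (χ 0) d.N0‖ + ‖V‖ + ‖projPerp (χ (T.n - 1)) d.N1‖ ≤ (2 + A) * ε := by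
    linarith
  have happrox : approxSample T γ = polygonOf T d.q0 χ := by rw [approxSample_eq, hγ0]
  rw [happrox]
  have hform : ∀ Q, IsDiscreteRestoration d T ρ (polygonOf T d.q0 χ) Q →
      Q ∈ discreteFeasible d T ∧ ∀ k < T.n, edgeTangent Q k =
        restoredEdge T χ (projPerp (χ 0) d.N0) V (projPerp (χ (T.n - 1)) d.N1) k := by
    intro Q hQ
    obtain ⟨hb₀, hb₁, V', hpr, hedge, hend'⟩ := hQ.exists_blending hn hχ1 hρ1
    have hV' := hcf.norm_blending_le hρ.le hb₀ hb₁ (T.ae_edgeMeasure hpr)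
    have hBρ : ρ * B = ρ + 3 * d.L / c' * ρ + ρ := by rw [hB]; ring
    have := hcf.blending_unique hR₀half hR₀c
      (V₀ := projPerp (χ 0) d.N0) (V₁ := projPerp (χ (T.n - 1)) d.N1) (V := V') (V' := V) (by linarith) (by linarith)
      (by rw [hend, T.integral_edgeMeasure]; exact hend')
    rw [← this]
    exact ⟨hQ.feasible, hedge⟩
  refine ⟨⟨a, hreg⟩, fun k hk => ⟨(hspec k hk).1, (hspec k hk).2.1⟩,
    ⟨_, isDiscreteRestoration_polygonOf (R := (2 + A) * ε) hn hχ1 rfl rfl (by linarith)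
      (by linarith) hsum (by linarith) (by linarith) ?_ ?_⟩, fun Q Q' hQ hQ' i hi => ?_,
    _, V, _, hCε ▸ hsum, by linarith, hform⟩
  · rw [le_div_iff₀ (by positivity)] at hηρL
    linarith
  · rw [← hend, T.integral_edgeMeasure]; rfl
  · obtain ⟨hf, he⟩ := hform Q hQ
    obtain ⟨hf', he'⟩ := hform Q' hQ'
    have e1 := sum_len_smul_edgeTangent hf hi
    have e2 := sum_len_smul_edgeTangent hf' hi
    rw [hf.2.1] at e1
    rw [hf'.2.1] at e2
    refine sub_left_injective (b := d.q0) ?_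
    simp only
    rw [← e1, ← e2]
    refine Finset.sum_congr rfl fun k hk => ?_
    have hk' : k < T.n := (Finset.mem_range.1 hk).trans_le hi
    rw [he k hk', he' k hk']

/-! ### Derivative bounds for the normal lift -/

/-- The normal lift has a bounded and Lipschitz continuous derivative, uniformly in the tangents and
the small normal parts. -/
lemma exists_normalLift_deriv_bound (m : ℕ) :
    ∃ B : ℝ, 0 ≤ B ∧ ∃ G : E m × E m → (E m × E m →L[ℝ] E m),
      ∀ x ∈ Metric.closedBall (0 : E m) 1 ×ˢ Metric.closedBall (0 : E m) (1 / 2),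
        HasFDerivAt (fun x : E m × E m => normalLift x.1 x.2) (G x) x ∧ ‖G x‖ ≤ B ∧
        ∀ y ∈ Metric.closedBall (0 : E m) 1 ×ˢ Metric.closedBall (0 : E m) (1 / 2),
          ‖G x - G y‖ ≤ B * ‖x - y‖ := by
  -- The tangents range over the closed ball and not the sphere so that S is convex; a C^1 map on a
  -- compact convex set is Lipschitz.
  set S := Metric.closedBall (0 : E m) 1 ×ˢ Metric.closedBall (0 : E m) (1 / 2) with hS
  set F : E m × E m → E m := fun x => normalLift x.1 x.2 with hF
  -- On this open set the radicand is positive and the lift is C²; S lies inside since ‖τ‖ ≤ 1 still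
  -- gives ‖projPerp τ b‖ ≤ ‖b‖.
  set U : Set (E m × E m) := {x | ‖projPerp x.1 x.2‖ ^ 2 < 1} with hU
  have hp : ContDiff ℝ 2 fun x : E m × E m => projPerp x.1 x.2 := by
    unfold projPerp
    exact contDiff_snd.sub ((contDiff_fst.inner ℝ contDiff_snd).smul contDiff_fst)
  have hUo : IsOpen U := isOpen_lt (hp.continuous.norm.pow 2) continuous_const
  have hSU : S ⊆ U := by
    rintro ⟨τ, b⟩ ⟨hτ, hb⟩
    simp only [mem_closedBall_zero_iff] at hτ hb
    have h1 : ‖projPerp τ b‖ ^ 2 =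
        ‖b‖ ^ 2 - 2 * inner ℝ τ b ^ 2 + inner ℝ τ b ^ 2 * ‖τ‖ ^ 2 := by
      rw [projPerp, norm_sub_sq_real, inner_smul_right, real_inner_comm, norm_smul, mul_pow,
        Real.norm_eq_abs, sq_abs]
      ring
    have h2 : ‖τ‖ ^ 2 ≤ 1 := pow_le_one₀ (norm_nonneg _) hτ
    have h3 : ‖b‖ ^ 2 ≤ (1 / 2) ^ 2 := by gcongr
    have h4 := mul_le_mul_of_nonneg_left h2 (sq_nonneg (inner ℝ τ b))
    change ‖projPerp τ b‖ ^ 2 < 1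
    nlinarith [sq_nonneg (inner ℝ τ b)]
  have hFU : ContDiffOn ℝ 2 F U := by
    refine ContDiffOn.add (ContDiffOn.smul (ContDiffOn.sqrt ?_ fun x hx => ?_) contDiffOn_fst)
      hp.contDiffOn
    · exact contDiffOn_const.sub ((hp.norm_sq ℝ).contDiffOn)
    · exact (sub_pos.2 hx).ne'
  have hG : ContDiffOn ℝ 1 (fderiv ℝ F) U := hFU.fderiv_of_isOpen hUo (by norm_num)
  have hSc : IsCompact S := (isCompact_closedBall _ _).prod (isCompact_closedBall _ _)
  obtain ⟨K, hK⟩ := (hG.mono hSU).exists_lipschitzOnWith one_ne_zero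
    ((convex_closedBall _ _).prod (convex_closedBall _ _)) hSc
  obtain ⟨B, hB⟩ := hSc.exists_bound_of_continuousOn (hG.mono hSU).continuousOn
  refine ⟨max K B, le_max_of_le_left K.coe_nonneg, fderiv ℝ F, fun x hx => ⟨?_, ?_, fun y hy => ?_⟩⟩
  · exact ((hFU.contDiffAt (hUo.mem_nhds (hSU hx))).differentiableAt two_ne_zero).hasFDerivAt
  · exact (hB x hx).trans (le_max_right _ _)
  · rw [← dist_eq_norm, ← dist_eq_norm]
    refine (hK.dist_le_mul x hx y hy).trans ?_
    gcongr
    exact le_max_left _ _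

/-- A curve with a bounded and Lipschitz continuous derivative. -/
structure HasBoundedDeriv {F : Type*} [NormedAddCommGroup F] [NormedSpace ℝ F] (s : Set ℝ)
    (B : ℝ) (f f' : ℝ → F) : Prop where
  deriv : ∀ t ∈ s, HasDerivWithinAt f (f' t) s t
  bound : ∀ t ∈ s, ‖f' t‖ ≤ B
  lipschitz : ∀ x ∈ s, ∀ y ∈ s, ‖f' x - f' y‖ ≤ B * |x - y|

lemma RegularCurve.hasBoundedDeriv {L M : ℝ} {γ a : ℝ → E m} (H : RegularCurve L M γ a) {s : Set ℝ}
    (hs : s ⊆ Icc 0 L) : HasBoundedDeriv s M (velocity L γ) a where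
  deriv t ht := (H.deriv_velocity t (hs ht)).mono hs
  bound t ht := H.norm_accel t (hs ht)
  lipschitz x hx y hy := H.lipschitz_accel x (hs hx) y (hs hy)

/-- Each derivative of the quadratic polynomial in the rescaled parameter contributes a factor 1 /
D. The blending vectors enter only through a fixed bound, so the constant does not depend on their
choice. -/
lemma hasBoundedDeriv_blend {s : Set ℝ} {x₀ D : ℝ} (hD : 0 < D)
    (hs : ∀ t ∈ s, (t - x₀) / D ∈ Icc (0 : ℝ) 1) {V₀ V V₁ : E m}
    (hV : ‖V₀‖ + ‖V‖ + ‖V₁‖ ≤ 1 / 2) {B : ℝ} (hB : 1 / D + 2 / D ^ 2 ≤ B) :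
    HasBoundedDeriv s B (fun t => blend ((t - x₀) / D) V₀ V V₁) fun t =>
      D⁻¹ • ((-2 * (1 - (t - x₀) / D)) • V₀ + (1 - 2 * ((t - x₀) / D)) • V +
        (2 * ((t - x₀) / D)) • V₁) where
  deriv t ht := by
    have h1 : HasDerivAt (fun t : ℝ => (t - x₀) / D) D⁻¹ t := by
      simpa using ((hasDerivAt_id t).sub_const x₀).div_const D
    have h2 : HasDerivAt (fun t : ℝ => 1 - (t - x₀) / D) (-D⁻¹) t := by
      simpa using h1.const_sub 1
    have h3 := (((h2.pow 2).smul_const V₀).add ((h2.mul h1).smul_const V)).add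
      ((h1.pow 2).smul_const V₁)
    refine (h3.hasDerivWithinAt).congr_deriv ?_
    simp only [smul_add, smul_smul]
    congr 1
    · congr 1
      · congr 1; simp; ring
      · congr 1; ring
    · congr 1; simp; ring
  bound t ht := by
    obtain ⟨h0, h1⟩ := hs t ht
    set r := (t - x₀) / D
    have hn : ‖(-2 * (1 - r)) • V₀ + (1 - 2 * r) • V + (2 * r) • V₁‖ ≤ 1 := by
      refine (norm_add₃_le).trans ?_
      rw [norm_smul, norm_smul, norm_smul]
      simp only [Real.norm_eq_abs]
      have a0 : |-2 * (1 - r)| ≤ 2 := abs_le.2 ⟨by linarith, by linarith⟩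
      have a1 : |1 - 2 * r| ≤ 2 := abs_le.2 ⟨by linarith, by linarith⟩
      have a2 : |2 * r| ≤ 2 := abs_le.2 ⟨by linarith, by linarith⟩
      calc _ ≤ 2 * ‖V₀‖ + 2 * ‖V‖ + 2 * ‖V₁‖ := by gcongr
        _ ≤ 1 := by linarith
    rw [norm_smul, norm_inv, Real.norm_eq_abs, abs_of_pos hD]
    have : 0 < 2 / D ^ 2 := by positivity
    calc D⁻¹ * _ ≤ D⁻¹ * 1 := by gcongr
      _ ≤ B := by rw [mul_one, ← one_div]; linarith
  lipschitz x _ y _ := by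
    have e : D⁻¹ • ((-2 * (1 - (x - x₀) / D)) • V₀ + (1 - 2 * ((x - x₀) / D)) • V +
          (2 * ((x - x₀) / D)) • V₁) -
        D⁻¹ • ((-2 * (1 - (y - x₀) / D)) • V₀ + (1 - 2 * ((y - x₀) / D)) • V +
          (2 * ((y - x₀) / D)) • V₁) = (2 * (x - y) / D ^ 2) • (V₀ - V + V₁) := by
      simp only [smul_add, smul_sub, smul_smul]
      have e1 : D⁻¹ * (-2 * (1 - (x - x₀) / D)) - D⁻¹ * (-2 * (1 - (y - x₀) / D)) =
        2 * (x - y) / D ^ 2 := by field_simp; ring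
      have e2 : D⁻¹ * (1 - 2 * ((x - x₀) / D)) - D⁻¹ * (1 - 2 * ((y - x₀) / D)) =
        -(2 * (x - y) / D ^ 2) := by field_simp; ring
      have e3 : D⁻¹ * (2 * ((x - x₀) / D)) - D⁻¹ * (2 * ((y - x₀) / D)) =
        2 * (x - y) / D ^ 2 := by field_simp; ring
      rw [add_sub_add_comm, add_sub_add_comm, ← sub_smul, ← sub_smul, ← sub_smul, e1, e2, e3,
        neg_smul, ← sub_eq_add_neg]
    have hn : ‖V₀ - V + V₁‖ ≤ 1 := by
      have h1 := norm_add_le (V₀ - V) V₁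
      have h2 := norm_sub_le V₀ V
      linarith
    rw [e, norm_smul, Real.norm_eq_abs, abs_div, abs_mul, abs_two, abs_of_pos (show 0 < D ^ 2 by positivity)]
    have : 0 < 1 / D := by positivity
    calc 2 * |x - y| / D ^ 2 * ‖V₀ - V + V₁‖ ≤ 2 * |x - y| / D ^ 2 * 1 := by gcongr
      _ = 2 / D ^ 2 * |x - y| := by ring
      _ ≤ B * |x - y| := by gcongr; linarith

namespace HasBoundedDeriv

variable {F : Type*} [NormedAddCommGroup F] [NormedSpace ℝ F] {s : Set ℝ} {B : ℝ} {f f' : ℝ → F}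

lemma mono (H : HasBoundedDeriv s B f f') {B' : ℝ} (h : B ≤ B') : HasBoundedDeriv s B' f f' where
  deriv := H.deriv
  bound t ht := (H.bound t ht).trans h
  lipschitz x hx y hy := (H.lipschitz x hx y hy).trans (by gcongr)

lemma norm_sub_le (H : HasBoundedDeriv s B f f') (hs : Convex ℝ s) {x y : ℝ} (hx : x ∈ s)
    (hy : y ∈ s) : ‖f x - f y‖ ≤ B * |x - y| := by
  have := hs.norm_image_sub_le_of_norm_hasDerivWithin_le H.deriv H.bound hy hx
  rwa [Real.norm_eq_abs] at this

/-- First order Taylor expansion about a point between `x` and `y`. -/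
lemma norm_sub_sub_le {a b : ℝ} (H : HasBoundedDeriv (Icc a b) B f f') (hB : 0 ≤ B) {x y z : ℝ}
    (hx : x ∈ Icc a b) (hy : y ∈ Icc a b) (hz : z ∈ Icc x y) :
    ‖f y - f x - (y - x) • f' z‖ ≤ B * (y - x) * (y - x) := by
  have hsub : Icc x y ⊆ Icc a b := Icc_subset_Icc hx.1 hy.2
  have hxy : x ≤ y := hz.1.trans hz.2
  have := norm_sub_sub_le_of_hasDerivWithinAt (convex_Icc x y) (a := f' z) (M := B * (y - x))
    (fun t ht => (H.deriv t (hsub ht)).mono hsub) (fun t ht => ?_)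
    (left_mem_Icc.2 hxy) (right_mem_Icc.2 hxy)
  · rwa [abs_of_nonneg (sub_nonneg.2 hxy)] at this
  · refine (H.lipschitz t (hsub ht) z (hsub hz)).trans ?_
    gcongr
    exact abs_le.2 ⟨by linarith [ht.1, hz.2], by linarith [ht.2, hz.1]⟩

end HasBoundedDeriv

/-- The normal lift along a curve with bounded derivatives. -/
lemma exists_hasBoundedDeriv_normalLift (m : ℕ) {A : ℝ} (hA : 0 ≤ A) :
    ∃ B : ℝ, 0 ≤ B ∧ ∀ (s : Set ℝ) (v v' b b' : ℝ → E m), Convex ℝ s → HasBoundedDeriv s A v v' →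
      HasBoundedDeriv s A b b' → (∀ t ∈ s, ‖v t‖ ≤ 1) → (∀ t ∈ s, ‖b t‖ ≤ 1 / 2) →
      ∃ g', HasBoundedDeriv s B (fun t => normalLift (v t) (b t)) g' := by
  obtain ⟨B, hB, G, hG⟩ := exists_normalLift_deriv_bound m
  refine ⟨B * A * (1 + A), by positivity, fun s v v' b b' hs hv hb hv1 hb1 =>
    ⟨fun t => G (v t, b t) (v' t, b' t), ?_⟩⟩
  have hmem : ∀ t ∈ s, (v t, b t) ∈
      Metric.closedBall (0 : E m) 1 ×ˢ Metric.closedBall (0 : E m) (1 / 2) := fun t ht =>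
    ⟨mem_closedBall_zero_iff.2 (hv1 t ht), mem_closedBall_zero_iff.2 (hb1 t ht)⟩
  have hd : ∀ t ∈ s, ‖(v' t, b' t)‖ ≤ A := fun t ht =>
    max_le (hv.bound t ht) (hb.bound t ht)
  refine ⟨fun t ht => ?_, fun t ht => ?_, fun x hx y hy => ?_⟩
  · exact (hG _ (hmem t ht)).1.comp_hasDerivWithinAt t
      ((hv.deriv t ht).prodMk (hb.deriv t ht))
  · refine ((G (v t, b t)).le_opNorm_of_le (hd t ht)).trans ?_
    calc ‖G (v t, b t)‖ * A ≤ B * A := by gcongr; exact (hG _ (hmem t ht)).2.1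
      _ ≤ B * A * (1 + A) := le_mul_of_one_le_right (by positivity) (by linarith)
  · have e : G (v x, b x) (v' x, b' x) - G (v y, b y) (v' y, b' y) =
        G (v x, b x) ((v' x, b' x) - (v' y, b' y)) +
          (G (v x, b x) - G (v y, b y)) (v' y, b' y) := by
      rw [map_sub, _root_.sub_apply]; abel
    have h1 : ‖(v' x, b' x) - (v' y, b' y)‖ ≤ A * |x - y| :=
      max_le (hv.lipschitz x hx y hy) (hb.lipschitz x hx y hy)
    have h2 : ‖(v x, b x) - (v y, b y)‖ ≤ A * |x - y| :=
      max_le (hv.norm_sub_le hs hx hy) (hb.norm_sub_le hs hx hy)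
    have h3 : ‖G (v x, b x) - G (v y, b y)‖ ≤ B * (A * |x - y|) :=
      ((hG _ (hmem x hx)).2.2 _ (hmem y hy)).trans (by gcongr)
    rw [e]
    refine (norm_add_le _ _).trans ?_
    calc _ ≤ B * (A * |x - y|) + B * (A * |x - y|) * A := by
          refine add_le_add ?_ ?_
          · exact (ContinuousLinearMap.le_opNorm_of_le _ h1).trans
              (by gcongr; exact (hG _ (hmem x hx)).2.1)
          · exact (ContinuousLinearMap.le_opNorm_of_le _ (hd y hy)).trans (by gcongr)
      _ = B * A * (1 + A) * |x - y| := by ring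

/-! ### Curvature of sampled curves -/

section Curvature

variable {L : ℝ} {T : Partition L}

/-- Errors quadratic in two neighbouring edge lengths are quadratic in their dual length, so their
quotient by it is of first order even if the two lengths are very different. -/
lemma Partition.sq_len_add_sq_len_le (T : Partition L) {j : ℕ} (hj : j + 1 < T.n) :
    T.len j ^ 2 + T.len (j + 1) ^ 2 ≤ 4 * T.dualLen j ^ 2 := by
  have h1 := T.len_pos hj
  have h2 := T.len_pos (j.lt_succ_self.trans hj)
  unfold Partition.dualLen
  nlinarith [mul_pos h1 h2]

/-- Difference quotients of samples at the edge midpoints, up to errors of second order,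
approximate the derivative. -/
lemma norm_dualQuotient_sub_le {g g' : ℝ → E m} {B C : ℝ} (hB : 0 ≤ B) (hC : 0 ≤ C)
    (hg : HasBoundedDeriv (Icc (T.mid 0) (T.mid (T.n - 1))) B g g') {x : ℕ → E m}
    (hx : ∀ k < T.n, ‖x k - g (T.mid k)‖ ≤ C * T.len k ^ 2) {j : ℕ} (hj : j + 1 < T.n) {z : ℝ}
    (hz : z ∈ Icc (T.mid j) (T.mid (j + 1))) :
    ‖(T.dualLen j)⁻¹ • (x (j + 1) - x j) - g' z‖ ≤ (B + 4 * C) * T.dualLen j := by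
  have hD := T.dualLen_pos hj
  have hmem : ∀ k < T.n, T.mid k ∈ Icc (T.mid 0) (T.mid (T.n - 1)) := fun k hk =>
    ⟨T.mid_le k.zero_le hk, T.mid_le (by omega) (by omega)⟩
  have h1 := hg.norm_sub_sub_le hB (hmem j (by omega)) (hmem _ hj) hz
  rw [T.mid_succ_sub] at h1
  have h2 := hx j (by omega)
  have h3 := hx (j + 1) hj
  have h4 := mul_le_mul_of_nonneg_left (T.sq_len_add_sq_len_le hj) hC
  have e : (T.dualLen j)⁻¹ • (x (j + 1) - x j) - g' z = (T.dualLen j)⁻¹ •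
      ((x (j + 1) - g (T.mid (j + 1))) - (x j - g (T.mid j)) +
        (g (T.mid (j + 1)) - g (T.mid j) - T.dualLen j • g' z)) := by
    have e₀ : (x (j + 1) - g (T.mid (j + 1))) - (x j - g (T.mid j)) +
        (g (T.mid (j + 1)) - g (T.mid j) - T.dualLen j • g' z) =
          (x (j + 1) - x j) - T.dualLen j • g' z := by abel
    rw [e₀, smul_sub _ (x (j + 1) - x j), inv_smul_smul₀ hD.ne']
  rw [e, norm_smul, norm_inv, Real.norm_eq_abs, abs_of_pos hD, inv_mul_le_iff₀ hD]
  refine (norm_add_le _ _).trans ?_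
  have h5 := norm_sub_le (x (j + 1) - g (T.mid (j + 1))) (x j - g (T.mid j))
  nlinarith

/-- Successive curvature vectors are both compared with g' at the midpoint of the edge they share,
which bounds their jump by C times the sum of the two dual lengths. Summation over the interior
edges contributes at most 2 C L, and the maximum of the curvature at most B + C. -/
lemma discretePriors_of_dualQuotient {d : ClampedData m} {T : Partition d.L} {Q : Polygon m}
    (hQ : Q ∈ discreteFeasible d T) {g' : ℝ → E m} {B C : ℝ} (hB : 0 ≤ B) (hC : 0 ≤ C)
    (hmesh : T.mesh ≤ 1)
    (hg' : ∀ t ∈ Icc (T.mid 0) (T.mid (T.n - 1)), ‖g' t‖ ≤ B)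
    (h : ∀ j, j + 1 < T.n → ∀ z ∈ Icc (T.mid j) (T.mid (j + 1)),
      ‖(T.dualLen j)⁻¹ • (edgeTangent Q (j + 1) - edgeTangent Q j) - g' z‖ ≤ C * T.dualLen j)
    {K : ℝ} (hK : B + C + 2 * (C * d.L) ≤ K) : Q ∈ discretePriors d T K := by
  have hL := d.L_pos
  have hκ : ∀ j, j + 1 < T.n → ∀ z ∈ Icc (T.mid j) (T.mid (j + 1)),
      ‖discreteCurvature Q j - g' z‖ ≤ C * T.dualLen j := fun j hj z hz => by
    rw [discreteCurvature_eq hQ hj]; exact h j hj z hz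
  refine ⟨hQ, ?_, ?_⟩
  · have hB0 : 0 ≤ B + C := by positivity
    have : discreteSecondSup T Q ≤ (B + C).toNNReal := Finset.sup_le fun j hj => by
      have hj' : j + 1 < T.n := by have := Finset.mem_range.1 hj; omega
      rw [← NNReal.coe_le_coe, Real.coe_toNNReal _ hB0, coe_nnnorm]
      have h1 := hκ j hj' (T.mid j) (left_mem_Icc.2 (T.mid_le j.le_succ hj'))
      have h2 := hg' (T.mid j) ⟨T.mid_le j.zero_le (by omega), T.mid_le (by omega) (by omega)⟩
      have h3 := norm_le_norm_add_norm_sub' (discreteCurvature Q j) (g' (T.mid j))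
      have h4 : C * T.dualLen j ≤ C * 1 := by
        gcongr
        exact (T.dualLen_le_mesh hj').trans hmesh
      linarith
    have h5 : (discreteSecondSup T Q : ℝ) ≤ B + C := by
      rw [← Real.coe_toNNReal _ hB0]; exact_mod_cast this
    have : 0 ≤ C * d.L := by positivity
    linarith
  · have hterm : ∀ j ∈ Finset.range (T.n - 2),
        ‖(edgeLen Q (j + 1))⁻¹ • (discreteCurvature Q (j + 1) - discreteCurvature Q j)‖ *
          edgeLen Q (j + 1) ≤ C * (T.dualLen j + T.dualLen (j + 1)) := fun j hj => by
      have hj' : j + 1 + 1 < T.n := by have := Finset.mem_range.1 hj; omega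
      have hp : 0 < edgeLen Q (j + 1) := by
        rw [edgeLen_eq_len hQ (by omega)]; exact T.len_pos (by omega)
      rw [norm_smul, norm_inv, Real.norm_eq_abs, abs_of_pos hp, mul_comm, mul_inv_cancel_left₀ hp.ne']
      have h1 := hκ j (by omega) (T.mid (j + 1)) (right_mem_Icc.2 (T.mid_le j.le_succ (by omega)))
      have h2 := hκ (j + 1) hj' (T.mid (j + 1))
        (left_mem_Icc.2 (T.mid_le (j + 1).le_succ hj'))
      have h3 := norm_sub_le_norm_sub_add_norm_sub (discreteCurvature Q (j + 1)) (g' (T.mid (j + 1)))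
        (discreteCurvature Q j)
      rw [norm_sub_rev (g' _)] at h3
      linarith
    refine (Finset.sum_le_sum hterm).trans ?_
    rw [← Finset.mul_sum, Finset.sum_add_distrib]
    -- The sum telescopes over midpoints; f is used for the identity and for the shift by one.
    have hsum : ∀ f : ℕ → ℕ, (∀ j, f j + 1 = f (j + 1)) → f (T.n - 2) + 1 ≤ T.n →
        ∑ j ∈ Finset.range (T.n - 2), T.dualLen (f j) ≤ d.L := fun f hf hfn => by
      have e : ∀ j, T.dualLen (f j) = T.mid (f (j + 1)) - T.mid (f j) := fun j => by
        rw [← hf, T.mid_succ_sub]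
      simp only [e]
      rw [Finset.sum_range_sub (fun j => T.mid (f j))]
      have hle : f 0 ≤ f (T.n - 2) := monotone_nat_of_le_succ (fun j => by rw [← hf]; omega)
        (Nat.zero_le _)
      have h1 := (T.mid_mem (show f (T.n - 2) < T.n by omega)).2
      have h2 := (T.mid_mem (show f 0 < T.n by omega)).1
      linarith
    rcases Nat.lt_or_ge T.n 2 with hn | hn
    · rw [show T.n - 2 = 0 by omega]
      simp only [Finset.range_zero, Finset.sum_empty, add_zero, mul_zero]
      exact le_trans (by positivity) hK
    have h1 := hsum (fun j => j) (fun _ => rfl) (by omega)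
    have h2 := hsum (fun j => j + 1) (fun _ => rfl) (by omega)
    have h3 : C * (∑ j ∈ Finset.range (T.n - 2), T.dualLen j +
        ∑ j ∈ Finset.range (T.n - 2), T.dualLen (j + 1)) ≤ C * (d.L + d.L) := by gcongr
    linarith

/-- Polygons whose edge vectors are restored from chord tangents satisfy uniform a priori bounds. -/
lemma exists_restoredEdge_bound (m : ℕ) {L M : ℝ} (hL : 0 < L) (hM : 0 ≤ M) :
    ∃ B : ℝ, 0 ≤ B ∧ ∀ (T : Partition L), 2 ≤ T.n → T.mesh ≤ L / 2 →
      ∀ (γ a : ℝ → E m), RegularCurve L M γ a → ∀ χ : ℕ → E m, (∀ k < T.n, ‖χ k‖ = 1 ∧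
        ‖χ k - velocity L γ (T.mid k)‖ ≤ 2 * (M * T.len k ^ 2)) →
      ∀ V₀ V V₁ : E m, ‖V₀‖ + ‖V‖ + ‖V₁‖ ≤ 1 / 2 → ∃ g' : ℝ → E m,
        (∀ t ∈ Icc (T.mid 0) (T.mid (T.n - 1)), ‖g' t‖ ≤ B) ∧
        ∀ j, j + 1 < T.n → ∀ z ∈ Icc (T.mid j) (T.mid (j + 1)),
          ‖(T.dualLen j)⁻¹ • (restoredEdge T χ V₀ V V₁ (j + 1) - restoredEdge T χ V₀ V V₁ j) -
            g' z‖ ≤ B * T.dualLen j := by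
  -- One bound A serves both the velocity (M) and the blend, whose parameter interval has length at
  -- least L / 2.
  obtain ⟨B, hB, key⟩ := exists_hasBoundedDeriv_normalLift m
    (A := M + (2 / L + 8 / L ^ 2)) (by positivity)
  -- Replacing the velocity by χ inside the lift costs 7 M times the squared edge length: 2 M from χ
  -- itself and 5 * (1 / 2) * 2 M from the dependence of the correction on the tangent.
  refine ⟨B + 4 * (7 * M), by positivity, fun T hn hmesh γ a H χ hχ V₀ V V₁ hV => ?_⟩
  have hD := T.mid_last_sub_pos hn
  have hDL : L / 2 ≤ T.mid (T.n - 1) - T.mid 0 := by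
    have h1 := T.len_le_mesh T.n_pos
    have h2 := T.len_le_mesh (show T.n - 1 < T.n by omega)
    rw [T.mid_last, T.mid_zero]; linarith
  set D := T.mid (T.n - 1) - T.mid 0 with hDdef
  set I := Icc (T.mid 0) (T.mid (T.n - 1)) with hI
  have hIL : I ⊆ Icc 0 L := Icc_subset_Icc (T.mid_mem T.n_pos).1 (T.mid_mem (by omega)).2
  have hσ : ∀ t ∈ I, (t - T.mid 0) / D ∈ Icc (0 : ℝ) 1 := fun t ht =>
    ⟨div_nonneg (by linarith [ht.1]) hD.le, (div_le_one hD).2 (by linarith [ht.2])⟩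
  have hDB : 1 / D + 2 / D ^ 2 ≤ 2 / L + 8 / L ^ 2 := by
    have h1 : 1 / D ≤ 1 / (L / 2) := by gcongr
    have h2 : 2 / D ^ 2 ≤ 2 / (L / 2) ^ 2 := by gcongr
    have e1 : 1 / (L / 2) = 2 / L := by field_simp
    have e2 : 2 / (L / 2) ^ 2 = 8 / L ^ 2 := by field_simp; norm_num
    linarith
  have hb := hasBoundedDeriv_blend hD hσ hV hDB
  have hbn : ∀ t ∈ I, ‖blend ((t - T.mid 0) / D) V₀ V V₁‖ ≤ 1 / 2 := fun t ht =>
    (norm_blend_le (hσ t ht) V₀ V V₁).trans hV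
  have hpos : 0 < 2 / L + 8 / L ^ 2 := by positivity
  obtain ⟨g', hg⟩ := key I _ _ _ _ (convex_Icc _ _) ((H.hasBoundedDeriv hIL).mono (by linarith))
    (hb.mono (by linarith)) (fun t ht => (H.norm_velocity t (hIL ht)).le) hbn
  refine ⟨g', fun t ht => (hg.bound t ht).trans (by linarith), fun j hj z hz =>
    norm_dualQuotient_sub_le hB (by positivity) hg (fun k hk => ?_) hj hz⟩
  obtain ⟨h1, h2⟩ := hχ k hk
  have hkI : T.mid k ∈ I := ⟨T.mid_le k.zero_le hk, T.mid_le (by omega) (by omega)⟩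
  have h3 := norm_normalLift_sub_self_sub_le h1 (H.norm_velocity _ (T.mid_mem hk)) (hbn _ hkI)
    (hbn _ hkI)
  rw [sub_self, norm_zero, mul_zero, zero_add] at h3
  have h4 : 5 * ‖blend ((T.mid k - T.mid 0) / D) V₀ V V₁‖ * ‖χ k - velocity L γ (T.mid k)‖ ≤
      5 * (1 / 2) * (2 * (M * T.len k ^ 2)) := by gcongr; exact hbn _ hkI
  set x := normalLift (χ k) (blend ((T.mid k - T.mid 0) / D) V₀ V V₁) with hx
  set y := normalLift (velocity L γ (T.mid k)) (blend ((T.mid k - T.mid 0) / D) V₀ V V₁) with hy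
  have h5 := norm_add_le (x - χ k - (y - velocity L γ (T.mid k))) (χ k - velocity L γ (T.mid k))
  rw [show x - χ k - (y - velocity L γ (T.mid k)) + (χ k - velocity L γ (T.mid k)) = x - y by abel]
    at h5
  change ‖x - y‖ ≤ _
  linarith

/-- The curvature of the restored polygon is close to the second derivative of the curve. -/
lemma norm_dualQuotient_restoredEdge_sub_le {M R : ℝ} (hL : 0 < L) (hM : 0 ≤ M) (hn : 2 ≤ T.n)
    (hmesh : T.mesh ≤ L / 2) (hmesh1 : T.mesh ≤ 1) {γ a : ℝ → E m} (H : RegularCurve L M γ a)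
    {χ : ℕ → E m} (hχ : ∀ k < T.n, ‖χ k‖ = 1 ∧
      ‖χ k - velocity L γ (T.mid k)‖ ≤ 2 * (M * T.len k ^ 2))
    {V₀ V V₁ : E m} (hV : ‖V₀‖ + ‖V‖ + ‖V₁‖ ≤ R) (hR : R ≤ 1 / 2) {j : ℕ} (hj : j + 1 < T.n) :
    ‖(T.dualLen j)⁻¹ • (restoredEdge T χ V₀ V V₁ (j + 1) - restoredEdge T χ V₀ V V₁ j) -
      a (T.mid j)‖ ≤ 9 * M * T.mesh + (8 / L + 50 * M) * R := by
  have hD := T.dualLen_pos hj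
  have hDm := T.dualLen_le_mesh hj
  have hR0 : 0 ≤ R := le_trans (by positivity) hV
  have hIL : Icc (T.mid 0) (T.mid (T.n - 1)) ⊆ Icc 0 L :=
    Icc_subset_Icc (T.mid_mem T.n_pos).1 (T.mid_mem (by omega)).2
  have hmid := T.mid_le j.le_succ hj
  have h1 := norm_dualQuotient_sub_le (T := T) hM (show 0 ≤ 2 * M by positivity)
    (H.hasBoundedDeriv hIL) (fun k hk => (hχ k hk).2.trans_eq (by ring)) hj (left_mem_Icc.2 hmid)
  have h2 : ‖χ (j + 1) - χ j‖ ≤ 10 * M * T.dualLen j := by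
    have h3 := norm_le_norm_add_norm_sub' ((T.dualLen j)⁻¹ • (χ (j + 1) - χ j)) (a (T.mid j))
    have h4 := H.norm_accel _ (T.mid_mem (show j < T.n by omega))
    have h5 : (M + 4 * (2 * M)) * T.dualLen j ≤ (M + 4 * (2 * M)) * 1 := by gcongr; linarith
    have h6 : ‖(T.dualLen j)⁻¹ • (χ (j + 1) - χ j)‖ ≤ 10 * M := by linarith
    rwa [norm_smul, norm_inv, Real.norm_eq_abs, abs_of_pos hD, inv_mul_le_iff₀ hD, mul_comm] at h6
  have hb : ∀ k < T.n, ‖blend (T.param k) V₀ V V₁‖ ≤ R := fun k hk =>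
    (norm_blend_le (T.param_mem hn hk) V₀ V V₁).trans hV
  have h3 := norm_normalLift_sub_self_sub_le (hχ _ hj).1 (hχ j (by omega)).1
    ((hb _ hj).trans hR) ((hb j (by omega)).trans hR)
  have h4 := norm_blend_sub_blend_le (T.param_mem hn hj) (T.param_mem hn (show j < T.n by omega))
    V₀ V V₁
  have h5 : |T.param (j + 1) - T.param j| ≤ 2 / L * T.dualLen j := by
    have hDL : L / 2 ≤ T.mid (T.n - 1) - T.mid 0 := by
      have h1 := T.len_le_mesh T.n_pos
      have h2 := T.len_le_mesh (show T.n - 1 < T.n by omega)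
      rw [T.mid_last, T.mid_zero]; linarith
    have hD' := T.mid_last_sub_pos hn
    rw [Partition.param, Partition.param, ← sub_div, sub_sub_sub_cancel_right, T.mid_succ_sub,
      abs_div, abs_of_pos hD, abs_of_pos hD']
    calc T.dualLen j / (T.mid (T.n - 1) - T.mid 0) ≤ T.dualLen j / (L / 2) := by gcongr
      _ = 2 / L * T.dualLen j := by field_simp
  set x := restoredEdge T χ V₀ V V₁ with hx
  -- The correction varies from edge to edge for two reasons, the change of the parameter (8 / L)
  -- and the turning of χ (50 M = 5 * 10 M); both effects are proportional to R.
  have h6 : ‖(x (j + 1) - χ (j + 1)) - (x j - χ j)‖ ≤ T.dualLen j * ((8 / L + 50 * M) * R) := by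
    refine h3.trans ?_
    calc _ ≤ 2 * (2 * R * (2 / L * T.dualLen j)) + 5 * R * (10 * M * T.dualLen j) := by
          refine add_le_add (mul_le_mul_of_nonneg_left (h4.trans ?_) zero_le_two) ?_
          · gcongr
          · gcongr
            exact hb _ hj
      _ = _ := by ring
  have e : (T.dualLen j)⁻¹ • (x (j + 1) - x j) - a (T.mid j) =
      (T.dualLen j)⁻¹ • ((x (j + 1) - χ (j + 1)) - (x j - χ j)) +
        ((T.dualLen j)⁻¹ • (χ (j + 1) - χ j) - a (T.mid j)) := by
    rw [add_sub, ← smul_add]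
    congr 2
    abel
  rw [e]
  refine (norm_add_le _ _).trans ?_
  rw [norm_smul, norm_inv, Real.norm_eq_abs, abs_of_pos hD]
  have h7 : (T.dualLen j)⁻¹ * ‖(x (j + 1) - χ (j + 1)) - (x j - χ j)‖ ≤ (8 / L + 50 * M) * R :=
    (inv_mul_le_iff₀ hD).2 h6
  have h8 : (M + 4 * (2 * M)) * T.dualLen j ≤ (M + 4 * (2 * M)) * T.mesh := by gcongr
  linarith

end Curvature

/-! ### Proximity -/

lemma Partition.exists_mem_edge {L : ℝ} (T : Partition L) {t : ℝ} (ht : t ∈ Icc 0 L) :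
    ∃ k < T.n, t ∈ Icc (T.t k) (T.t (k + 1)) := by
  have h : ∀ i, 0 < i → t ≤ T.t i → ∃ k < i, t ∈ Icc (T.t k) (T.t (k + 1)) := by
    intro i
    induction i with
    | zero => intro h; exact absurd h (lt_irrefl 0)
    | succ i ih =>
      intro _ hi
      rcases le_total (T.t i) t with h1 | h1
      · exact ⟨i, i.lt_succ_self, h1, hi⟩
      · rcases Nat.eq_zero_or_pos i with rfl | h0
        · exact ⟨0, Nat.zero_lt_one, by rw [T.t_zero]; exact ht.1, hi⟩
        · obtain ⟨k, hk, hkt⟩ := ih h0 h1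
          exact ⟨k, hk.trans i.lt_succ_self, hkt⟩
  exact h T.n T.n_pos (by rw [T.t_last]; exact ht.2)

/-- All differences between γ and δ are routed through the polygon P: from γ to its chords, then to
the restored edges, to the indicatrix and to the restored tangent. Each passage costs O(h) in the
tangent, and the corresponding comparisons of accelerations and discrete curvatures cost O(h) as
well. -/
lemma exists_sobolevNorm_sub_le {L : ℝ} (hL : 0 < L) {M K C₁ C₂ : ℝ} (hM : 0 ≤ M)
    (hC₁ : 0 ≤ C₁) (hC₂ : 0 ≤ C₂) :
    ∃ C : ℝ, 0 ≤ C ∧ ∀ (T : Partition L), T.mesh ≤ L / 2 → T.mesh ≤ 1 →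
      ∀ (γ a δ : ℝ → E m), RegularCurve L M γ a → ∀ χ : ℕ → E m, (∀ k < T.n, ‖χ k‖ = 1 ∧
        ‖χ k - velocity L γ (T.mid k)‖ ≤ 2 * (M * T.len k ^ 2)) →
      ∀ V₀ V V₁ : E m, ‖V₀‖ + ‖V‖ + ‖V₁‖ ≤ C₁ * T.mesh → ‖V₀‖ + ‖V‖ + ‖V₁‖ ≤ 1 / 2 →
      ∀ W₀ W W₁ : E m, ‖W₀‖ + ‖W‖ + ‖W₁‖ ≤ C₂ * T.mesh → ‖W₀‖ + ‖W‖ + ‖W₁‖ ≤ 1 / 2 →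
      ∀ P : Polygon m, TurningBound T P K →
        (∀ k < T.n, edgeTangent P k = restoredEdge T χ V₀ V V₁ k) →
        (∀ t ∈ Icc 0 L,
          δ t = integralCurve (γ 0) (restoredTangent L (indicatrix T P) W₀ W W₁) t) →
        sobolevNorm L 2 ∞ (fun t => γ t - δ t) ≤ ENNReal.ofReal (C * T.mesh) := by
  -- For negative K no polygon satisfies `TurningBound`.
  rcases lt_or_ge K 0 with hK | hK
  · exact ⟨0, le_rfl, fun T _ _ _ _ _ _ _ _ _ _ _ _ _ _ _ _ _ _ _ H => absurd H.nonneg hK.not_ge⟩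
  set A₁ := 2 * C₂ + K + 2 * C₁ + 3 * M with hA₁
  set A₂ := 9 * M + (8 / L + 50 * M) * C₁ + 2 * M + 8 * K ^ 2 + (4 / L + 10 * K) * C₂ with hA₂
  have hA₁0 : 0 ≤ A₁ := by positivity
  have hA₂0 : 0 ≤ A₂ := by positivity
  refine ⟨3 * (A₁ + A₁ * L + A₂), by positivity, ?_⟩
  intro T hmesh hmesh1 γ a δ H χ hχ V₀ V V₁ hV hV2 W₀ W W₁ hW hW2 P hP hedge hδ
  have hn := hP.two_le
  have hh := T.mesh_pos
  set τ := indicatrix T P with hτ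
  set f := restoredTangent L τ W₀ W W₁ with hf
  set S := ‖W₀‖ + ‖W‖ + ‖W₁‖ with hS
  have hS0 : 0 ≤ S := by positivity
  set R := ‖V₀‖ + ‖V‖ + ‖V₁‖ with hR
  have hR0 : 0 ≤ R := by positivity
  have hτ1 : ∀ t ∈ Icc 0 L, ‖τ t‖ = 1 := fun t _ => hP.norm_indicatrix t
  have hτc : ContinuousOn τ (Icc 0 L) := hP.continuous_indicatrix.continuousOn
  have hfc : ContinuousOn f (Icc 0 L) := continuousOn_restoredTangent hτc _ _ _
  have hδd : ∀ t ∈ Icc 0 L, HasDerivWithinAt δ (f t) (Icc 0 L) t := fun t ht =>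
    (hasDerivWithinAt_integralCurve hfc ht).congr hδ (hδ t ht)
  have hud : ∀ t ∈ Icc 0 L,
      HasDerivWithinAt (fun t => γ t - δ t) (velocity L γ t - f t) (Icc 0 L) t := fun t ht =>
    (H.deriv t ht).fun_sub (hδd t ht)
  have hb : ∀ k < T.n, ‖blend (T.param k) V₀ V V₁‖ ≤ R := fun k hk =>
    norm_blend_le (T.param_mem hn hk) V₀ V V₁
  have h1 : ∀ t ∈ Icc 0 L, ‖velocity L γ t - f t‖ ≤ A₁ * T.mesh := by
    intro t ht
    obtain ⟨k, hk, hkt⟩ := T.exists_mem_edge ht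
    have b1 := norm_restoredTangent_sub_self_le hL le_rfl hW2 hτ1 ht
    have b2 := hP.norm_indicatrix_sub_edgeTangent_le hk hkt
    have b3 := norm_normalLift_sub_self_le (hχ k hk).1 ((hb k hk).trans hV2)
    rw [← restoredEdge, ← hedge k hk] at b3
    have b4 := (hχ k hk).2
    have b5 := H.norm_velocity_sub_le (T.mid_mem hk) ht
    have b6 := hb k hk
    have b7 := T.len_le_mesh hk
    have b8 := T.len_pos hk
    have b9 : M * T.len k ^ 2 ≤ M * T.mesh := by
      gcongr
      nlinarith
    have b10 : M * |T.mid k - t| ≤ M * T.mesh := by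
      rw [abs_sub_comm]
      have := T.abs_sub_mid_le hkt
      gcongr
      linarith
    have e : velocity L γ t - f t = -((f t - τ t) + (τ t - edgeTangent P k) +
        (edgeTangent P k - χ k) + (χ k - velocity L γ (T.mid k)) +
          (velocity L γ (T.mid k) - velocity L γ t)) := by abel
    rw [e, norm_neg]
    refine (norm_add_le_of_le (norm_add_le_of_le (norm_add_le_of_le (norm_add_le_of_le b1 b2) b3)
      b4) b5).trans ?_
    rw [hA₁]
    linarith
  -- The correction f - τ is differentiated separately: its Lipschitz constant is proportional to S
  -- = O(h), whereas τ itself only has bounded derivative.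
  have hφ : ∀ x ∈ Icc 0 L, ∀ y ∈ Icc 0 L,
      ‖(f x - τ x) - (f y - τ y)‖ ≤ (4 / L + 10 * K) * S * |x - y| := by
    intro x hx y hy
    have b1 := restoredTangent_sub_sub_le hL le_rfl hW2 hτ1 hx hy
    have b2 : 5 * S * ‖τ x - τ y‖ ≤ 5 * S * (2 * K * |x - y|) := by
      gcongr
      exact hP.norm_indicatrix_sub_le x y
    refine (b1.trans (add_le_add_right b2 _)).trans_eq ?_
    ring
  refine (sobolevNorm_two_le (K := M + 2 * K + (4 / L + 10 * K) * S)
    (A := (A₁ + A₁ * L + A₂) * T.mesh) hL (by positivity) (by positivity) hud ?_ ?_ ?_ ?_).trans_eq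
    (by rw [mul_assoc])
  · intro x hx y hy
    have e : velocity L γ x - f x - (velocity L γ y - f y) =
        (velocity L γ x - velocity L γ y) - (τ x - τ y) - ((f x - τ x) - (f y - τ y)) := by abel
    rw [e]
    have b1 := H.norm_velocity_sub_le hx hy
    have b2 := hP.norm_indicatrix_sub_le x y
    refine (norm_sub_le_of_le (norm_sub_le_of_le b1 b2) (hφ x hx y hy)).trans_eq ?_
    ring
  · intro t ht
    have m0 : (0 : ℝ) ∈ Icc 0 L := ⟨le_rfl, hL.le⟩
    have b1 := (convex_Icc 0 L).norm_image_sub_le_of_norm_hasDerivWithin_le hud h1 m0 ht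
    have e : γ 0 - δ 0 = 0 := by rw [hδ 0 m0]; simp [integralCurve]
    rw [e, sub_zero, sub_zero, Real.norm_eq_abs, abs_of_nonneg ht.1] at b1
    have b2 : A₁ * T.mesh * t ≤ A₁ * T.mesh * L := by gcongr; exact ht.2
    have b3 : 0 ≤ (A₁ + A₂) * T.mesh := by positivity
    linarith
  · intro t ht
    have b1 := h1 t ht
    have b3 : 0 ≤ (A₁ * L + A₂) * T.mesh := by positivity
    linarith
  -- The indicatrix may have corners at the midpoints, a finite set that is irrelevant for the
  -- essential supremum.
  · have hnull : ∀ᵐ t : ℝ, t ∉ ((Finset.range T.n).image T.mid : Finset ℝ) :=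
      ((Finset.range T.n).image T.mid).countable_toSet.ae_notMem volume
    filter_upwards [hnull, ae_hasDerivAt_deriv_of_lipschitz (by positivity) hφ,
      ae_Icc_of_forall_Ioo (L := L) (q := fun t => t ∈ Ioo 0 L) fun t ht => ht]
      with t ht0 htφ htI ht
    obtain ⟨hφd, hφn⟩ := htφ ht
    obtain ⟨k, v, hk, hv, hkt, hvk⟩ := hP.exists_hasDerivAt_indicatrix ht fun k hk h =>
      ht0 (Finset.mem_image.2 ⟨k, Finset.mem_range.2 hk, h.symm⟩)
    have hvel := (H.deriv_velocity t ht).hasDerivAt (Icc_mem_nhds (htI ht).1 (htI ht).2)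
    have hw : HasDerivAt (fun t => velocity L γ t - f t)
        (a t - v - deriv (fun t => f t - τ t) t) t := by
      refine ((hvel.fun_sub hv).fun_sub hφd).congr_of_eventuallyEq
        (Filter.Eventually.of_forall fun s => ?_)
      simp only [← hτ]
      abel
    rw [hw.deriv]
    have b1 := norm_dualQuotient_restoredEdge_sub_le hL hM hn hmesh hmesh1 H hχ le_rfl hV2 hk
    rw [← hedge _ hk, ← hedge k (by omega)] at b1
    have b2 := H.lipschitz_accel t ht _ (T.mid_mem (show k < T.n by omega))
    have b3 : M * |t - T.mid k| ≤ M * (2 * T.mesh) := by gcongr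
    rw [norm_sub_rev] at b1 hvk
    -- The second derivative of the error splits into the variation of γ'' near the midpoint, its
    -- distance from the curvature vector of P, the distance of that vector from the indicatrix
    -- derivative, and the derivative of the correction.
    have e : a t - v - deriv (fun t => f t - τ t) t = (a t - a (T.mid k)) +
        (a (T.mid k) - (T.dualLen k)⁻¹ • (edgeTangent P (k + 1) - edgeTangent P k)) +
        ((T.dualLen k)⁻¹ • (edgeTangent P (k + 1) - edgeTangent P k) - v) -
          deriv (fun t => f t - τ t) t := by abel
    rw [e]
    refine (norm_sub_le_of_le (norm_add_le_of_le (norm_add_le_of_le (b2.trans b3) b1) hvk)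
      hφn).trans ?_
    have b4 : (8 / L + 50 * M) * R ≤ (8 / L + 50 * M) * (C₁ * T.mesh) := by gcongr
    have b5 : (4 / L + 10 * K) * S ≤ (4 / L + 10 * K) * (C₂ * T.mesh) := by gcongr
    have b6 : 0 ≤ (A₁ + A₁ * L) * T.mesh := by positivity
    rw [add_mul _ A₂, hA₂]
    linarith

end Elastica

end

/-! ### Choice of the constants and assembly of the theorem -/

theorem mainTheorem6 {m : ℕ} (d : Elastica.ClampedData m) (hd : ‖d.q1 - d.q0‖ < d.L)
    (p : ℝ≥0∞) (hp : 2 ≤ p) (K₁ : ℝ) (hK₁ : 0 ≤ K₁) :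
    ∃ K₀ : ℝ, 0 ≤ K₀ ∧ ∀ K₂ : ℝ, K₀ ≤ K₂ →
      ∃ ρ : ℝ, 0 < ρ ∧ ∃ h₀ : ℝ, 0 < h₀ ∧ ∃ C : ℝ, 0 ≤ C ∧
        ∀ T : Elastica.Partition d.L, T.mesh ≤ h₀ →
          -- the sampling operator is well defined and maps `priors` into `discretePriors`
          (∀ γ ∈ Elastica.priors d p K₁,
            (∃ Q, Elastica.IsDiscreteRestoration d T ρ (Elastica.approxSample T γ) Q) ∧
            (∀ Q Q' : Elastica.Polygon m,
              Elastica.IsDiscreteRestoration d T ρ (Elastica.approxSample T γ) Q →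
              Elastica.IsDiscreteRestoration d T ρ (Elastica.approxSample T γ) Q' →
              ∀ i ≤ T.n, Q i = Q' i) ∧
            Elastica.sample d ρ T γ ∈ Elastica.discretePriors d T K₂) ∧
          -- the reconstruction operator is well defined and maps `discretePriors` into `feasible`
          (∀ P ∈ Elastica.discretePriors d T K₂,
            (∃ δ, Elastica.IsRestoration d p ρ (Elastica.approxReconstruct d T P) δ) ∧
            (∀ δ δ' : ℝ → Elastica.E m,
              Elastica.IsRestoration d p ρ (Elastica.approxReconstruct d T P) δ →
              Elastica.IsRestoration d p ρ (Elastica.approxReconstruct d T P) δ' →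
              ∀ t ∈ Set.Icc 0 d.L, δ t = δ' t) ∧
            Elastica.reconstruct d p ρ T P ∈ Elastica.feasible d p) ∧
          -- proximity
          ∀ γ ∈ Elastica.priors d p K₁,
            Elastica.sobolevNorm d.L 2 ∞
              (fun t => γ t - Elastica.reconstruct d p ρ T (Elastica.sample d ρ T γ) t) ≤
            ENNReal.ofReal (C * T.mesh) := by
  have hL := d.L_pos
  have hM : (0 : ℝ) ≤ K₁ + 1 := by linarith
  obtain ⟨ρS, hρS, C₁, hC₁, hS⟩ := Elastica.exists_sampling_bounds d hd p hK₁
  obtain ⟨B, hB, hBound⟩ := Elastica.exists_restoredEdge_bound m hL hM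
  -- This is the bound of `discretePriors_of_dualQuotient` with C = B. It involves only m, L and K₁,
  -- as the blending vectors enter B merely through the bound 1 / 2.
  refine ⟨B + B + 2 * (B * d.L), by positivity, fun K₂ hK₂ => ?_⟩
  have hK₂0 : 0 ≤ K₂ := le_trans (by positivity) hK₂
  obtain ⟨ρR, hρR, C₂, hC₂, hR⟩ := Elastica.exists_reconstruction_bounds d hd p hK₂0
  obtain ⟨C, hC, hprox⟩ := Elastica.exists_sobolevNorm_sub_le (m := m) (K := K₂) hL hM hC₁ hC₂
  -- Both constructions accept any smaller ρ at the price of a smaller mesh threshold, and their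
  -- constants C₁ and C₂ do not depend on ρ. A common ρ can therefore be fixed now, and the
  -- thresholds after it.
  have hρ : 0 < min ρS ρR := lt_min hρS hρR
  obtain ⟨hs, hs0, hS⟩ := hS _ hρ (min_le_left _ _)
  obtain ⟨hr, hr0, hR⟩ := hR _ hρ (min_le_right _ _)
  refine ⟨min ρS ρR, hρ, min (min hs hr) (d.L / 2), by positivity, C, hC, fun T hT => ?_⟩
  obtain ⟨hn, hT1, hS⟩ := hS T (hT.trans ((min_le_left _ _).trans (min_le_left _ _)))
  replace hR := hR T (hT.trans ((min_le_left _ _).trans (min_le_right _ _)))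
  have hTL : T.mesh ≤ d.L / 2 := hT.trans (min_le_right _ _)
  set ρ := min ρS ρR
  have hsample : ∀ γ ∈ Elastica.priors d p K₁, Elastica.IsDiscreteRestoration d T ρ
      (Elastica.approxSample T γ) (Elastica.sample d ρ T γ) := fun γ hγ => by
    have hex := (hS γ hγ).2.2.1
    rw [Elastica.sample, Elastica.discreteRestore, dif_pos hex]
    exact hex.choose_spec
  have hreconstruct : ∀ P ∈ Elastica.discretePriors d T K₂, Elastica.IsRestoration d p ρ
      (Elastica.approxReconstruct d T P) (Elastica.reconstruct d p ρ T P) := fun P hP => by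
    have hex := (hR P hP).2.1
    rw [Elastica.reconstruct, Elastica.restore, dif_pos hex]
    exact hex.choose_spec
  have hpriors : ∀ γ ∈ Elastica.priors d p K₁,
      Elastica.sample d ρ T γ ∈ Elastica.discretePriors d T K₂ := fun γ hγ => by
    obtain ⟨⟨a, hreg⟩, hχ, -, -, V₀, V, V₁, -, hV, hform⟩ := hS γ hγ
    obtain ⟨hfeas, hedge⟩ := hform _ (hsample γ hγ)
    obtain ⟨g', hg', hquot⟩ := hBound T hn hTL γ a hreg _ hχ V₀ V V₁ hV
    refine Elastica.discretePriors_of_dualQuotient hfeas hB hB hT1 hg' (fun j hj z hz => ?_) hK₂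
    rw [hedge _ hj, hedge j (by omega)]
    exact hquot j hj z hz
  refine ⟨fun γ hγ => ?_, fun P hP => ?_, fun γ hγ => ?_⟩
  · obtain ⟨-, -, hex, huniq, -⟩ := hS γ hγ
    exact ⟨hex, huniq, hpriors γ hγ⟩
  · obtain ⟨-, hex, huniq, -⟩ := hR P hP
    exact ⟨hex, huniq, (hreconstruct P hP).feasible⟩
  · obtain ⟨⟨a, hreg⟩, hχ, -, -, V₀, V, V₁, hV, hV2, hform⟩ := hS γ hγ
    obtain ⟨-, hedge⟩ := hform _ (hsample γ hγ)
    obtain ⟨hturn, -, -, W₀, W, W₁, hW, hW2, hδ⟩ := hR _ (hpriors γ hγ)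
    refine hprox T hTL hT1 γ a _ hreg _ hχ V₀ V V₁ hV hV2 W₀ W W₁ hW hW2 _ hturn hedge ?_
    rw [hγ.1.2.1]
    exact hδ _ (hreconstruct _ (hpriors γ hγ))
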